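/- Let $O\subset\mathbb R^2$ be the regular octagon centred at the origin with sides of length one and two horizontal sides, with vertices $O_1,\dots,O_8$ listed clockwise, $\overline{O_1O_2}$ being the horizontal top side. Let $S_O$ be the surface obtained from $O$ by identifying opposite sides by translations, and label the pairs of identified sides $\overline{O_1O_2}=\overline{O_6O_5}$, $\overline{O_2O_3}=\overline{O_7O_6}$, $\overline{O_3O_4}=\overline{O_8O_7}$, $\overline{O_4O_5}=\overline{O_1O_8}$ by $A,B,C,D$ respectively. A *bi-infinite linear trajectory* $\tau:\mathbb R\to S_O$ is a path moving with constant non-zero velocity on $S_O$ which never hits the vertices; it has direction $\theta$ if its velocity is a positive multiple of $(\cos\theta,\sin\theta)$. Its *cutting sequence* $c(\tau)\in\{A,B,C,D\}^{\mathbb Z}$ is the bi-infinite word of the labels of the sides crossed by $\tau$ as time increases (bi-infinite words are considered up to a shift of the index). A letter of a bi-infinite word $w$ is *sandwiched* if it is preceded and followed by the same letter, and the *derived sequence* $w'$ is the word obtained from $w$ by keeping only the sandwiched letters. Let $\Sigma_k=[k\pi/8,(k+1)\pi/8)$ for $0\le k\le 6$ and $\Sigma_7=[7\pi/8,\pi]$,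 and let $\nu_k$ be the isometry of $O$ (and the induced map of $S_O$) which maps $\overline\Sigma_k$ to $\overline\Sigma_0$, with matrix, for $k=0,\dots,7$ and $s=\tfrac{\sqrt2}{2}$, $$\begin{pmatrix}1&0\\0&1\end{pmatrix},\ \begin{pmatrix}s&s\\s&-s\end{pmatrix},\ \begin{pmatrix}s&s\\-s&s\end{pmatrix},\ \begin{pmatrix}0&1\\1&0\end{pmatrix},\ \begin{pmatrix}0&1\\-1&0\end{pmatrix},\ \begin{pmatrix}-s&s\\s&s\end{pmatrix},\ \begin{pmatrix}-s&s\\-s&-s\end{pmatrix},\ \begin{pmatrix}-1&0\\0&1\end{pmatrix}.$$ Let $\Psi_\gamma:S_O\to S_O$ be the affine automorphism of $S_O$ with derivative $\gamma=\begin{pmatrix}-1&2(1+\sqrt2)\\0&1\end{pmatrix}$, that is, $\Psi_\gamma=\Upsilon\circ\gamma$ where the cut and paste map $\Upsilon$ from $\gamma O$ to $O$ is a translation on each of finitely many polygonal pieces. Let $\mathscr D_0$ be the diagram on $\{A,B,C,D\}$ with oriented edges $AD, DA, BD, DB, BC, CB, CC$, and, for $k=0,\dots,7$, let $\mathscr D_k$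 be the diagram which becomes $\mathscr D_0$ when its vertices are relabelled by $\pi_k$, where $\pi_0,\dots,\pi_7$ are $\mathrm{id}$, $(AD)(BC)$, $(ABCD)$, $(AC)$, $(AC)(BD)$, $(AB)(CD)$, $(ADCB)$, $(BD)$. A bi-infinite word is *admissible* if all its pairs of consecutive letters are edges of one and the same $\mathscr D_k$; it is *derivable* if it is admissible and its derived sequence is (defined and) admissible; it is *infinitely derivable* if it is derivable and, for each $n$, the result of deriving it $n$ times is again derivable. Then: 1. If $w$ is the cutting sequence of a bi-infinite linear trajectory in $S_O$, then its derived sequence $w'$ is a bi-infinite word (there are infinitely many sandwiched letters in both directions), and $w'$ is again the cutting sequence of a bi-infinite linear trajectory in $S_O$. 2. More precisely, if $\tau$ is a bi-infinite linear trajectory with velocity $v$ in direction $\theta\in\Sigma_k$, $0\le k\le7$, then $\nu_k^{-1}\Psi_\gamma\nu_k\tau$ is a bi-infinite linear trajectory, with velocity $\nu_k^{-1}\gamma\nu_k v$, and $c(\tau)'=c(\nu_k^{-1}\Psi_\gamma\nu_k\tau)$. 3. Every cutting sequence of a bi-infinite linear trajectory in $S_O$ is infinitely derivable. -/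

import Mathlib

noncomputable section

namespace OctagonCutting

/-! ### The regular octagon and the translation surface -/

/-- The alphabet labelling the four pairs of opposite sides. -/
inductive Letter
  | A | B | C | D

/-- The Euclidean plane, as column vectors (only its linear structure is used). -/
abbrev Plane : Type := Fin 2 → ℝ

/-- Distance from the centre to each side of the regular octagon with sides of length one. -/
def apothem : ℝ := (1 + √2) / 2

/-- The outward unit normals of the eight sides, clockwise from the horizontal top side:
`normal 0, …, normal 7` are the normals of `O₁O₂, O₂O₃, …, O₈O₁`. -/
def normal : Fin 8 → Plane :=
  ![![0, 1], ![√2 / 2, √2 / 2], ![1, 0], ![√2 / 2, -(√2 / 2)],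
    ![0, -1], ![-(√2 / 2), -(√2 / 2)], ![-1, 0], ![-(√2 / 2), √2 / 2]]

/-- The label of each side; opposite sides `i` and `i + 4` have the same label. -/
def label : Fin 8 → Letter := ![.A, .B, .C, .D, .A, .B, .C, .D]

/-- The closed regular octagon with unit sides, centred at the origin, with two horizontal sides. -/
def octagon : Set Plane := {p | ∀ i, normal i ⬝ᵥ p ≤ apothem}

/-- The `i`-th closed side. -/
def side (i : Fin 8) : Set Plane := {p | p ∈ octagon ∧ normal i ⬝ᵥ p = apothem}

/-- Vertices are the points lying on two different sides. -/
def IsVertex (p : Plane) : Prop := ∃ i j, i ≠ j ∧ p ∈ side i ∧ p ∈ side j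

/-- A point of the side `i` is identified with its translate on the opposite side `i + 4`. -/
def Glue (p q : octagon) : Prop :=
  ∃ i, p.1 ∈ side i ∧ q.1 = p.1 - (2 * apothem) • normal i

/-- The surface obtained from the octagon by gluing opposite sides by translation
(quotient by the equivalence relation generated by `Glue`). -/
def Surface : Type := Quot Glue

/-- The point of the surface represented by a point of the octagon. -/
def toSurface (p : Plane) (hp : p ∈ octagon) : Surface := Quot.mk _ ⟨p, hp⟩

/-- The point of the surface coming from the vertices. -/
def IsSingular (x : Surface) : Prop := ∃ p hp, IsVertex p ∧ x = toSurface p hp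

/-- `x` lies on the (glued) side with label `L`. -/
def OnSide (L : Letter) (x : Surface) : Prop :=
  ∃ i p hp, label i = L ∧ p ∈ side i ∧ x = toSurface p hp

/-! ### Linear trajectories and cutting sequences -/

/-- A bi-infinite linear trajectory with velocity `v ≠ 0`: it never meets the vertices, and around
each time `t` it moves along straight segments in the octagon with velocity `v`: forward from a
representative `p` of `τ t`, and backward from a representative `q` of `τ t`. (In the interior of
the octagon `p = q`; when a side is crossed, `q` is on the side which is hit and `p` is the
corresponding point of the opposite side.) -/
def IsTrajectory (τ : ℝ → Surface) (v : Plane) : Prop :=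
  v ≠ 0 ∧ ∀ t, ¬ IsSingular (τ t) ∧
    ∃ (p q : Plane) (ε : ℝ), 0 < ε ∧
      (∀ s, 0 ≤ s → s < ε → ∃ h : p + s • v ∈ octagon, τ (t + s) = toSurface (p + s • v) h) ∧
      (∀ s, 0 ≤ s → s < ε → ∃ h : q - s • v ∈ octagon, τ (t - s) = toSurface (q - s • v) h)

/-- A bi-infinite word. Words are considered up to a shift of the index, so being the cutting
sequence of a trajectory and being the derived sequence of a word are expressed by relations which
determine the word up to a shift. -/
abbrev Word : Type := ℤ → Letter

/-- `w` is the cutting sequence of the path `τ`: the times at which `τ` is on a side of the octagon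
form a bi-infinite increasing sequence, and `w` lists the labels of the sides crossed. -/
def IsCuttingSequenceOf (τ : ℝ → Surface) (w : Word) : Prop :=
  ∃ t : ℤ → ℝ, StrictMono t ∧ Set.range t = {s | ∃ L, OnSide L (τ s)} ∧
    ∀ n, OnSide (w n) (τ (t n))

/-- `w` is the cutting sequence of some bi-infinite linear trajectory. -/
def IsCuttingSequence (w : Word) : Prop :=
  ∃ τ v, IsTrajectory τ v ∧ IsCuttingSequenceOf τ w

/-! ### Derivation -/

/-- The letter in position `n` is preceded and followed by the same letter. -/
def IsSandwiched (w : Word) (n : ℤ) : Prop := w (n - 1) = w (n + 1)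

/-- `w'` is the derived sequence of `w`: it is the bi-infinite word obtained by keeping only the
sandwiched letters of `w`, in their order. -/
def IsDerivedSequence (w w' : Word) : Prop :=
  ∃ e : ℤ → ℤ, StrictMono e ∧ Set.range e = {n | IsSandwiched w n} ∧ ∀ n, w' n = w (e n)

/-- The edges of the transition diagram of the sector `0`. -/
def diagramZero : Letter → Letter → Prop
  | .A, .D => True
  | .B, .C => True
  | .B, .D => True
  | .C, .C => True
  | .C, .B => True
  | .D, .A => True
  | .D, .B => True
  | _, _ => False

/-- The permutation of the labels given by cycles
`id, (AD)(BC), (ABCD), (AC), (AC)(BD), (AB)(CD), (ADCB), (BD)`: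
the lists are the images of `A, B, C, D`. -/
def labelPerm (k : Fin 8) : Letter → Letter
  | .A => (![.A, .D, .B, .C, .C, .B, .D, .A] : Fin 8 → Letter) k
  | .B => (![.B, .C, .C, .B, .D, .A, .A, .D] : Fin 8 → Letter) k
  | .C => (![.C, .B, .D, .A, .A, .D, .B, .C] : Fin 8 → Letter) k
  | .D => (![.D, .A, .A, .D, .B, .C, .C, .B] : Fin 8 → Letter) k

/-- The transition diagram of the sector `k`: relabelling its vertices by the `k`-th permutation
gives the diagram of the sector `0`. -/
def diagram (k : Fin 8) (L L' : Letter) : Prop := diagramZero (labelPerm k L) (labelPerm k L')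

/-- All transitions of `w` are edges of one of the eight diagrams. -/
def Admissible (w : Word) : Prop := ∃ k, ∀ n, diagram k (w n) (w (n + 1))

/-- `w` is admissible and so is its derived sequence. -/
def Derivable (w : Word) : Prop := Admissible w ∧ ∃ w', IsDerivedSequence w w' ∧ Admissible w'

/-- `w` can be derived indefinitely, and all the words so obtained (including `w`) are
derivable. -/
def InfinitelyDerivable (w : Word) : Prop :=
  ∃ u : ℕ → Word, u 0 = w ∧ ∀ n, IsDerivedSequence (u n) (u (n + 1)) ∧ Derivable (u n)

/-! ### Directions and sectors -/

/-- `v` is a positive multiple of the unit vector making an angle `θ` with the horizontal. -/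
def HasDirection (v : Plane) (θ : ℝ) : Prop := ∃ r > 0, v = r • ![Real.cos θ, Real.sin θ]

/-- The sectors `[kπ/8, (k+1)π/8)` for `k < 7` and `[7π/8, π]` for `k = 7`. -/
def sector (k : Fin 8) : Set ℝ :=
  if k = 7 then Set.Icc (7 * Real.pi / 8) Real.pi
  else Set.Ico (k.val * Real.pi / 8) ((k.val + 1) * Real.pi / 8)

/-! ### Coordinates for the octagon -/

/-- Half of the sum of the lengths of a side and of a longest horizontal diagonal: the octagon is
`|x|, |y| ≤ apothem`, `|x + y|, |x - y| ≤ halfOuter`. -/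
def halfOuter : ℝ := 1 + √2 / 2

lemma sqrt_two_sq : √2 * √2 = (2 : ℝ) := Real.mul_self_sqrt (by norm_num)

lemma sqrt_two_pos : (0 : ℝ) < √2 := Real.sqrt_pos.mpr (by norm_num)

lemma apothem_eq : apothem = halfOuter - 1 / 2 := by unfold apothem halfOuter; ring

lemma two_apothem : 2 * apothem = √2 * halfOuter := by
  unfold apothem halfOuter; linear_combination (-1 / 2) * sqrt_two_sq

lemma apothem_pos : 0 < apothem := by have := sqrt_two_pos; unfold apothem; positivity

lemma halfOuter_pos : 0 < halfOuter := by have := sqrt_two_pos; unfold halfOuter; positivity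

lemma half_lt_apothem : 1 / 2 < apothem := by
  have := sqrt_two_pos; unfold apothem; linarith

lemma diag_iff (z : ℝ) : √2 / 2 * z ≤ apothem ↔ z ≤ halfOuter := by
  have h := two_apothem
  have h2 := sqrt_two_pos
  constructor
  · intro hz
    have : √2 * z ≤ √2 * halfOuter := by linarith
    exact le_of_mul_le_mul_left this h2
  · intro hz
    have := mul_le_mul_of_nonneg_left hz h2.le
    linarith

lemma diag_eq_iff (z : ℝ) : √2 / 2 * z = apothem ↔ z = halfOuter := by
  have h := two_apothem
  have h2 := sqrt_two_pos
  constructor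
  · intro hz
    have : √2 * z = √2 * halfOuter := by linarith
    exact mul_left_cancel₀ h2.ne' this
  · rintro rfl
    linarith

lemma mem_octagon_iff (p : Plane) : p ∈ octagon ↔
    (p 0 ≤ apothem ∧ -p 0 ≤ apothem) ∧ (p 1 ≤ apothem ∧ -p 1 ≤ apothem) ∧
    (p 0 + p 1 ≤ halfOuter ∧ -p 0 - p 1 ≤ halfOuter) ∧
    (p 0 - p 1 ≤ halfOuter ∧ p 1 - p 0 ≤ halfOuter) := by
  have e1 := diag_iff (p 0 + p 1)
  have e2 := diag_iff (-p 0 - p 1)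
  have e3 := diag_iff (p 0 - p 1)
  have e4 := diag_iff (p 1 - p 0)
  rw [← e1, ← e2, ← e3, ← e4]
  simp only [octagon, Set.mem_ofPred_eq, Fin.forall_fin_succ, normal, dotProduct, Fin.sum_univ_two]
  simp
  constructor
  · rintro ⟨h0, h1, h2, h3, h4, h5, h6, h7⟩
    refine ⟨⟨?_, ?_⟩, ⟨?_, ?_⟩, ⟨?_, ?_⟩, ?_, ?_⟩ <;> linarith
  · rintro ⟨⟨h0, h1⟩, ⟨h2, h3⟩, ⟨h4, h5⟩, h6, h7⟩
    refine ⟨?_, ?_, ?_, ?_, ?_, ?_, ?_, ?_⟩ <;> linarith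

/-! ### The isometries of the octagon -/

/-- The isometries `ν₀, …, ν₇`. -/
def nuMatrix : Fin 8 → Matrix (Fin 2) (Fin 2) ℝ :=
  ![!![1, 0; 0, 1],
    !![√2 / 2, √2 / 2; √2 / 2, -(√2 / 2)],
    !![√2 / 2, √2 / 2; -(√2 / 2), √2 / 2],
    !![0, 1; 1, 0],
    !![0, 1; -1, 0],
    !![-(√2 / 2), √2 / 2; √2 / 2, √2 / 2],
    !![-(√2 / 2), √2 / 2; -(√2 / 2), -(√2 / 2)],
    !![-1, 0; 0, 1]]

/-- `M` is an orthogonal matrix which, like its inverse (its transpose), maps the outward normals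
of the sides of the octagon to outward normals; so it is an isometry of the octagon. -/
def IsOctagonIsometry (M : Matrix (Fin 2) (Fin 2) ℝ) : Prop :=
  (M.transpose * M = 1 ∧ M * M.transpose = 1) ∧
    (∀ i, ∃ j, M.mulVec (normal i) = normal j) ∧
    (∀ i, ∃ j, M.transpose.mulVec (normal i) = normal j)

lemma IsOctagonIsometry.transpose {M : Matrix (Fin 2) (Fin 2) ℝ} (h : IsOctagonIsometry M) :
    IsOctagonIsometry M.transpose := by
  obtain ⟨⟨h1, h2⟩, h3, h4⟩ := h
  exact ⟨⟨by simpa using h2, by simpa using h1⟩, h4, by simpa using h3⟩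

lemma dot_mulVec (M : Matrix (Fin 2) (Fin 2) ℝ) (v p : Plane) :
    v ⬝ᵥ M.mulVec p = M.transpose.mulVec v ⬝ᵥ p := by
  rw [Matrix.dotProduct_mulVec, Matrix.mulVec_transpose]

lemma IsOctagonIsometry.mem {M : Matrix (Fin 2) (Fin 2) ℝ} (h : IsOctagonIsometry M) {p : Plane}
    (hp : p ∈ octagon) : M.mulVec p ∈ octagon := by
  intro i
  obtain ⟨j, hj⟩ := h.2.2 i
  rw [dot_mulVec, hj]
  exact hp j

lemma IsOctagonIsometry.glue {M : Matrix (Fin 2) (Fin 2) ℝ} (h : IsOctagonIsometry M)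
    {p q : octagon} (hpq : Glue p q) :
    Glue ⟨M.mulVec p.1, h.mem p.2⟩ ⟨M.mulVec q.1, h.mem q.2⟩ := by
  obtain ⟨i, hi, hq⟩ := hpq
  obtain ⟨j, hj⟩ := h.2.1 i
  refine ⟨j, ⟨h.mem p.2, ?_⟩, ?_⟩
  · rw [← hj, dot_mulVec, Matrix.mulVec_mulVec, h.1.1, Matrix.one_mulVec]
    exact hi.2
  · simp only [hq, Matrix.mulVec_sub, Matrix.mulVec_smul, hj]

/-- The action on the surface of an isometry of the octagon. -/
def isometryMap {M : Matrix (Fin 2) (Fin 2) ℝ} (h : IsOctagonIsometry M) : Surface → Surface :=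
  Quot.map (fun p => ⟨M.mulVec p.1, h.mem p.2⟩) (fun _ _ hpq => h.glue hpq)

lemma nuMatrix_isometry (k : Fin 8) : IsOctagonIsometry (nuMatrix k) := by
  have e : √2 / 2 * (√2 / 2) = (1 : ℝ) / 2 := by linear_combination (1 / 4) * sqrt_two_sq
  have hf : ∀ i, (nuMatrix k).mulVec (normal i) = normal
      ((![i, 3 - i, i + 1, 2 - i, i + 2, 1 - i, i + 3, -i] : Fin 8 → Fin 8) k) := by
    intro i
    fin_cases k <;> fin_cases i <;> ext m <;> fin_cases m <;>
      simp [nuMatrix, normal, Matrix.mulVec, dotProduct, Fin.sum_univ_two, e] <;> norm_num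
  have hg : ∀ i, (nuMatrix k).transpose.mulVec (normal i) = normal
      ((![i, 3 - i, i - 1, 2 - i, i - 2, 1 - i, i - 3, -i] : Fin 8 → Fin 8) k) := by
    intro i
    fin_cases k <;> fin_cases i <;> ext m <;> fin_cases m <;>
      simp [nuMatrix, normal, Matrix.mulVec, dotProduct, Fin.sum_univ_two, e] <;> norm_num
  refine ⟨⟨?_, ?_⟩, fun i => ⟨_, hf i⟩, fun i => ⟨_, hg i⟩⟩
  · fin_cases k <;> ext m n <;> fin_cases m <;> fin_cases n <;>
      simp [nuMatrix, Matrix.mul_apply, Fin.sum_univ_two, e] <;> norm_num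
  · fin_cases k <;> ext m n <;> fin_cases m <;> fin_cases n <;>
      simp [nuMatrix, Matrix.mul_apply, Fin.sum_univ_two, e] <;> norm_num

/-- The bijection of the surface induced by the isometry `νₖ`; its inverse is induced by `νₖ⁻¹`. -/
def nu (k : Fin 8) : Surface ≃ Surface where
  toFun := isometryMap (nuMatrix_isometry k)
  invFun := isometryMap (nuMatrix_isometry k).transpose
  left_inv := by
    rintro ⟨p⟩
    refine congrArg (Quot.mk Glue) (Subtype.ext ?_)
    change (nuMatrix k).transpose.mulVec ((nuMatrix k).mulVec p.1) = p.1
    rw [Matrix.mulVec_mulVec, (nuMatrix_isometry k).1.1, Matrix.one_mulVec]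
  right_inv := by
    rintro ⟨p⟩
    refine congrArg (Quot.mk Glue) (Subtype.ext ?_)
    change (nuMatrix k).mulVec ((nuMatrix k).transpose.mulVec p.1) = p.1
    rw [Matrix.mulVec_mulVec, (nuMatrix_isometry k).1.2, Matrix.one_mulVec]

/-! ### The affine reflection `Ψ_γ`

The horizontal diagonals `O₈O₃` (`y = 1/2`) and `O₇O₄` (`y = -1/2`) cut the surface into two
horizontal cylinders: the middle rectangle `|y| ≤ 1/2`, of circumference `2 * apothem = 1 + √2`,
closed up along the sides `C`; and the outer cylinder, obtained from the top trapezoid and from the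
bottom trapezoid translated by `(halfOuter, halfOuter)` (so that they are glued along the side `B`),
of circumference `2 * halfOuter = 2 + √2`, closed up along the sides `D`. -/

/-- The matrix `γ`. -/
def gammaMatrix : Matrix (Fin 2) (Fin 2) ℝ := !![-1, 2 * (1 + √2); 0, 1]

lemma circ_middle_pos : 0 < 2 * apothem := by have := apothem_pos; positivity

lemma circ_outer_pos : 0 < 2 * halfOuter := by have := halfOuter_pos; positivity

/-- The point of the middle rectangle which differs from `(u, y)` by a horizontal translation by a
multiple of the circumference of the middle cylinder. -/
def middlePoint (u y : ℝ) : Plane := ![toIcoMod circ_middle_pos (-apothem) u, y]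

/-- The point of the octagon, in the top or in the bottom trapezoid, obtained from `(u, y)`,
`1/2 ≤ y ≤ apothem`, by a horizontal translation by a multiple of the circumference of the outer
cylinder, followed in the second case by the translation by `(-halfOuter, -halfOuter)`. -/
def outerPoint (u y : ℝ) : Plane :=
  if toIcoMod circ_outer_pos (y - halfOuter) u ≤ halfOuter - y then
    ![toIcoMod circ_outer_pos (y - halfOuter) u, y]
  else ![toIcoMod circ_outer_pos (y - halfOuter) u - halfOuter, y - halfOuter]

/-- The cut and paste map `Υ` from the affine octagon `γ O` to `O`: it is a translation on each of
finitely many polygonal pieces of `γ O`, and its linear part is the identity. -/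
def cutPaste (q : Plane) : Plane :=
  if |q 1| ≤ 1 / 2 then middlePoint (q 0) (q 1)
  else if 0 < q 1 then outerPoint (q 0 - 2 * apothem) (q 1)
  else outerPoint (q 0 + 2 * apothem + halfOuter) (q 1 + halfOuter)

lemma middlePoint_mem (u : ℝ) {y : ℝ} (h : |y| ≤ 1 / 2) : middlePoint u y ∈ octagon := by
  obtain ⟨h1, h2⟩ := abs_le.mp h
  have h3 := toIcoMod_mem_Ico circ_middle_pos (-apothem) u
  have h4 := apothem_eq
  have h5 := half_lt_apothem
  rw [mem_octagon_iff]
  simp only [middlePoint, Matrix.cons_val_zero, Matrix.cons_val_one]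
  obtain ⟨h6, h7⟩ := h3
  refine ⟨⟨?_, ?_⟩, ⟨?_, ?_⟩, ⟨?_, ?_⟩, ?_, ?_⟩ <;> linarith

lemma outerPoint_mem (u : ℝ) {y : ℝ} (h : 1 / 2 ≤ y) (h' : y ≤ apothem) :
    outerPoint u y ∈ octagon := by
  have h3 := toIcoMod_mem_Ico circ_outer_pos (y - halfOuter) u
  have h4 := apothem_eq
  have h5 := half_lt_apothem
  obtain ⟨h6, h7⟩ := h3
  rw [mem_octagon_iff, outerPoint]
  split_ifs with hc
  all_goals
    simp only [Matrix.cons_val_zero, Matrix.cons_val_one]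
    refine ⟨⟨?_, ?_⟩, ⟨?_, ?_⟩, ⟨?_, ?_⟩, ?_, ?_⟩ <;> linarith

lemma cutPaste_mem {q : Plane} (h : -apothem ≤ q 1 ∧ q 1 ≤ apothem) : cutPaste q ∈ octagon := by
  have h4 := apothem_eq
  unfold cutPaste
  split_ifs with h1 h2
  · exact middlePoint_mem _ h1
  · rw [abs_of_pos h2] at h1
    exact outerPoint_mem _ (by linarith) h.2
  · rw [abs_of_nonpos (by linarith)] at h1
    exact outerPoint_mem _ (by linarith [h.1]) (by linarith)

lemma gammaMatrix_mulVec (p : Plane) :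
    gammaMatrix.mulVec p = ![-p 0 + 4 * apothem * p 1, p 1] := by
  ext m
  fin_cases m
  · change gammaMatrix.mulVec p 0 = -p 0 + 4 * apothem * p 1
    have : gammaMatrix.mulVec p 0 = -1 * p 0 + 2 * (1 + √2) * p 1 := by
      simp [gammaMatrix, Matrix.mulVec, dotProduct, Fin.sum_univ_two]
    rw [this, apothem]
    ring
  · simp [gammaMatrix, Matrix.mulVec, dotProduct, Fin.sum_univ_two]

lemma cutPaste_gamma_mem {p : Plane} (hp : p ∈ octagon) :
    cutPaste (gammaMatrix.mulVec p) ∈ octagon := by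
  rw [mem_octagon_iff] at hp
  apply cutPaste_mem
  rw [gammaMatrix_mulVec]
  change -apothem ≤ p 1 ∧ p 1 ≤ apothem
  constructor <;> linarith [hp.2.1.1, hp.2.1.2]

/-- The map `Υ ∘ γ` from the octagon to the surface. -/
def psiPoint (p : octagon) : Surface :=
  toSurface (cutPaste (gammaMatrix.mulVec p.1)) (cutPaste_gamma_mem p.2)

lemma apothem_sq : 4 * apothem * apothem - 2 * apothem = 2 * halfOuter := by
  unfold apothem halfOuter; linear_combination sqrt_two_sq

lemma toSurface_eq_of_eq {p q : Plane} (hp : p ∈ octagon) (hq : q ∈ octagon) (h : p = q) :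
    toSurface p hp = toSurface q hq := by subst h; rfl

lemma toSurface_eq_of_glue {p q : Plane} (hp : p ∈ octagon) (hq : q ∈ octagon) (i : Fin 8)
    (h : normal i ⬝ᵥ p = apothem) (h' : q = p - (2 * apothem) • normal i) :
    toSurface p hp = toSurface q hq :=
  Quot.sound ⟨i, ⟨hp, h⟩, h'⟩

lemma glue_A (x : ℝ) (hp : ![x, apothem] ∈ octagon) (hq : ![x, -apothem] ∈ octagon) :
    toSurface _ hp = toSurface _ hq := by
  refine toSurface_eq_of_glue hp hq 0 ?_ ?_
  · simp [normal]
  · ext m; fin_cases m <;> simp [normal]; ring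

lemma glue_B (x y : ℝ) (h : x + y = halfOuter) (hp : ![x, y] ∈ octagon)
    (hq : ![x - halfOuter, y - halfOuter] ∈ octagon) :
    toSurface _ hp = toSurface _ hq := by
  have e : 2 * apothem * (√2 / 2) = halfOuter := by
    rw [two_apothem]; linear_combination halfOuter / 2 * sqrt_two_sq
  refine toSurface_eq_of_glue hp hq 1 ?_ ?_
  · have := (diag_eq_iff (x + y)).mpr h
    simp [normal]; linarith
  · ext m; fin_cases m <;> simp [normal, e]

lemma glue_C (y : ℝ) (hp : ![apothem, y] ∈ octagon) (hq : ![-apothem, y] ∈ octagon) :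
    toSurface _ hp = toSurface _ hq := by
  refine toSurface_eq_of_glue hp hq 2 ?_ ?_
  · simp [normal]
  · ext m; fin_cases m <;> simp [normal]; ring

lemma glue_D (x y : ℝ) (h : x - y = halfOuter) (hp : ![x, y] ∈ octagon)
    (hq : ![x - halfOuter, y + halfOuter] ∈ octagon) :
    toSurface _ hp = toSurface _ hq := by
  have e : 2 * apothem * (√2 / 2) = halfOuter := by
    rw [two_apothem]; linear_combination halfOuter / 2 * sqrt_two_sq
  refine toSurface_eq_of_glue hp hq 3 ?_ ?_
  · have := (diag_eq_iff (x - y)).mpr h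
    simp [normal]; linarith
  · ext m; fin_cases m <;> simp [normal, e]

lemma toIcoMod_eq_of {c : ℝ} (hc : 0 < c) {b u X : ℝ} (n : ℤ) (hX : X = u + n * c) (h : b ≤ X)
    (h' : X < b + c) : toIcoMod hc b u = X := by
  rw [toIcoMod_eq_iff]
  exact ⟨⟨h, h'⟩, -n, by rw [hX]; simp⟩

lemma middle_eq {u y X : ℝ} (n : ℤ) (hX : X = u + n * (2 * apothem)) (hy : |y| ≤ 1 / 2)
    (h1 : -apothem ≤ X) (h2 : X ≤ apothem) (hm : ![X, y] ∈ octagon) :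
    toSurface (middlePoint u y) (middlePoint_mem u hy) = toSurface _ hm := by
  have ha := apothem_pos
  rcases h2.lt_or_eq with h2 | rfl
  · have := toIcoMod_eq_of circ_middle_pos n hX h1 (by linarith)
    exact toSurface_eq_of_eq _ _ (by rw [middlePoint, this])
  · have := toIcoMod_eq_of circ_middle_pos (X := -apothem) (b := -apothem) (u := u) (n - 1)
      (by push_cast; linarith) le_rfl (by linarith)
    have e : middlePoint u y = ![-apothem, y] := by rw [middlePoint, this]
    rw [toSurface_eq_of_eq _ (e ▸ middlePoint_mem u hy) e]
    exact (glue_C _ _ _).symm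

lemma outer_top {u y X : ℝ} (n : ℤ) (hX : X = u + n * (2 * halfOuter)) (hy : 1 / 2 ≤ y)
    (hy' : y ≤ apothem) (h1 : y - halfOuter ≤ X) (h2 : X ≤ halfOuter - y)
    (hm : ![X, y] ∈ octagon) :
    toSurface (outerPoint u y) (outerPoint_mem u hy hy') = toSurface _ hm := by
  have := toIcoMod_eq_of circ_outer_pos n hX h1 (by linarith)
  exact toSurface_eq_of_eq _ _ (by rw [outerPoint, this, if_pos h2])

lemma outer_bottom {u y X : ℝ} (n : ℤ) (hX : X = u + n * (2 * halfOuter)) (hy : 1 / 2 ≤ y)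
    (hy' : y ≤ apothem) (h1 : halfOuter - y ≤ X) (h2 : X ≤ halfOuter + y)
    (hm : ![X - halfOuter, y - halfOuter] ∈ octagon) :
    toSurface (outerPoint u y) (outerPoint_mem u hy hy') = toSurface _ hm := by
  have ha := apothem_eq
  have hb := half_lt_apothem
  rcases h2.lt_or_eq with h2 | h2
  · have := toIcoMod_eq_of circ_outer_pos (b := y - halfOuter) n hX (by linarith) (by linarith)
    rcases h1.lt_or_eq with h1 | h1
    · exact toSurface_eq_of_eq _ _ (by rw [outerPoint, this, if_neg (not_le.mpr h1)])
    · have e : outerPoint u y = ![X, y] := by rw [outerPoint, this, if_pos h1.ge]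
      rw [toSurface_eq_of_eq _ (e ▸ outerPoint_mem u hy hy') e]
      exact glue_B _ _ (by linarith) _ _
  · have := toIcoMod_eq_of circ_outer_pos (X := y - halfOuter) (b := y - halfOuter) (u := u) (n - 1)
      (by push_cast; linarith) le_rfl (by linarith)
    have e : outerPoint u y = ![X - halfOuter - halfOuter, y - halfOuter + halfOuter] := by
      rw [outerPoint, this, if_pos (by linarith), h2]
      ext m; fin_cases m <;> simp
    rw [toSurface_eq_of_eq _ (e ▸ outerPoint_mem u hy hy') e]
    exact (glue_D _ _ (by linarith) _ _).symm

lemma psiPoint_middle (p : octagon) (h : |p.1 1| ≤ 1 / 2) :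
    psiPoint p = toSurface (middlePoint (-p.1 0 + 4 * apothem * p.1 1) (p.1 1))
      (middlePoint_mem _ h) := by
  refine toSurface_eq_of_eq _ _ ?_
  rw [gammaMatrix_mulVec, cutPaste]
  simp [if_pos (one_div (2 : ℝ) ▸ h)]

lemma psiPoint_top (p : octagon) (h : 1 / 2 ≤ p.1 1) (h' : p.1 1 ≤ apothem) :
    psiPoint p = toSurface (outerPoint (-p.1 0 + 4 * apothem * p.1 1 - 2 * apothem) (p.1 1))
      (outerPoint_mem _ h h') := by
  have hp := (mem_octagon_iff _).mp p.2
  have ha := apothem_eq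
  rcases h.lt_or_eq with h1 | h1
  · refine toSurface_eq_of_eq _ _ ?_
    rw [gammaMatrix_mulVec, cutPaste, if_neg, if_pos]
    · rfl
    · change 0 < p.1 1
      linarith
    · change ¬ |p.1 1| ≤ 1 / 2
      rw [abs_of_pos (by linarith)]; linarith
  · have hm : ![-p.1 0, p.1 1] ∈ octagon := by
      rw [mem_octagon_iff]
      simp only [Matrix.cons_val_zero, Matrix.cons_val_one]
      refine ⟨⟨?_, ?_⟩, ⟨?_, ?_⟩, ⟨?_, ?_⟩, ?_, ?_⟩ <;> linarith
    have hy : |p.1 1| ≤ 1 / 2 := by rw [abs_of_pos (by linarith)]; linarith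
    rw [psiPoint_middle p hy,
      middle_eq (X := -p.1 0) (-1) (by rw [← h1]; push_cast; ring) hy (by linarith) (by linarith) hm,
      outer_top (X := -p.1 0) 0 (by rw [← h1]; push_cast; ring) h h' (by linarith) (by linarith) hm]

lemma psiPoint_bottom (p : octagon) (h : -apothem ≤ p.1 1) (h' : p.1 1 ≤ -(1 / 2)) :
    psiPoint p = toSurface
      (outerPoint (-p.1 0 + 4 * apothem * p.1 1 + 2 * apothem + halfOuter) (p.1 1 + halfOuter))
      (outerPoint_mem _ (by linarith [apothem_eq]) (by linarith [apothem_eq])) := by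
  have hp := (mem_octagon_iff _).mp p.2
  have ha := apothem_eq
  rcases h'.lt_or_eq with h1 | h1
  · refine toSurface_eq_of_eq _ _ ?_
    rw [gammaMatrix_mulVec, cutPaste, if_neg, if_neg]
    · rfl
    · change ¬ 0 < p.1 1
      linarith
    · change ¬ |p.1 1| ≤ 1 / 2
      rw [abs_of_neg (by linarith)]; linarith
  · have hm : ![-p.1 0, p.1 1] ∈ octagon := by
      rw [mem_octagon_iff]
      simp only [Matrix.cons_val_zero, Matrix.cons_val_one]
      refine ⟨⟨?_, ?_⟩, ⟨?_, ?_⟩, ⟨?_, ?_⟩, ?_, ?_⟩ <;> linarith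
    have hy : |p.1 1| ≤ 1 / 2 := by rw [abs_of_neg (by linarith)]; linarith
    have e : ![-p.1 0, p.1 1] =
        ![(-p.1 0 + halfOuter) - halfOuter, (p.1 1 + halfOuter) - halfOuter] := by simp
    rw [psiPoint_middle p hy,
      middle_eq (X := -p.1 0) 1 (by rw [h1]; push_cast; ring) hy (by linarith) (by linarith) hm,
      outer_bottom (X := -p.1 0 + halfOuter) 0 (by rw [h1]; push_cast; ring)
        (by linarith) (by linarith) (by linarith) (by linarith) (e ▸ hm)]
    exact toSurface_eq_of_eq _ _ e

lemma glue_symm {p q : octagon} (i : Fin 8) (hi : normal i ⬝ᵥ p.1 = apothem)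
    (hq : q.1 = p.1 - (2 * apothem) • normal i) :
    normal (i + 4) ⬝ᵥ q.1 = apothem ∧ p.1 = q.1 - (2 * apothem) • normal (i + 4) := by
  have e : √2 / 2 * (√2 / 2) = (1 : ℝ) / 2 := by linear_combination (1 / 4) * sqrt_two_sq
  have h1 : normal (i + 4) = -normal i := by
    fin_cases i <;> ext m <;> fin_cases m <;> simp [normal]
  have h2 : normal i ⬝ᵥ normal i = 1 := by
    fin_cases i <;> simp [normal, e] <;> norm_num
  refine ⟨?_, ?_⟩
  · rw [hq, h1, neg_dotProduct, dotProduct_sub, dotProduct_smul, hi, h2, smul_eq_mul]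
    ring
  · rw [hq, h1, smul_neg]
    simp

lemma psiPoint_glue_aux {p q : octagon} (i : Fin 8) (hi : i.val < 4)
    (hp : normal i ⬝ᵥ p.1 = apothem) (hq : q.1 = p.1 - (2 * apothem) • normal i) :
    psiPoint p = psiPoint q := by
  have hpm := (mem_octagon_iff _).mp p.2
  have hqm := (mem_octagon_iff _).mp q.2
  have ha := apothem_eq
  have hsq := apothem_sq
  have hb := half_lt_apothem
  have e : 2 * apothem * (√2 / 2) = halfOuter := by
    rw [two_apothem]; linear_combination halfOuter / 2 * sqrt_two_sq
  have hpc : normal i 0 * p.1 0 + normal i 1 * p.1 1 = apothem := by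
    rw [← hp, dotProduct, Fin.sum_univ_two]
  have hq0 : q.1 0 = p.1 0 - 2 * apothem * normal i 0 := by rw [hq]; rfl
  have hq1 : q.1 1 = p.1 1 - 2 * apothem * normal i 1 := by rw [hq]; rfl
  obtain rfl | rfl | rfl | rfl : i = 0 ∨ i = 1 ∨ i = 2 ∨ i = 3 := by
    have : ∀ j : Fin 8, j.val < 4 → j = 0 ∨ j = 1 ∨ j = 2 ∨ j = 3 := by decide
    exact this i hi
  · have n0 : normal 0 0 = 0 := rfl
    have n1 : normal 0 1 = 1 := rfl
    rw [n0, n1] at hpc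
    rw [n0] at hq0
    rw [n1] at hq1
    have hpy : p.1 1 = apothem := by linarith
    have hqy : q.1 1 = -apothem := by linarith
    have hm : ![-p.1 0, p.1 1] ∈ octagon := by
      rw [mem_octagon_iff]
      simp only [Matrix.cons_val_zero, Matrix.cons_val_one]
      refine ⟨⟨?_, ?_⟩, ⟨?_, ?_⟩, ⟨?_, ?_⟩, ?_, ?_⟩ <;> linarith
    have hm' : ![-p.1 0, q.1 1] ∈ octagon := by
      rw [mem_octagon_iff]
      simp only [Matrix.cons_val_zero, Matrix.cons_val_one]
      refine ⟨⟨?_, ?_⟩, ⟨?_, ?_⟩, ⟨?_, ?_⟩, ?_, ?_⟩ <;> linarith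
    have e' : ![-p.1 0, q.1 1] =
        ![(-p.1 0 + halfOuter) - halfOuter, (q.1 1 + halfOuter) - halfOuter] := by simp
    rw [psiPoint_top p (by linarith) (by linarith), psiPoint_bottom q (by linarith) (by linarith),
      outer_top (X := -p.1 0) (-1) (by rw [hpy]; push_cast; linarith) (by linarith) (by linarith)
        (by linarith) (by linarith) hm,
      outer_bottom (X := -p.1 0 + halfOuter) 1 (by rw [hqy, hq0]; push_cast; linarith)
        (by linarith) (by linarith) (by linarith) (by linarith) (e' ▸ hm')]
    have e1 : ![-p.1 0, p.1 1] = ![-p.1 0, apothem] := by rw [hpy]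
    have e2 : ![(-p.1 0 + halfOuter) - halfOuter, (q.1 1 + halfOuter) - halfOuter] =
        ![-p.1 0, -apothem] := by rw [← e', hqy]
    rw [toSurface_eq_of_eq hm (e1 ▸ hm) e1,
      toSurface_eq_of_eq (e' ▸ hm') (e2 ▸ e' ▸ hm') e2]
    exact glue_A _ _ _
  · have n0 : normal 1 0 = √2 / 2 := rfl
    have n1 : normal 1 1 = √2 / 2 := rfl
    rw [n0, n1] at hpc
    rw [n0, e] at hq0
    rw [n1, e] at hq1
    have hs : p.1 0 + p.1 1 = halfOuter := (diag_eq_iff _).mp (by linarith)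
    rw [psiPoint_top p (by linarith) (by linarith), psiPoint_bottom q (by linarith) (by linarith)]
    refine toSurface_eq_of_eq _ _ ?_
    rw [hq0, hq1]
    congr 1
    · have : 4 * apothem * halfOuter = 4 * apothem * apothem + 2 * apothem := by rw [ha]; ring
      linarith
    · ring
  · have n0 : normal 2 0 = 1 := rfl
    have n1 : normal 2 1 = 0 := rfl
    rw [n0, n1] at hpc
    rw [n0] at hq0
    rw [n1] at hq1
    have hqy : q.1 1 = p.1 1 := by linarith
    have hy : |p.1 1| ≤ 1 / 2 := by rw [abs_le]; constructor <;> linarith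
    rw [psiPoint_middle p hy, psiPoint_middle q (by rw [hqy]; exact hy)]
    refine toSurface_eq_of_eq _ _ ?_
    rw [hqy, hq0, middlePoint, middlePoint]
    congr 1
    rw [← toIcoMod_add_right circ_middle_pos]
    congr 1
    ring
  · have n0 : normal 3 0 = √2 / 2 := rfl
    have n1 : normal 3 1 = -(√2 / 2) := rfl
    rw [n0, n1] at hpc
    rw [n0, e] at hq0
    rw [n1] at hq1
    have hq1' : q.1 1 = p.1 1 + halfOuter := by linarith
    have hs : p.1 0 - p.1 1 = halfOuter := (diag_eq_iff _).mp (by linarith)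
    rw [psiPoint_bottom p (by linarith) (by linarith), psiPoint_top q (by linarith) (by linarith)]
    refine toSurface_eq_of_eq _ _ ?_
    have h4 : -q.1 0 + 4 * apothem * q.1 1 - 2 * apothem =
        -p.1 0 + 4 * apothem * p.1 1 + 2 * apothem + halfOuter + 2 * halfOuter := by
      have : 4 * apothem * halfOuter = 4 * apothem * apothem + 2 * apothem := by rw [ha]; ring
      rw [hq0, hq1']
      linarith
    rw [h4, hq1', outerPoint, outerPoint, toIcoMod_add_right circ_outer_pos]

lemma psiPoint_glue {p q : octagon} (h : Glue p q) : psiPoint p = psiPoint q := by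
  obtain ⟨i, hi, hq⟩ := h
  by_cases h4 : i.val < 4
  · exact psiPoint_glue_aux i h4 hi.2 hq
  · obtain ⟨hj, hp⟩ := glue_symm i hi.2 hq
    refine (psiPoint_glue_aux (i + 4) ?_ hj hp).symm
    revert h4
    clear hi hq hj hp
    revert i
    decide

/-- The affine reflection `Ψ_γ = Υ ∘ γ` of the surface, with linear part `γ`. -/
def psiGamma : Surface → Surface := Quot.lift psiPoint (fun _ _ h => psiPoint_glue h)

end OctagonCutting

end

/-! The isometry `nu k` permutes the labels of the sides by `labelPerm k` (`onSide_nu_iff`), and the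
central symmetry fixes every label (`onSide_neg_iff`). Both therefore carry cutting sequences to
relabelled cutting sequences, and it is enough to understand a trajectory with direction in the
closed sector [0, π/8].

For such a trajectory the cutting sequence of its image under `psiGamma` lists the crossings of the
preimages of the sides. The preimage of A is A itself. For L ≠ A the preimage of the side L is a
segment through the midpoint of L; in the octagon it appears as two opposite halves, each joining a
vertex to the midpoint of one of the two sides labelled L (`goodImage`, `exists_halfPoint_of_eq`).
Glue two copies of the octagon along L. The preimage becomes a diagonal of this pair: one end is the
vertex between the two sides of the first copy through which a trajectory about to cross L can have
entered, the other is the vertex between the two sides of the second copy through which it can then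
leave. The letters before and after L agree exactly when the trajectory passes between the two ends
(`sandwiched_iff_separates`), that is, when it crosses the diagonal, and it then does so once. The
letter A is always sandwiched, because D is its only neighbour in `diagramZero` (`sandwiched_A`). So
the sandwiched letters are in bijection with the crossings of the preimages
(`Chords.isSandwiched_iff`, `Chords.near_unique`), and the order is preserved (`Chords.near_lt`).
This gives `Chords.isCuttingSequenceOf_derived`.

To make this computable, the trajectory is cut at its crossings into chords, each on a line y = m x
+ b with a fixed slope m (`exists_unfolding`, `Chords`). The side through which a chord leaves
depends only on the interval containing b (`Leaves`), and crossing a side changes b by a constant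
depending on its label. Every comparison then becomes a linear inequality in b.

The transitions are edges of the diagram of the sector, and in a word admissible for a diagram
sandwiched letters occur with bounded gaps (`exists_isSandwiched`), so the derived sequence exists.
As it is again a cutting sequence, the argument iterates. -/

noncomputable section

namespace OctagonCutting

/-! ### Sides, vertices and the identifications -/

/-- The coordinate equation of the two lines carrying the sides with label `L`. -/
def SideEq : Letter → Plane → Prop
  | .A, p => p 1 = apothem ∨ p 1 = -apothem
  | .B, p => p 0 + p 1 = halfOuter ∨ p 0 + p 1 = -halfOuter
  | .C, p => p 0 = apothem ∨ p 0 = -apothem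
  | .D, p => p 0 - p 1 = halfOuter ∨ p 0 - p 1 = -halfOuter

/-- The coordinate equation of the line carrying the side `i`. -/
def LineEq (i : Fin 8) (p : Plane) : Prop :=
  (![p 1 = apothem, p 0 + p 1 = halfOuter, p 0 = apothem, p 0 - p 1 = halfOuter,
    p 1 = -apothem, p 0 + p 1 = -halfOuter, p 0 = -apothem, p 0 - p 1 = -halfOuter] :
    Fin 8 → Prop) i

lemma normal_dot_eq_iff (i : Fin 8) (p : Plane) : normal i ⬝ᵥ p = apothem ↔ LineEq i p := by
  have e1 := diag_eq_iff (p 0 + p 1)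
  have e2 := diag_eq_iff (-p 0 - p 1)
  have e3 := diag_eq_iff (p 0 - p 1)
  have e4 := diag_eq_iff (p 1 - p 0)
  have n5 : normal 5 = ![-(√2 / 2), -(√2 / 2)] := rfl
  have n6 : normal 6 = ![-1, 0] := rfl
  have n7 : normal 7 = ![-(√2 / 2), √2 / 2] := rfl
  have n4 : normal 4 = ![0, -1] := rfl
  have n3 : normal 3 = ![√2 / 2, -(√2 / 2)] := rfl
  have n2 : normal 2 = ![1, 0] := rfl
  have n1 : normal 1 = ![√2 / 2, √2 / 2] := rfl
  have n0 : normal 0 = ![0, 1] := rfl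
  fin_cases i <;>
    simp only [LineEq, dotProduct, Fin.sum_univ_two, Fin.zero_eta, Fin.mk_one, Fin.reduceFinMk,
      n0, n1, n2, n3, n4, n5, n6, n7, Matrix.cons_val, Matrix.cons_val_zero, Matrix.cons_val_one]
  · constructor <;> intro <;> linarith
  · rw [← e1]; constructor <;> intro <;> linarith
  · constructor <;> intro <;> linarith
  · rw [← e3]; constructor <;> intro <;> linarith
  · constructor <;> intro <;> linarith
  · rw [show p 0 + p 1 = -halfOuter ↔ -p 0 - p 1 = halfOuter by
      constructor <;> intro <;> linarith, ← e2]
    constructor <;> intro <;> linarith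
  · constructor <;> intro <;> linarith
  · rw [show p 0 - p 1 = -halfOuter ↔ p 1 - p 0 = halfOuter by
      constructor <;> intro <;> linarith, ← e4]
    constructor <;> intro <;> linarith

lemma mem_side_iff (i : Fin 8) (p : Plane) : p ∈ side i ↔ p ∈ octagon ∧ LineEq i p := by
  rw [← normal_dot_eq_iff]; rfl

lemma exists_side_iff (L : Letter) {p : Plane} (hp : p ∈ octagon) :
    (∃ i, label i = L ∧ p ∈ side i) ↔ SideEq L p := by
  simp only [mem_side_iff, hp, true_and]
  constructor
  · rintro ⟨i, rfl, h⟩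
    fin_cases i
    exacts [Or.inl h, Or.inl h, Or.inl h, Or.inl h, Or.inr h, Or.inr h, Or.inr h, Or.inr h]
  · cases L <;> rintro (h | h)
    exacts [⟨0, rfl, h⟩, ⟨4, rfl, h⟩, ⟨1, rfl, h⟩, ⟨5, rfl, h⟩, ⟨2, rfl, h⟩, ⟨6, rfl, h⟩,
      ⟨3, rfl, h⟩, ⟨7, rfl, h⟩]

/-- The coordinates of the vertices. -/
def VertexEq (p : Plane) : Prop :=
  ((p 0 = 1 / 2 ∨ p 0 = -(1 / 2)) ∧ (p 1 = apothem ∨ p 1 = -apothem)) ∨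
    ((p 0 = apothem ∨ p 0 = -apothem) ∧ (p 1 = 1 / 2 ∨ p 1 = -(1 / 2)))

lemma vertexEq_of_lineEq {p : Plane} (hp : p ∈ octagon) {i j : Fin 8} (hij : i ≠ j)
    (hi : LineEq i p) (hj : LineEq j p) : VertexEq p := by
  rw [mem_octagon_iff] at hp
  obtain ⟨⟨h1, h2⟩, ⟨h3, h4⟩, ⟨h5, h6⟩, h7, h8⟩ := hp
  have ha := apothem_eq
  have hb := half_lt_apothem
  wlog h : i < j generalizing i j
  · exact this hij.symm hj hi (lt_of_le_of_ne (not_lt.mp h) hij.symm)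
  unfold VertexEq
  fin_cases i <;> fin_cases j <;> first
    | exact absurd h (by decide)
    | (simp only [LineEq, Fin.zero_eta, Fin.mk_one, Fin.reduceFinMk, Matrix.cons_val,
        Matrix.cons_val_zero, Matrix.cons_val_one] at hi hj
       first
       | (exfalso; linarith)
       | exact Or.inl ⟨Or.inl (by linarith), Or.inl (by linarith)⟩
       | exact Or.inl ⟨Or.inr (by linarith), Or.inl (by linarith)⟩
       | exact Or.inl ⟨Or.inl (by linarith), Or.inr (by linarith)⟩
       | exact Or.inl ⟨Or.inr (by linarith), Or.inr (by linarith)⟩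
       | exact Or.inr ⟨Or.inl (by linarith), Or.inl (by linarith)⟩
       | exact Or.inr ⟨Or.inr (by linarith), Or.inl (by linarith)⟩
       | exact Or.inr ⟨Or.inl (by linarith), Or.inr (by linarith)⟩
       | exact Or.inr ⟨Or.inr (by linarith), Or.inr (by linarith)⟩)

lemma mem_octagon_of_vertexEq {p : Plane} (h : VertexEq p) : p ∈ octagon := by
  have ha := apothem_eq
  have hb := half_lt_apothem
  rw [mem_octagon_iff]
  rcases h with ⟨h1 | h1, h2 | h2⟩ | ⟨h1 | h1, h2 | h2⟩ <;>
    refine ⟨⟨?_, ?_⟩, ⟨?_, ?_⟩, ⟨?_, ?_⟩, ?_, ?_⟩ <;> linarith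

lemma isVertex_iff (p : Plane) : IsVertex p ↔ VertexEq p := by
  constructor
  · rintro ⟨i, j, hij, hi, hj⟩
    rw [mem_side_iff] at hi hj
    exact vertexEq_of_lineEq hi.1 hij hi.2 hj.2
  · intro h
    have hp := mem_octagon_of_vertexEq h
    have ha := apothem_eq
    have key : ∀ i j, i ≠ j → LineEq i p → LineEq j p → IsVertex p := fun i j hij hi hj =>
      ⟨i, j, hij, (mem_side_iff _ _).mpr ⟨hp, hi⟩, (mem_side_iff _ _).mpr ⟨hp, hj⟩⟩
    rcases h with ⟨h1 | h1, h2 | h2⟩ | ⟨h1 | h1, h2 | h2⟩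
    · exact key 0 1 (by decide) h2 (show p 0 + p 1 = halfOuter by linarith)
    · exact key 4 3 (by decide) h2 (show p 0 - p 1 = halfOuter by linarith)
    · exact key 0 7 (by decide) h2 (show p 0 - p 1 = -halfOuter by linarith)
    · exact key 4 5 (by decide) h2 (show p 0 + p 1 = -halfOuter by linarith)
    · exact key 2 1 (by decide) h1 (show p 0 + p 1 = halfOuter by linarith)
    · exact key 2 3 (by decide) h1 (show p 0 - p 1 = halfOuter by linarith)
    · exact key 6 7 (by decide) h1 (show p 0 - p 1 = -halfOuter by linarith)
    · exact key 6 5 (by decide) h1 (show p 0 + p 1 = -halfOuter by linarith)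

/-- The index of the side with outward normal in the right or upper half plane. -/
def sideIndex : Letter → Fin 8
  | .A => 0
  | .B => 1
  | .C => 2
  | .D => 3

/-- The translation vector `2 * apothem * normal` of the identification of the sides. -/
def shift : Letter → Plane
  | .A => ![0, 2 * apothem]
  | .B => ![halfOuter, halfOuter]
  | .C => ![2 * apothem, 0]
  | .D => ![halfOuter, -halfOuter]

lemma shift_eq (L : Letter) : shift L = (2 * apothem) • normal (sideIndex L) := by
  have e : 2 * apothem * (√2 / 2) = halfOuter := by
    rw [two_apothem]; linear_combination halfOuter / 2 * sqrt_two_sq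
  cases L <;> ext m <;> fin_cases m <;> simp [shift, sideIndex, normal, e]

lemma normal_add_four (i : Fin 8) : normal (i + 4) = -normal i := by
  fin_cases i <;> ext m <;> fin_cases m <;> simp [normal]

lemma sideIndex_cases (i : Fin 8) : i = sideIndex (label i) ∨ i = sideIndex (label i) + 4 := by
  fin_cases i <;> simp [sideIndex, label]

/-! ### Which points of the octagon are identified in the surface. -/

lemma Glue.symm {p q : octagon} (h : Glue p q) : Glue q p := by
  obtain ⟨i, hi, hq⟩ := h
  obtain ⟨h1, h2⟩ := glue_symm i hi.2 hq
  exact ⟨i + 4, ⟨q.2, h1⟩, h2⟩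

lemma Glue.exists_shift {p q : octagon} (h : Glue p q) :
    ∃ L, (LineEq (sideIndex L) p.1 ∧ q.1 = p.1 - shift L) ∨
      (LineEq (sideIndex L) q.1 ∧ p.1 = q.1 - shift L) := by
  obtain ⟨i, hi, hq⟩ := h
  refine ⟨label i, ?_⟩
  rcases sideIndex_cases i with h | h
  · exact Or.inl ⟨h ▸ ((mem_side_iff _ _).mp hi).2, by rw [shift_eq, ← h]; exact hq⟩
  · obtain ⟨h1, h2⟩ := glue_symm i hi.2 hq
    have e : i + 4 = sideIndex (label i) := by
      generalize label i = L at h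
      subst h
      cases L <;> rfl
    exact Or.inr ⟨by rw [← e, ← normal_dot_eq_iff]; exact h1, by rw [shift_eq, ← e]; exact h2⟩

lemma vertexEq_sub_shift_iff {p : Plane} {L : Letter} (hp : p ∈ octagon)
    (h : LineEq (sideIndex L) p) : VertexEq (p - shift L) ↔ VertexEq p := by
  have ha := apothem_eq
  have hb := half_lt_apothem
  rw [mem_octagon_iff] at hp
  cases L
  · replace h : p 1 = apothem := h
    have e0 : (p - shift .A) 0 = p 0 := by simp [shift]
    have e1 : (p - shift .A) 1 = p 1 - 2 * apothem := by simp [shift]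
    simp only [VertexEq, e0, e1]
    constructor
    · rintro (⟨h1, -⟩ | ⟨h1 | h1, -⟩)
      · exact Or.inl ⟨h1, Or.inl h⟩
      · exfalso; linarith
      · exfalso; linarith
    · rintro (⟨h1, -⟩ | ⟨h1 | h1, -⟩)
      · exact Or.inl ⟨h1, Or.inr (by linarith)⟩
      · exfalso; linarith
      · exfalso; linarith
  · replace h : p 0 + p 1 = halfOuter := h
    have e0 : (p - shift .B) 0 = p 0 - halfOuter := by simp [shift]
    have e1 : (p - shift .B) 1 = p 1 - halfOuter := by simp [shift]
    simp only [VertexEq, e0, e1]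
    constructor
    · rintro (⟨h1 | h1, h2 | h2⟩ | ⟨h1 | h1, h2 | h2⟩) <;> first
        | (exfalso; linarith)
        | exact Or.inl ⟨Or.inl (by linarith), Or.inl (by linarith)⟩
        | exact Or.inr ⟨Or.inl (by linarith), Or.inl (by linarith)⟩
    · rintro (⟨h1 | h1, h2 | h2⟩ | ⟨h1 | h1, h2 | h2⟩) <;> first
        | (exfalso; linarith)
        | exact Or.inl ⟨Or.inr (by linarith), Or.inr (by linarith)⟩
        | exact Or.inr ⟨Or.inr (by linarith), Or.inr (by linarith)⟩
  · replace h : p 0 = apothem := h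
    have e0 : (p - shift .C) 0 = p 0 - 2 * apothem := by simp [shift]
    have e1 : (p - shift .C) 1 = p 1 := by simp [shift]
    simp only [VertexEq, e0, e1]
    constructor
    · rintro (⟨-, h1 | h1⟩ | ⟨-, h1⟩)
      · exfalso; linarith
      · exfalso; linarith
      · exact Or.inr ⟨Or.inl h, h1⟩
    · rintro (⟨-, h1 | h1⟩ | ⟨-, h1⟩)
      · exfalso; linarith
      · exfalso; linarith
      · exact Or.inr ⟨Or.inr (by linarith), h1⟩
  · replace h : p 0 - p 1 = halfOuter := h
    have e0 : (p - shift .D) 0 = p 0 - halfOuter := by simp [shift]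
    have e1 : (p - shift .D) 1 = p 1 + halfOuter := by simp [shift]
    simp only [VertexEq, e0, e1]
    constructor
    · rintro (⟨h1 | h1, h2 | h2⟩ | ⟨h1 | h1, h2 | h2⟩) <;> first
        | (exfalso; linarith)
        | exact Or.inl ⟨Or.inl (by linarith), Or.inr (by linarith)⟩
        | exact Or.inr ⟨Or.inl (by linarith), Or.inr (by linarith)⟩
    · rintro (⟨h1 | h1, h2 | h2⟩ | ⟨h1 | h1, h2 | h2⟩) <;> first
        | (exfalso; linarith)
        | exact Or.inl ⟨Or.inr (by linarith), Or.inl (by linarith)⟩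
        | exact Or.inr ⟨Or.inr (by linarith), Or.inl (by linarith)⟩

lemma Glue.vertexEq_iff {p q : octagon} (h : Glue p q) : VertexEq p.1 ↔ VertexEq q.1 := by
  obtain ⟨L, ⟨h1, h2⟩ | ⟨h1, h2⟩⟩ := h.exists_shift
  · rw [h2, vertexEq_sub_shift_iff p.2 h1]
  · rw [h2, vertexEq_sub_shift_iff q.2 h1]

/-- A point of the boundary which is not a vertex lies on one side only, so it has a single partner.
-/
lemma Glue.eq_of_glue {p q r : octagon} (hq : ¬ VertexEq q.1) (h : Glue p q) (h' : Glue q r) :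
    p = r := by
  obtain ⟨i, hi, hpq⟩ := h.symm
  obtain ⟨j, hj, hqr⟩ := h'
  have : i = j := by
    by_contra hij
    exact hq ((isVertex_iff _).mp ⟨i, j, hij, hi, hj⟩)
  subst this
  exact Subtype.ext (hpq.trans hqr.symm)

lemma plane_eq {p : Plane} {x y : ℝ} (h0 : p 0 = x) (h1 : p 1 = y) : p = ![x, y] := by
  ext m; fin_cases m
  exacts [h0, h1]

lemma toSurface_vertex {p : Plane} (h : VertexEq p) :
    toSurface p (mem_octagon_of_vertexEq h) =
      toSurface ![1 / 2, apothem] (mem_octagon_of_vertexEq (Or.inl ⟨Or.inl rfl, Or.inl rfl⟩)) := by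
  have ha := apothem_eq
  have v : ∀ x y, ((x = 1 / 2 ∨ x = -(1 / 2)) ∧ (y = apothem ∨ y = -apothem)) ∨
    ((x = apothem ∨ x = -apothem) ∧ (y = 1 / 2 ∨ y = -(1 / 2))) → ![x, y] ∈ octagon :=
    fun x y h => mem_octagon_of_vertexEq (p := ![x, y]) h
  have m1 := v (1 / 2) apothem (by simp)
  have m2 := v (1 / 2) (-apothem) (by simp)
  have m3 := v (-(1 / 2)) apothem (by simp)
  have m4 := v (-(1 / 2)) (-apothem) (by simp)
  have m5 := v apothem (1 / 2) (by simp)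
  have m6 := v apothem (-(1 / 2)) (by simp)
  have m7 := v (-apothem) (1 / 2) (by simp)
  have m8 := v (-apothem) (-(1 / 2)) (by simp)
  have tr : ∀ {x y x' y' : ℝ} (hm : ![x, y] ∈ octagon) (hm' : ![x', y'] ∈ octagon) (L : Letter),
      LineEq (sideIndex L) ![x, y] → x' = x - shift L 0 → y' = y - shift L 1 →
      toSurface _ hm = toSurface _ hm' := by
    intro x y x' y' hm hm' L hL hx hy
    refine toSurface_eq_of_glue hm hm' (sideIndex L) ((normal_dot_eq_iff _ _).mpr hL) ?_
    rw [← shift_eq]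
    ext m; fin_cases m
    exacts [hx, hy]
  -- These seven gluings form a path through all eight vertices.
  have e2 := tr m1 m2 .A rfl (by simp [shift]) (by simp [shift]; ring)
  have e8 := tr m1 m8 .B (by simp [LineEq, sideIndex]; linarith)
    (by simp [shift]; linarith) (by simp [shift]; linarith)
  have e6 := tr m6 m8 .C rfl (by simp [shift]; ring) (by simp [shift])
  have e3 := tr m6 m3 .D (by simp [LineEq, sideIndex]; linarith)
    (by simp [shift]; linarith) (by simp [shift]; linarith)
  have e4 := tr m3 m4 .A rfl (by simp [shift]) (by simp [shift]; ring)
  have e5 := tr m5 m4 .B (by simp [LineEq, sideIndex]; linarith)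
    (by simp [shift]; linarith) (by simp [shift]; linarith)
  have e7 := tr m5 m7 .C rfl (by simp [shift]; ring) (by simp [shift])
  rcases h with ⟨h1 | h1, h2 | h2⟩ | ⟨h1 | h1, h2 | h2⟩ <;> obtain rfl := plane_eq h1 h2
  · rfl
  · exact e2.symm
  · exact e3.symm.trans (e6.trans e8.symm)
  · exact e4.symm.trans (e3.symm.trans (e6.trans e8.symm))
  · exact e5.trans (e4.symm.trans (e3.symm.trans (e6.trans e8.symm)))
  · exact e6.trans e8.symm
  · exact e7.symm.trans (e5.trans (e4.symm.trans (e3.symm.trans (e6.trans e8.symm))))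
  · exact e8.symm

/-- The vertices form a single class and every other point has at most one partner, so the relation
on the right is already an equivalence; only transitivity needs an argument. -/
lemma toSurface_eq_iff {p q : Plane} (hp : p ∈ octagon) (hq : q ∈ octagon) :
    toSurface p hp = toSurface q hq ↔
      p = q ∨ (VertexEq p ∧ VertexEq q) ∨ Glue ⟨p, hp⟩ ⟨q, hq⟩ := by
  constructor
  · intro h
    have key : ∀ x y : octagon, Relation.EqvGen Glue x y →
        x = y ∨ (VertexEq x.1 ∧ VertexEq y.1) ∨ Glue x y := by
      intro x y hxy
      induction hxy with
      | rel x y h => exact Or.inr (Or.inr h)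
      | refl x => exact Or.inl rfl
      | symm x y _ ih =>
        rcases ih with h | h | h
        exacts [Or.inl h.symm, Or.inr (Or.inl h.symm), Or.inr (Or.inr h.symm)]
      | trans x y z _ _ ih1 ih2 =>
        rcases ih1 with rfl | h | h
        · exact ih2
        · rcases ih2 with rfl | h' | h'
          · exact Or.inr (Or.inl h)
          · exact Or.inr (Or.inl ⟨h.1, h'.2⟩)
          · exact Or.inr (Or.inl ⟨h.1, h'.vertexEq_iff.mp h.2⟩)
        · rcases ih2 with rfl | h' | h'
          · exact Or.inr (Or.inr h)
          · exact Or.inr (Or.inl ⟨h.vertexEq_iff.mpr h'.1, h'.2⟩)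
          · by_cases hv : VertexEq y.1
            · exact Or.inr (Or.inl ⟨h.vertexEq_iff.mpr hv, h'.vertexEq_iff.mp hv⟩)
            · exact Or.inl (h.eq_of_glue hv h')
    rcases key _ _ (Quot.eqvGen_exact h) with h | h
    · exact Or.inl (congrArg Subtype.val h)
    · exact Or.inr h
  · rintro (h | ⟨h1, h2⟩ | h)
    · exact toSurface_eq_of_eq _ _ h
    · rw [toSurface_vertex h1, toSurface_vertex h2]
    · exact Quot.sound h

lemma isSingular_toSurface_iff {p : Plane} (hp : p ∈ octagon) :
    IsSingular (toSurface p hp) ↔ VertexEq p := by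
  constructor
  · rintro ⟨q, hq, hv, h⟩
    rw [isVertex_iff] at hv
    rcases (toSurface_eq_iff hp hq).mp h with rfl | h | h
    exacts [hv, h.1, h.vertexEq_iff.mpr hv]
  · intro h
    exact ⟨p, hp, (isVertex_iff p).mpr h, rfl⟩

/-- The label can be read on any representative: the partner of a point of the side i is on the side
i + 4, which has the same label. -/
lemma onSide_toSurface_iff {L : Letter} {p : Plane} (hp : p ∈ octagon) (hv : ¬ VertexEq p) :
    OnSide L (toSurface p hp) ↔ SideEq L p := by
  rw [← exists_side_iff L hp]
  constructor
  · rintro ⟨i, q, hq, hL, hi, h⟩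
    rcases (toSurface_eq_iff hp hq).mp h with rfl | h | h
    · exact ⟨i, hL, hi⟩
    · exact absurd h.1 hv
    · obtain ⟨j, hj, hpq⟩ := h.symm
      have : i = j := by
        by_contra hij
        exact hv (h.vertexEq_iff.mpr ((isVertex_iff _).mp ⟨i, j, hij, hi, hj⟩))
      subst this
      obtain ⟨h1, -⟩ := glue_symm (p := ⟨q, hq⟩) (q := ⟨p, hp⟩) i hi.2 hpq
      refine ⟨i + 4, ?_, hp, h1⟩
      rw [← hL]
      fin_cases i <;> rfl
  · rintro ⟨i, hL, hi⟩
    exact ⟨i, p, hp, hL, hi, rfl⟩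

lemma exists_rep (x : Surface) : ∃ p hp, x = toSurface p hp := by
  obtain ⟨⟨p, hp⟩, rfl⟩ := Quot.exists_rep x
  exact ⟨p, hp, rfl⟩

/-! ### Unfolding a trajectory along its cutting sequence -/

lemma exists_onSide_of_vertexEq {p : Plane} (hp : p ∈ octagon) (h : VertexEq p) :
    ∃ L, OnSide L (toSurface p hp) := by
  obtain ⟨i, j, -, hi, -⟩ := (isVertex_iff p).mpr h
  exact ⟨label i, i, p, hp, rfl, hi, rfl⟩

lemma exists_onSide_of_lineEq {p : Plane} (hp : p ∈ octagon) {i : Fin 8} (h : LineEq i p) :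
    ∃ L, OnSide L (toSurface p hp) :=
  ⟨label i, i, p, hp, rfl, (mem_side_iff i p).mpr ⟨hp, h⟩, rfl⟩

lemma rep_unique {p q : Plane} (hp : p ∈ octagon) (hq : q ∈ octagon)
    (hs : ∀ L, ¬ OnSide L (toSurface p hp)) (h : toSurface p hp = toSurface q hq) : p = q := by
  rcases (toSurface_eq_iff hp hq).mp h with h | h | ⟨i, hi, -⟩
  · exact h
  · obtain ⟨L, hL⟩ := exists_onSide_of_vertexEq hp h.1
    exact absurd hL (hs L)
  · exact absurd ⟨i, p, hp, rfl, hi, rfl⟩ (hs (label i))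

/-- `c + s • v` represents `τ s` for `s` in `[α, β]`. -/
def Follows (τ : ℝ → Surface) (v c : Plane) (α β : ℝ) : Prop :=
  ∀ s, α ≤ s → s ≤ β → ∃ h : c + s • v ∈ octagon, τ s = toSurface (c + s • v) h

/-- Away from the sides the representative `r s` of `τ s` is unique, so the local segments force `r
s - s • v` to be locally constant, hence constant on the open interval. The local segments at α and
β extend the formula to the ends. -/
lemma IsTrajectory.exists_follows {τ : ℝ → Surface} {v : Plane} (hτ : IsTrajectory τ v) {α β : ℝ}
    (hαβ : α < β) (hs : ∀ s, α < s → s < β → ∀ L, ¬ OnSide L (τ s)) :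
    ∃ c, Follows τ v c α β := by
  choose r hr hτr using fun s => exists_rep (τ s)
  have uniq : ∀ s, α < s → s < β → ∀ p (hp : p ∈ octagon), τ s = toSurface p hp → r s = p := by
    intro s h1 h2 p hp h
    refine rep_unique (hr s) hp ?_ ((hτr s).symm.trans h)
    rw [← hτr s]
    exact hs s h1 h2
  have const : ∀ x ∈ Set.Ioo α β, ∀ y ∈ Set.Ioo α β, r x - x • v = r y - y • v := by
    intro x hx y hy
    refine isPreconnected_Ioo.induction₂ (fun x y => r x - x • v = r y - y • v) ?_
      (fun a b c _ _ _ h h' => h.trans h') (fun a b _ _ h => h.symm) hx hy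
    intro x hx
    obtain ⟨-, p, q, ε, hε, hf, hb⟩ := hτ.2 x
    have hp : r x = p := by
      obtain ⟨h, h'⟩ := hf 0 le_rfl hε
      simp only [zero_smul, add_zero] at h h'
      exact uniq x hx.1 hx.2 p h h'
    have hq : r x = q := by
      obtain ⟨h, h'⟩ := hb 0 le_rfl hε
      simp only [zero_smul, sub_zero] at h h'
      exact uniq x hx.1 hx.2 q h h'
    have hnhds : Set.Ioo (x - ε) (x + ε) ∈ nhdsWithin x (Set.Ioo α β) :=
      mem_nhdsWithin_of_mem_nhds (Ioo_mem_nhds (by linarith) (by linarith))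
    filter_upwards [hnhds, self_mem_nhdsWithin] with y hy hy'
    rcases le_total x y with hxy | hxy
    · obtain ⟨h, h'⟩ := hf (y - x) (by linarith) (by linarith [hy.2])
      rw [add_sub_cancel] at h'
      rw [uniq y hy'.1 hy'.2 _ h h', hp]
      module
    · obtain ⟨h, h'⟩ := hb (x - y) (by linarith) (by linarith [hy.1])
      rw [sub_sub_cancel] at h'
      rw [uniq y hy'.1 hy'.2 _ h h', hq]
      module
  set γ := (α + β) / 2 with hγ
  have hγ1 : α < γ := by linarith
  have hγ2 : γ < β := by linarith
  set c := r γ - γ • v with hc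
  have hrc : ∀ s, α < s → s < β → r s = c + s • v := by
    intro s h1 h2
    have := const s ⟨h1, h2⟩ γ ⟨hγ1, hγ2⟩
    rw [← hc] at this
    rw [← this]
    module
  refine ⟨c, fun s h1 h2 => ?_⟩
  have key : ∃ p, ∃ h : p ∈ octagon, τ s = toSurface p h ∧ p = c + s • v := by
    rcases h1.lt_or_eq with h1 | rfl
    · rcases h2.lt_or_eq with h2 | rfl
      · exact ⟨r s, hr s, hτr s, hrc s h1 h2⟩
      · obtain ⟨-, p, q, ε, hε, hf, hb⟩ := hτ.2 s
        obtain ⟨h, h'⟩ := hb 0 le_rfl hε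
        simp only [zero_smul, sub_zero] at h h'
        refine ⟨q, h, h', ?_⟩
        -- At an end point the local segment overlaps the open interval, and the comparison at one
        -- point of the overlap identifies the two lines.
        obtain ⟨u, hu1, hu2⟩ := exists_between (lt_min hε (sub_pos.mpr hαβ))
        have hu3 := hu2.trans_le (min_le_left _ _)
        have hu4 := hu2.trans_le (min_le_right _ _)
        obtain ⟨k, k'⟩ := hb u hu1.le hu3
        have e1 := uniq (s - u) (by linarith) (by linarith) _ k k'
        have e2 := hrc (s - u) (by linarith) (by linarith)
        have : q = r (s - u) + u • v := by rw [e1]; module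
        rw [this, e2]
        module
    · obtain ⟨-, p, q, ε, hε, hf, hb⟩ := hτ.2 α
      obtain ⟨h, h'⟩ := hf 0 le_rfl hε
      simp only [zero_smul, add_zero] at h h'
      refine ⟨p, h, h', ?_⟩
      obtain ⟨u, hu1, hu2⟩ := exists_between (lt_min hε (sub_pos.mpr hαβ))
      have hu3 := hu2.trans_le (min_le_left _ _)
      have hu4 := hu2.trans_le (min_le_right _ _)
      obtain ⟨k, k'⟩ := hf u hu1.le hu3
      have e1 := uniq (α + u) (by linarith) (by linarith) _ k k'
      have e2 := hrc (α + u) (by linarith) (by linarith)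
      have : p = r (α + u) - u • v := by rw [e1]; module
      rw [this, e2]
      module
  obtain ⟨p, h, h', rfl⟩ := key
  exact ⟨h, h'⟩

lemma normal_dot_add_smul (i : Fin 8) (c v : Plane) (s : ℝ) :
    normal i ⬝ᵥ (c + s • v) = normal i ⬝ᵥ c + s * (normal i ⬝ᵥ v) := by
  rw [dotProduct_add, dotProduct_smul, smul_eq_mul]

/-- A segment in the octagon which meets a side in its interior is contained in the side. -/
lemma Follows.lineEq {τ : ℝ → Surface} {v c : Plane} {α β γ : ℝ} (h : Follows τ v c α β)
    (h1 : α < γ) (h2 : γ < β) {i : Fin 8} (hi : LineEq i (c + γ • v)) (s : ℝ) :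
    LineEq i (c + s • v) := by
  rw [← normal_dot_eq_iff, normal_dot_add_smul] at hi ⊢
  have hα := (h α le_rfl (h1.trans h2).le).1 i
  have hβ := (h β (h1.trans h2).le le_rfl).1 i
  rw [normal_dot_add_smul] at hα hβ
  have : normal i ⬝ᵥ v = 0 := by
    apply le_antisymm
    · by_contra hc
      nlinarith
    · by_contra hc
      nlinarith
  rw [this] at hi ⊢
  linarith

/-! ### Discreteness of the crossing times and the sequence of chords. -/

section Cutting

variable {τ : ℝ → Surface} {v : Plane} {w : Word} {t : ℤ → ℝ}

lemma not_onSide_between (ht : StrictMono t) (hr : Set.range t = {s | ∃ L, OnSide L (τ s)})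
    {n : ℤ} {s : ℝ} (h1 : t n < s) (h2 : s < t (n + 1)) (L : Letter) : ¬ OnSide L (τ s) := by
  intro hL
  have : s ∈ Set.range t := by rw [hr]; exact ⟨L, hL⟩
  obtain ⟨k, rfl⟩ := this
  rw [ht.lt_iff_lt] at h1 h2
  omega

lemma Follows.exists_lineEq {c : Plane} {α β s : ℝ} {L : Letter} (h : Follows τ v c α β)
    (h1 : α ≤ s) (h2 : s ≤ β) (hs : ¬ IsSingular (τ s)) (hL : OnSide L (τ s)) :
    ¬ VertexEq (c + s • v) ∧ ∃ i, label i = L ∧ LineEq i (c + s • v) := by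
  obtain ⟨hm, he⟩ := h s h1 h2
  rw [he] at hs hL
  rw [isSingular_toSurface_iff] at hs
  rw [onSide_toSurface_iff hm hs, ← exists_side_iff L hm] at hL
  obtain ⟨i, hi, hside⟩ := hL
  exact ⟨hs, i, hi, ((mem_side_iff _ _).mp hside).2⟩

/-- The middle one of three crossings would be interior to a segment in the octagon, which would
then run along a side; every one of its times would be a crossing time, whereas there is none
between `t n` and `t (n + 1)`. -/
lemma Follows.not_three {c : Plane} {α β : ℝ} (h : Follows τ v c α β) (hτ : IsTrajectory τ v)
    (ht : StrictMono t) (hr : Set.range t = {s | ∃ L, OnSide L (τ s)}) {n : ℤ}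
    (h1 : α ≤ t n) (h2 : t (n + 2) ≤ β) : False := by
  have l1 : t n < t (n + 1) := ht (by omega)
  have l2 : t (n + 1) < t (n + 2) := ht (by omega)
  have hL : t (n + 1) ∈ {s | ∃ L, OnSide L (τ s)} := hr ▸ Set.mem_range_self _
  obtain ⟨L, hL⟩ := hL
  obtain ⟨-, i, -, hi⟩ := h.exists_lineEq (by linarith) (by linarith) (hτ.2 _).1 hL
  obtain ⟨s, hs1, hs2⟩ := exists_between l1
  have := h.lineEq (by linarith) (by linarith) hi s
  obtain ⟨hm, he⟩ := h s (by linarith) (by linarith)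
  obtain ⟨L', hL'⟩ := exists_onSide_of_lineEq hm this
  exact not_onSide_between ht hr hs1 hs2 L' (he ▸ hL')

/-- Crossing times do not accumulate: the local segment of the trajectory ending at their supremum
would contain three of them. -/
lemma exists_gt_crossing (hτ : IsTrajectory τ v) (ht : StrictMono t)
    (hr : Set.range t = {s | ∃ L, OnSide L (τ s)}) (s : ℝ) : ∃ n, s < t n := by
  by_contra! hc
  have hb : BddAbove (Set.range t) := ⟨s, by rintro _ ⟨n, rfl⟩; exact hc n⟩
  obtain ⟨-, -, q, ε, hε, -, hq⟩ := hτ.2 (sSup (Set.range t))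
  set T := sSup (Set.range t) with hT
  obtain ⟨_, ⟨n, rfl⟩, hn⟩ := exists_lt_of_lt_csSup (Set.range_nonempty t)
    (show T - ε < sSup (Set.range t) by linarith)
  have hle : t (n + 2) ≤ T := le_csSup hb (Set.mem_range_self _)
  have hf : Follows τ v (q - T • v) (t n) T := by
    intro u h1 h2
    obtain ⟨h, h'⟩ := hq (T - u) (by linarith) (by linarith)
    have e : q - (T - u) • v = q - T • v + u • v := by module
    rw [sub_sub_cancel] at h'
    exact ⟨e ▸ h, h'.trans (toSurface_eq_of_eq _ _ e)⟩
  exact hf.not_three hτ ht hr le_rfl hle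

lemma exists_crossing_lt (hτ : IsTrajectory τ v) (ht : StrictMono t)
    (hr : Set.range t = {s | ∃ L, OnSide L (τ s)}) (s : ℝ) : ∃ n, t n < s := by
  by_contra! hc
  have hb : BddBelow (Set.range t) := ⟨s, by rintro _ ⟨n, rfl⟩; exact hc n⟩
  obtain ⟨-, p, -, ε, hε, hp, -⟩ := hτ.2 (sInf (Set.range t))
  set T := sInf (Set.range t) with hT
  obtain ⟨_, ⟨n, rfl⟩, hn⟩ := exists_lt_of_csInf_lt (Set.range_nonempty t)
    (show sInf (Set.range t) < T + ε by linarith)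
  have hle : T ≤ t (n - 2) := csInf_le hb (Set.mem_range_self _)
  have hf : Follows τ v (p - T • v) T (t n) := by
    intro u h1 h2
    obtain ⟨h, h'⟩ := hp (u - T) (by linarith) (by linarith)
    have e : p + (u - T) • v = p - T • v + u • v := by module
    rw [add_sub_cancel] at h'
    exact ⟨e ▸ h, h'.trans (toSurface_eq_of_eq _ _ e)⟩
  exact hf.not_three hτ ht hr hle (by rw [sub_add_cancel])

lemma exists_chord_of_time (hτ : IsTrajectory τ v) (ht : StrictMono t)
    (hr : Set.range t = {s | ∃ L, OnSide L (τ s)}) (s : ℝ) : ∃ n, t n ≤ s ∧ s < t (n + 1) := by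
  obtain ⟨a, ha⟩ := exists_crossing_lt hτ ht hr s
  obtain ⟨b, hb⟩ := exists_gt_crossing hτ ht hr s
  obtain ⟨n, hn, hmax⟩ := Int.exists_greatest_of_bdd (P := fun n => t n ≤ s)
    ⟨b, fun z hz => (ht.lt_iff_lt.mp (hz.trans_lt hb)).le⟩ ⟨a, ha.le⟩
  refine ⟨n, hn, ?_⟩
  by_contra! hc
  have := hmax _ hc
  omega

/-- Between crossings the trajectory follows straight segments in the octagon, and consecutive
segments are related by the translation which identifies the sides. -/
lemma exists_unfolding (hτ : IsTrajectory τ v) (ht : StrictMono t)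
    (hr : Set.range t = {s | ∃ L, OnSide L (τ s)}) (hw : ∀ n, OnSide (w n) (τ (t n)))
    (hv : ∀ i, 0 < normal i ⬝ᵥ v → i = sideIndex (label i)) :
    ∃ c : ℤ → Plane, ∀ n, Follows τ v (c n) (t n) (t (n + 1)) ∧
      LineEq (sideIndex (w (n + 1))) (c n + t (n + 1) • v) ∧
      0 < normal (sideIndex (w (n + 1))) ⬝ᵥ v ∧
      c (n + 1) = c n - shift (w (n + 1)) := by
  have lt : ∀ n, t n < t (n + 1) := fun n => ht (by omega)
  have nb := fun n s => not_onSide_between (n := n) (s := s) ht hr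
  choose c hc using fun n => hτ.exists_follows (lt n) (fun s h1 h2 => nb n s h1 h2)
  -- A side parallel to v which meets a chord contains the whole chord, and the times strictly
  -- inside the chord would be crossing times.
  have nz : ∀ n s i, t n ≤ s → s ≤ t (n + 1) → LineEq i (c n + s • v) → normal i ⬝ᵥ v ≠ 0 := by
    intro n s i h1 h2 hi h0
    obtain ⟨u, hu1, hu2⟩ := exists_between (lt n)
    obtain ⟨hm, he⟩ := hc n u hu1.le hu2.le
    have : LineEq i (c n + u • v) := by
      rw [← normal_dot_eq_iff, normal_dot_add_smul, h0] at hi ⊢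
      linarith
    obtain ⟨L, hL⟩ := exists_onSide_of_lineEq hm this
    exact nb n u hu1 hu2 L (he ▸ hL)
  refine ⟨c, fun n => ?_⟩
  have hns := (hτ.2 (t (n + 1))).1
  have e1 := lt n
  have e2 := lt (n + 1)
  obtain ⟨hv1, i, hiL, hi⟩ := (hc n).exists_lineEq e1.le le_rfl hns (hw (n + 1))
  obtain ⟨hv2, j, hjL, hj⟩ := (hc (n + 1)).exists_lineEq le_rfl e2.le hns (hw (n + 1))
  -- The chord starts in the half plane of the side i and ends on its boundary line, so v points
  -- outwards there; the same argument at the start of the next chord gives the opposite sign.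
  have pi : 0 < normal i ⬝ᵥ v := by
    refine lt_of_le_of_ne ?_ (nz n _ i e1.le le_rfl hi).symm
    have h0 := (hc n (t n) le_rfl e1.le).1 i
    rw [← normal_dot_eq_iff] at hi
    rw [normal_dot_add_smul] at hi h0
    by_contra hneg
    nlinarith
  have pj : normal j ⬝ᵥ v < 0 := by
    refine lt_of_le_of_ne ?_ (nz (n + 1) _ j le_rfl e2.le hj)
    have h0 := (hc (n + 1) (t (n + 1 + 1)) e2.le le_rfl).1 j
    rw [← normal_dot_eq_iff] at hj
    rw [normal_dot_add_smul] at hj h0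
    by_contra hneg
    nlinarith
  obtain ⟨m1, s1⟩ := hc n (t (n + 1)) e1.le le_rfl
  obtain ⟨m2, s2⟩ := hc (n + 1) (t (n + 1)) le_rfl e2.le
  have unique : ∀ k, LineEq k (c n + t (n + 1) • v) → k = i := by
    intro k hk
    by_contra hki
    exact hv1 (vertexEq_of_lineEq m1 hki hk hi)
  have hij : i = sideIndex (w (n + 1)) := by rw [← hiL]; exact hv i pi
  rw [← hij]
  refine ⟨hc n, hi, pi, ?_⟩
  -- The end of one chord and the start of the next represent the same point. If they coincided, one
  -- point which is not a vertex would be on an exit side and on an entrance side, so these would be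
  -- equal; the only possibility left is the gluing along the exit side.
  rcases (toSurface_eq_iff m1 m2).mp (s1.symm.trans s2) with h | h | ⟨k, hk, h⟩
  · have := unique j (h ▸ hj)
    subst this
    exact absurd pi pj.not_gt
  · exact absurd h.1 hv1
  · have := unique k ((mem_side_iff _ _).mp hk).2
    subst this
    rw [shift_eq, ← hij]
    have h' : c (n + 1) + t (n + 1) • v = c n + t (n + 1) • v - (2 * apothem) • normal k := h
    have : c (n + 1) = (c (n + 1) + t (n + 1) • v) - t (n + 1) • v := by module
    rw [this, h']
    module

end Cutting

/-! ### The image of a trajectory under `Ψ_γ` -/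

/-- When α = c the sign of β decides; otherwise the inequality at s = 0 persists for a time of the
order of |α - c| / |β|, the added 1 covering β = 0. -/
lemma linear_dichotomy (α β c : ℝ) :
    ∃ ε > 0, (∀ s, 0 ≤ s → s < ε → α + s * β ≤ c) ∨ (∀ s, 0 ≤ s → s < ε → c ≤ α + s * β) := by
  rcases lt_trichotomy α c with h | rfl | h
  · refine ⟨(c - α) / (|β| + 1), by have := abs_nonneg β; apply div_pos <;> linarith, Or.inl ?_⟩
    intro s h1 h2
    rw [lt_div_iff₀ (by positivity)] at h2
    nlinarith [le_abs_self β]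
  · rcases le_total β 0 with hb | hb
    · exact ⟨1, one_pos, Or.inl fun s h1 _ => by nlinarith⟩
    · exact ⟨1, one_pos, Or.inr fun s h1 _ => by nlinarith⟩
  · refine ⟨(α - c) / (|β| + 1), by have := abs_nonneg β; apply div_pos <;> linarith, Or.inr ?_⟩
    intro s h1 h2
    rw [lt_div_iff₀ (by positivity)] at h2
    nlinarith [neg_abs_le β]

/-- For a short time a moving point of a circle stays in one closed fundamental interval. At an end
of the interval the representative depends on the direction of motion: the lower end is taken if β ≥
0 and the upper end if β ≤ 0. -/
lemma linear_mod {c : ℝ} (hc : 0 < c) (b α β : ℝ) :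
    ∃ n : ℤ, ∃ ε > 0, ∀ s, 0 ≤ s → s < ε → b ≤ α + s * β + n * c ∧ α + s * β + n * c ≤ b + c := by
  rcases le_total 0 β with hβ | hβ
  · set n := -toIcoDiv hc b α with hn
    have hm : b ≤ α + n * c ∧ α + n * c < b + c := by
      have := sub_toIcoDiv_zsmul_mem_Ico hc b α
      rw [zsmul_eq_mul] at this
      rw [hn]; push_cast
      exact ⟨by linarith [this.1], by linarith [this.2]⟩
    refine ⟨n, (b + c - (α + n * c)) / (β + 1), div_pos (by linarith) (by linarith), ?_⟩
    intro s h1 h2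
    rw [lt_div_iff₀ (by linarith)] at h2
    constructor <;> nlinarith
  · set n := -toIocDiv hc b α with hn
    have hm : b < α + n * c ∧ α + n * c ≤ b + c := by
      have := sub_toIocDiv_zsmul_mem_Ioc hc b α
      rw [zsmul_eq_mul] at this
      rw [hn]; push_cast
      exact ⟨by linarith [this.1], by linarith [this.2]⟩
    refine ⟨n, (α + n * c - b) / (-β + 1), div_pos (by linarith) (by linarith), ?_⟩
    intro s h1 h2
    rw [lt_div_iff₀ (by linarith)] at h2
    constructor <;> nlinarith

lemma psiGamma_toSurface {p : Plane} (hp : p ∈ octagon) :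
    psiGamma (toSurface p hp) = psiPoint ⟨p, hp⟩ := rfl

/-- A point of the outer cylinder with coordinates `X, y` in the top trapezoid. -/
lemma mem_octagon_top {X y : ℝ} (hy : 1 / 2 ≤ y) (hy' : y ≤ apothem) (h1 : y - halfOuter ≤ X)
    (h2 : X ≤ halfOuter - y) : ![X, y] ∈ octagon := by
  have ha := apothem_eq
  rw [mem_octagon_iff]
  simp only [Matrix.cons_val_zero, Matrix.cons_val_one]
  refine ⟨⟨?_, ?_⟩, ⟨?_, ?_⟩, ⟨?_, ?_⟩, ?_, ?_⟩ <;> linarith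

/-- A point of the outer cylinder with coordinates `X, y` in the translated bottom trapezoid. -/
lemma mem_octagon_bottom {X y : ℝ} (hy : 1 / 2 ≤ y) (hy' : y ≤ apothem) (h1 : halfOuter - y ≤ X)
    (h2 : X ≤ halfOuter + y) : ![X - halfOuter, y - halfOuter] ∈ octagon := by
  have ha := apothem_eq
  rw [mem_octagon_iff]
  simp only [Matrix.cons_val_zero, Matrix.cons_val_one]
  refine ⟨⟨?_, ?_⟩, ⟨?_, ?_⟩, ⟨?_, ?_⟩, ?_, ?_⟩ <;> linarith

lemma mem_octagon_middle {X y : ℝ} (hy : |y| ≤ 1 / 2) (h1 : -apothem ≤ X) (h2 : X ≤ apothem) :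
    ![X, y] ∈ octagon := by
  have ha := apothem_eq
  have hb := half_lt_apothem
  obtain ⟨h3, h4⟩ := abs_le.mp hy
  rw [mem_octagon_iff]
  simp only [Matrix.cons_val_zero, Matrix.cons_val_one]
  refine ⟨⟨?_, ?_⟩, ⟨?_, ?_⟩, ⟨?_, ?_⟩, ?_, ?_⟩ <;> linarith

/-- A path with horizontal speed `μ` and vertical speed `ν` in the outer cylinder is locally a
straight path in the octagon. -/
lemma outerPoint_linear (u μ y ν : ℝ) {ε : ℝ} (hε : 0 < ε) :
    ∃ p : Plane, ∃ ε' > 0, ε' ≤ ε ∧ ∀ s, 0 ≤ s → s < ε' →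
      ∀ (h1 : 1 / 2 ≤ y + s * ν) (h2 : y + s * ν ≤ apothem),
      ∃ h : p + s • ![μ, ν] ∈ octagon,
        toSurface (outerPoint (u + s * μ) (y + s * ν)) (outerPoint_mem _ h1 h2) =
          toSurface _ h := by
  -- The outer cylinder has the slanted fundamental domain |X - y| ≤ `halfOuter`, so it is the
  -- difference X - y which is reduced. The line X + y = `halfOuter` of the side B then separates
  -- the top trapezoid from the translated bottom one.
  obtain ⟨n, ε₁, hε₁, hn⟩ := linear_mod circ_outer_pos (-halfOuter) (u - y) (μ - ν)
  obtain ⟨ε₂, hε₂, hd | hd⟩ :=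
    linear_dichotomy (u + y + n * (2 * halfOuter)) (μ + ν) halfOuter
  · refine ⟨![u + n * (2 * halfOuter), y], min ε (min ε₁ ε₂), by positivity, min_le_left _ _, ?_⟩
    intro s h0 hs h1 h2
    simp only [lt_min_iff] at hs
    obtain ⟨k1, k2⟩ := hn s h0 hs.2.1
    have k3 := hd s h0 hs.2.2
    have e : ![u + n * (2 * halfOuter), y] + s • ![μ, ν] =
        ![u + s * μ + n * (2 * halfOuter), y + s * ν] := by
      ext m; fin_cases m <;> simp; ring
    have hm : ![u + s * μ + n * (2 * halfOuter), y + s * ν] ∈ octagon :=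
      mem_octagon_top h1 h2 (by linarith) (by linarith)
    refine ⟨e ▸ hm, ?_⟩
    rw [outer_top n rfl h1 h2 (by linarith) (by linarith) hm]
    exact toSurface_eq_of_eq _ _ e.symm
  · refine ⟨![u + n * (2 * halfOuter) - halfOuter, y - halfOuter], min ε (min ε₁ ε₂), by positivity,
      min_le_left _ _, ?_⟩
    intro s h0 hs h1 h2
    simp only [lt_min_iff] at hs
    obtain ⟨k1, k2⟩ := hn s h0 hs.2.1
    have k3 := hd s h0 hs.2.2
    have e : ![u + n * (2 * halfOuter) - halfOuter, y - halfOuter] + s • ![μ, ν] =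
        ![u + s * μ + n * (2 * halfOuter) - halfOuter, y + s * ν - halfOuter] := by
      ext m; fin_cases m <;> simp <;> ring
    have hm : ![u + s * μ + n * (2 * halfOuter) - halfOuter, y + s * ν - halfOuter] ∈ octagon :=
      mem_octagon_bottom h1 h2 (by linarith) (by linarith)
    refine ⟨e ▸ hm, ?_⟩
    rw [outer_bottom n rfl h1 h2 (by linarith) (by linarith) hm]
    exact toSurface_eq_of_eq _ _ e.symm

lemma middlePoint_linear (u μ y ν : ℝ) {ε : ℝ} (hε : 0 < ε) :
    ∃ p : Plane, ∃ ε' > 0, ε' ≤ ε ∧ ∀ s, 0 ≤ s → s < ε' → ∀ h1 : |y + s * ν| ≤ 1 / 2,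
      ∃ h : p + s • ![μ, ν] ∈ octagon,
        toSurface (middlePoint (u + s * μ) (y + s * ν)) (middlePoint_mem _ h1) =
          toSurface _ h := by
  obtain ⟨n, ε₁, hε₁, hn⟩ := linear_mod circ_middle_pos (-apothem) u μ
  refine ⟨![u + n * (2 * apothem), y], min ε ε₁, by positivity, min_le_left _ _, ?_⟩
  intro s h0 hs h1
  simp only [lt_min_iff] at hs
  obtain ⟨k1, k2⟩ := hn s h0 hs.2
  have e : ![u + n * (2 * apothem), y] + s • ![μ, ν] =
      ![u + s * μ + n * (2 * apothem), y + s * ν] := by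
    ext m; fin_cases m <;> simp; ring
  have hm : ![u + s * μ + n * (2 * apothem), y + s * ν] ∈ octagon :=
    mem_octagon_middle h1 (by linarith) (by linarith)
  refine ⟨e ▸ hm, ?_⟩
  rw [middle_eq n rfl h1 (by linarith) (by linarith) hm]
  exact toSurface_eq_of_eq _ _ e.symm

/-- For a short time the height stays in one of the three strips cut out by y = ±1/2, and there
`psiPoint` is γ followed by a translation modulo the circumference of one cylinder. Backward
segments are obtained by applying this to -v. -/
lemma psiGamma_segment {p v : Plane} {ε : ℝ} (hε : 0 < ε)
    (hp : ∀ s, 0 ≤ s → s < ε → p + s • v ∈ octagon) :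
    ∃ p' : Plane, ∃ ε' > 0, ε' ≤ ε ∧ ∀ s, 0 ≤ s → s < ε' → ∀ h : p + s • v ∈ octagon,
      ∃ h' : p' + s • gammaMatrix.mulVec v ∈ octagon,
        psiGamma (toSurface (p + s • v) h) = toSurface _ h' := by
  have ha := apothem_eq
  have c0 : ∀ s, (p + s • v) 0 = p 0 + s * v 0 := fun s => by simp
  have c1 : ∀ s, (p + s • v) 1 = p 1 + s * v 1 := fun s => by simp
  have bounds : ∀ s, 0 ≤ s → s < ε → -apothem ≤ p 1 + s * v 1 ∧ p 1 + s * v 1 ≤ apothem := by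
    intro s h0 h1
    have := (mem_octagon_iff _).mp (hp s h0 h1)
    rw [c1] at this
    constructor <;> linarith [this.2.1.1, this.2.1.2]
  rw [gammaMatrix_mulVec]
  set μ := -v 0 + 4 * apothem * v 1 with hμ
  obtain ⟨ε₁, hε₁, hd₁⟩ := linear_dichotomy (p 1) (v 1) (1 / 2)
  obtain ⟨ε₂, hε₂, hd₂⟩ := linear_dichotomy (p 1) (v 1) (-(1 / 2))
  set δ := min ε (min ε₁ ε₂) with hδ
  have hδ0 : 0 < δ := by positivity
  have hδ1 : δ ≤ ε := min_le_left _ _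
  have hδ2 : δ ≤ ε₁ := (min_le_right _ _).trans (min_le_left _ _)
  have hδ3 : δ ≤ ε₂ := (min_le_right _ _).trans (min_le_right _ _)
  rcases hd₁ with hd₁ | hd₁
  · rcases hd₂ with hd₂ | hd₂
    · have hy : ∀ s, 0 ≤ s → s < δ → 1 / 2 ≤ p 1 + halfOuter + s * v 1 ∧
          p 1 + halfOuter + s * v 1 ≤ apothem := by
        intro s h0 h1
        have := hd₂ s h0 (by linarith)
        have := bounds s h0 (by linarith)
        constructor <;> linarith
      obtain ⟨p', ε', h1, h2, h3⟩ := outerPoint_linear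
        (-p 0 + 4 * apothem * p 1 + 2 * apothem + halfOuter) μ (p 1 + halfOuter) (v 1) hδ0
      refine ⟨p', ε', h1, h2.trans hδ1, fun s hs0 hs1 h => ?_⟩
      obtain ⟨k1, k2⟩ := hy s hs0 (by linarith)
      obtain ⟨h', e⟩ := h3 s hs0 hs1 k1 k2
      refine ⟨h', ?_⟩
      rw [← e, psiGamma_toSurface, psiPoint_bottom ⟨p + s • v, h⟩ (by dsimp only; rw [c1]; linarith)
        (by dsimp only; rw [c1]; linarith)]
      refine toSurface_eq_of_eq _ _ ?_
      simp only [c0, c1]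
      congr 1 <;> ring
    · obtain ⟨p', ε', h1, h2, h3⟩ := middlePoint_linear
        (-p 0 + 4 * apothem * p 1) μ (p 1) (v 1) hδ0
      refine ⟨p', ε', h1, h2.trans hδ1, fun s hs0 hs1 h => ?_⟩
      have k : |p 1 + s * v 1| ≤ 1 / 2 :=
        abs_le.mpr ⟨hd₂ s hs0 (by linarith), hd₁ s hs0 (by linarith)⟩
      obtain ⟨h', e⟩ := h3 s hs0 hs1 k
      refine ⟨h', ?_⟩
      rw [← e, psiGamma_toSurface, psiPoint_middle ⟨p + s • v, h⟩ (by dsimp only; rw [c1]; exact k)]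
      refine toSurface_eq_of_eq _ _ ?_
      simp only [c0, c1]
      congr 1; ring
  · have hy : ∀ s, 0 ≤ s → s < δ → 1 / 2 ≤ p 1 + s * v 1 ∧ p 1 + s * v 1 ≤ apothem :=
      fun s h0 h1 => ⟨hd₁ s h0 (by linarith), (bounds s h0 (by linarith)).2⟩
    obtain ⟨p', ε', h1, h2, h3⟩ := outerPoint_linear
      (-p 0 + 4 * apothem * p 1 - 2 * apothem) μ (p 1) (v 1) hδ0
    refine ⟨p', ε', h1, h2.trans hδ1, fun s hs0 hs1 h => ?_⟩
    obtain ⟨k1, k2⟩ := hy s hs0 (by linarith)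
    obtain ⟨h', e⟩ := h3 s hs0 hs1 k1 k2
    refine ⟨h', ?_⟩
    rw [← e, psiGamma_toSurface, psiPoint_top ⟨p + s • v, h⟩ (by dsimp only; rw [c1]; linarith)
      (by dsimp only; rw [c1]; linarith)]
    refine toSurface_eq_of_eq _ _ ?_
    simp only [c0, c1]
    congr 1; ring

/-! ### The preimages of the sides under `Ψ_γ` -/

/-- The coordinate equations of the two lines which cut from the octagon the segments mapped by
`Ψ_γ` to the side `L`. -/
def PrimedEq : Letter → Plane → Prop
  | .A, p => p 1 = apothem ∨ p 1 = -apothem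
  | .B, p => p 0 = (4 * apothem + 1) * p 1 - (2 * apothem + halfOuter) ∨
      p 0 = (4 * apothem + 1) * p 1 + (2 * apothem + halfOuter)
  | .C, p => p 0 = 4 * apothem * p 1 + apothem ∨ p 0 = 4 * apothem * p 1 - apothem
  | .D, p => p 0 = (4 * apothem - 1) * p 1 + (2 * apothem + halfOuter) ∨
      p 0 = (4 * apothem - 1) * p 1 - (2 * apothem + halfOuter)

lemma exists_add_int_mul {c : ℝ} (hc : 0 < c) (b u : ℝ) :
    ∃ n : ℤ, b ≤ u + n * c ∧ u + n * c ≤ b + c := by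
  obtain ⟨n, ε, hε, h⟩ := linear_mod hc b u 0
  exact ⟨n, by simpa using h 0 le_rfl hε⟩

lemma int_lt_of_mul_lt {c : ℝ} (hc : 0 < c) {n k : ℤ} (h : (n : ℝ) * c < k * c) : n < k := by
  exact_mod_cast lt_of_mul_lt_mul_right h hc.le

lemma cast_cases {n : ℤ} (h : n < 2) (h' : -2 < n) :
    (n : ℝ) = -1 ∨ (n : ℝ) = 0 ∨ (n : ℝ) = 1 := by
  obtain rfl | rfl | rfl : n = -1 ∨ n = 0 ∨ n = 1 := by omega
  all_goals simp

/-- `psiPoint` sends `p` to a point which lies on exactly the sides whose preimages contain `p`. -/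
def GoodImage (p : octagon) : Prop :=
  ∃ q, ∃ hq : q ∈ octagon, psiPoint p = toSurface q hq ∧ ¬ VertexEq q ∧
    ∀ L, SideEq L q ↔ PrimedEq L p.1

lemma goodImage_middle (p : octagon) (h : |p.1 1| < 1 / 2) : GoodImage p := by
  have hp := (mem_octagon_iff _).mp p.2
  have ha := apothem_eq
  have hb := half_lt_apothem
  obtain ⟨h3, h4⟩ := abs_lt.mp h
  obtain ⟨n, hn1, hn2⟩ := exists_add_int_mul circ_middle_pos (-apothem)
    (-p.1 0 + 4 * apothem * p.1 1)
  -- Since |y| < 1/2 strictly, γ moves the point to |x| < 3 * `apothem`, so at most one turn of the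
  -- cylinder brings it back: n is -1, 0 or 1. The outer cylinder is treated in the same way.
  have k1 : apothem * p.1 1 < apothem * (1 / 2) := mul_lt_mul_of_pos_left h4 (by linarith)
  have k2 : apothem * (-(1 / 2)) < apothem * p.1 1 := mul_lt_mul_of_pos_left h3 (by linarith)
  have hn3 : n < 2 := int_lt_of_mul_lt circ_middle_pos (by push_cast; linarith)
  have hn4 : -2 < n := int_lt_of_mul_lt circ_middle_pos (by push_cast; linarith)
  have hm := mem_octagon_middle h.le hn1 (by linarith)
  refine ⟨_, hm, ?_, ?_, ?_⟩
  · rw [psiPoint_middle p h.le, middle_eq n rfl h.le hn1 (by linarith) hm]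
  · simp only [VertexEq, Matrix.cons_val_zero, Matrix.cons_val_one]
    rintro (⟨-, h | h⟩ | ⟨-, h | h⟩) <;> linarith
  · clear hm
    intro L
    rcases cast_cases hn3 hn4 with e | e | e <;> rw [e] at hn1 hn2 ⊢ <;>
    cases L <;> simp only [SideEq, PrimedEq, Matrix.cons_val_zero, Matrix.cons_val_one] <;>
      constructor <;> rintro (h | h) <;> first
        | (exfalso; linarith)
        | exact Or.inl (by linarith)
        | exact Or.inr (by linarith)

lemma goodImage_top (p : octagon) (h : 1 / 2 < p.1 1) (h' : p.1 1 < apothem) : GoodImage p := by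
  have hp := (mem_octagon_iff _).mp p.2
  have ha := apothem_eq
  have hb := half_lt_apothem
  have hsq := apothem_sq
  obtain ⟨n, hn1, hn2⟩ := exists_add_int_mul circ_outer_pos (p.1 1 - halfOuter)
    (-p.1 0 + 4 * apothem * p.1 1 - 2 * apothem)
  have k1 : apothem * p.1 1 < apothem * apothem := mul_lt_mul_of_pos_left h' (by linarith)
  have k2 : apothem * (1 / 2) < apothem * p.1 1 := mul_lt_mul_of_pos_left h (by linarith)
  have hn3 : n < 2 := int_lt_of_mul_lt circ_outer_pos (by push_cast; linarith)
  have hn4 : -2 < n := int_lt_of_mul_lt circ_outer_pos (by push_cast; linarith)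
  rcases le_or_gt (-p.1 0 + 4 * apothem * p.1 1 - 2 * apothem + n * (2 * halfOuter))
    (halfOuter - p.1 1) with hX | hX
  · have hm := mem_octagon_top h.le h'.le hn1 hX
    refine ⟨_, hm, ?_, ?_, ?_⟩
    · rw [psiPoint_top p h.le h'.le, outer_top n rfl h.le h'.le hn1 hX hm]
    · simp only [VertexEq, Matrix.cons_val_zero, Matrix.cons_val_one]
      rintro (⟨-, h | h⟩ | ⟨-, h | h⟩) <;> linarith
    · clear hm
      intro L
      rcases cast_cases hn3 hn4 with e | e | e <;> rw [e] at hn1 hn2 hX ⊢ <;>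
      cases L <;> simp only [SideEq, PrimedEq, Matrix.cons_val_zero, Matrix.cons_val_one] <;>
        constructor <;> rintro (h | h) <;> first
          | (exfalso; linarith)
          | exact Or.inl (by linarith)
          | exact Or.inr (by linarith)
  · have hm := mem_octagon_bottom h.le h'.le hX.le (by linarith)
    refine ⟨_, hm, ?_, ?_, ?_⟩
    · rw [psiPoint_top p h.le h'.le, outer_bottom n rfl h.le h'.le hX.le (by linarith) hm]
    · simp only [VertexEq, Matrix.cons_val_zero, Matrix.cons_val_one]
      rintro (⟨-, h | h⟩ | ⟨-, h | h⟩) <;> linarith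
    · clear hm
      intro L
      rcases cast_cases hn3 hn4 with e | e | e <;> rw [e] at hn1 hn2 hX ⊢ <;>
      cases L <;> simp only [SideEq, PrimedEq, Matrix.cons_val_zero, Matrix.cons_val_one] <;>
        constructor <;> rintro (h | h) <;> first
          | (exfalso; linarith)
          | exact Or.inl (by linarith)
          | exact Or.inr (by linarith)

lemma goodImage_bottom (p : octagon) (h : p.1 1 < -(1 / 2)) (h' : -apothem < p.1 1) :
    GoodImage p := by
  have hp := (mem_octagon_iff _).mp p.2
  have ha := apothem_eq
  have hb := half_lt_apothem
  have hsq := apothem_sq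
  obtain ⟨n, hn1, hn2⟩ := exists_add_int_mul circ_outer_pos (p.1 1)
    (-p.1 0 + 4 * apothem * p.1 1 + 2 * apothem + halfOuter)
  have k1 : apothem * -apothem < apothem * p.1 1 := mul_lt_mul_of_pos_left h' (by linarith)
  have k2 : apothem * p.1 1 < apothem * -(1 / 2) := mul_lt_mul_of_pos_left h (by linarith)
  have hn3 : n < 2 := int_lt_of_mul_lt circ_outer_pos (by push_cast; linarith)
  have hn4 : -2 < n := int_lt_of_mul_lt circ_outer_pos (by push_cast; linarith)
  have l1 : 1 / 2 ≤ p.1 1 + halfOuter := by linarith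
  have l2 : p.1 1 + halfOuter ≤ apothem := by linarith
  rcases le_or_gt (-p.1 0 + 4 * apothem * p.1 1 + 2 * apothem + halfOuter + n * (2 * halfOuter))
    (halfOuter - (p.1 1 + halfOuter)) with hX | hX
  · have hm := mem_octagon_top l1 l2 (by linarith) hX
    refine ⟨_, hm, ?_, ?_, ?_⟩
    · rw [psiPoint_bottom p h'.le h.le, outer_top n rfl l1 l2 (by linarith) hX hm]
    · simp only [VertexEq, Matrix.cons_val_zero, Matrix.cons_val_one]
      rintro (⟨-, h | h⟩ | ⟨-, h | h⟩) <;> linarith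
    · clear hm
      intro L
      rcases cast_cases hn3 hn4 with e | e | e <;> rw [e] at hn1 hn2 hX ⊢ <;>
      cases L <;> simp only [SideEq, PrimedEq, Matrix.cons_val_zero, Matrix.cons_val_one] <;>
        constructor <;> rintro (h | h) <;> first
          | (exfalso; linarith)
          | exact Or.inl (by linarith)
          | exact Or.inr (by linarith)
  · have hm := mem_octagon_bottom l1 l2 hX.le (by linarith)
    refine ⟨_, hm, ?_, ?_, ?_⟩
    · rw [psiPoint_bottom p h'.le h.le, outer_bottom n rfl l1 l2 hX.le (by linarith) hm]
    · simp only [VertexEq, Matrix.cons_val_zero, Matrix.cons_val_one]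
      rintro (⟨-, h | h⟩ | ⟨-, h | h⟩) <;> linarith
    · clear hm
      intro L
      rcases cast_cases hn3 hn4 with e | e | e <;> rw [e] at hn1 hn2 hX ⊢ <;>
      cases L <;> simp only [SideEq, PrimedEq, Matrix.cons_val_zero, Matrix.cons_val_one] <;>
        constructor <;> rintro (h | h) <;> first
          | (exfalso; linarith)
          | exact Or.inl (by linarith)

/-- On the horizontal sides and diagonals, `Ψ_γ` is the reflection in the vertical axis. -/
lemma goodImage_boundary (p : octagon) (hv : ¬ VertexEq p.1)
    (h : p.1 1 = apothem ∨ p.1 1 = -apothem ∨ p.1 1 = 1 / 2 ∨ p.1 1 = -(1 / 2)) :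
    GoodImage p := by
  have hp := (mem_octagon_iff _).mp p.2
  have ha := apothem_eq
  have hb := half_lt_apothem
  have hsq := apothem_sq
  have hm : ![-p.1 0, p.1 1] ∈ octagon := by
    rw [mem_octagon_iff]
    simp only [Matrix.cons_val_zero, Matrix.cons_val_one]
    refine ⟨⟨?_, ?_⟩, ⟨?_, ?_⟩, ⟨?_, ?_⟩, ?_, ?_⟩ <;> linarith
  have hneg : ∀ x c : ℝ, -x = c ∨ -x = -c → x = c ∨ x = -c := by
    rintro x c (h | h)
    exacts [Or.inr (by linarith), Or.inl (by linarith)]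
  refine ⟨_, hm, ?_, ?_, ?_⟩
  · rcases h with h | h | h | h
    · rw [psiPoint_top p (by linarith) h.le, outer_top (X := -p.1 0) (-1)
        (by rw [h]; push_cast; linarith) (by linarith) h.le (by linarith) (by linarith) hm]
    · have e : ![-p.1 0, p.1 1] =
          ![(-p.1 0 + halfOuter) - halfOuter, (p.1 1 + halfOuter) - halfOuter] := by simp
      rw [psiPoint_bottom p h.ge (by linarith), outer_bottom (X := -p.1 0 + halfOuter) 1
        (by rw [h]; push_cast; linarith) (by linarith) (by linarith) (by linarith) (by linarith)
        (e ▸ hm)]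
      exact toSurface_eq_of_eq _ _ e.symm
    · have hy : |p.1 1| ≤ 1 / 2 := by rw [h, abs_of_pos] <;> norm_num
      rw [psiPoint_middle p hy, middle_eq (X := -p.1 0) (-1) (by rw [h]; push_cast; ring) hy
        (by linarith) (by linarith) hm]
    · have hy : |p.1 1| ≤ 1 / 2 := by rw [h, abs_of_neg] <;> norm_num
      rw [psiPoint_middle p hy, middle_eq (X := -p.1 0) 1 (by rw [h]; push_cast; ring) hy
        (by linarith) (by linarith) hm]
  · simp only [VertexEq, Matrix.cons_val_zero, Matrix.cons_val_one]
    rintro (⟨h1, h2⟩ | ⟨h1, h2⟩)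
    · exact hv (Or.inl ⟨hneg _ _ h1, h2⟩)
    · exact hv (Or.inr ⟨hneg _ _ h1, h2⟩)
  · have strict : ∀ c d : ℝ, (c = 1 / 2 ∧ (d = apothem ∨ d = -apothem)) ∨
        (c = apothem ∧ (d = 1 / 2 ∨ d = -(1 / 2))) → p.1 1 = d → -c ≤ p.1 0 → p.1 0 ≤ c →
        -c < p.1 0 ∧ p.1 0 < c := by
      rintro c d h rfl h1 h2
      constructor
      · refine lt_of_le_of_ne h1 fun e => hv ?_
        rcases h with ⟨rfl, h⟩ | ⟨rfl, h⟩
        exacts [Or.inl ⟨Or.inr e.symm, h⟩, Or.inr ⟨Or.inr e.symm, h⟩]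
      · refine lt_of_le_of_ne h2 fun e => hv ?_
        rcases h with ⟨rfl, h⟩ | ⟨rfl, h⟩
        exacts [Or.inl ⟨Or.inl e, h⟩, Or.inr ⟨Or.inl e, h⟩]
    intro L
    rcases h with h | h | h | h
    · obtain ⟨s1, s2⟩ := strict (1 / 2) _ (by simp) h (by linarith) (by linarith)
      cases L <;> simp only [SideEq, PrimedEq, Matrix.cons_val_zero, Matrix.cons_val_one] <;>
        rw [h] <;> constructor <;> rintro (h | h) <;> first
          | exact Or.inl rfl
          | (exfalso; linarith)
    · obtain ⟨s1, s2⟩ := strict (1 / 2) _ (by simp) h (by linarith) (by linarith)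
      cases L <;> simp only [SideEq, PrimedEq, Matrix.cons_val_zero, Matrix.cons_val_one] <;>
        rw [h] <;> constructor <;> rintro (h | h) <;> first
          | exact Or.inr rfl
          | (exfalso; linarith)
    · obtain ⟨s1, s2⟩ := strict apothem _ (by simp) h (by linarith) (by linarith)
      cases L <;> simp only [SideEq, PrimedEq, Matrix.cons_val_zero, Matrix.cons_val_one] <;>
        rw [h] <;> constructor <;> rintro (h | h) <;> (exfalso; linarith)
    · obtain ⟨s1, s2⟩ := strict apothem _ (by simp) h (by linarith) (by linarith)
      cases L <;> simp only [SideEq, PrimedEq, Matrix.cons_val_zero, Matrix.cons_val_one] <;>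
        rw [h] <;> constructor <;> rintro (h | h) <;> (exfalso; linarith)

/-- Inside the open strips the height of the image excludes vertices and the strict bounds leave
three possible translations. The horizontal sides and diagonals, whose lines contain all the
vertices, are handled separately. -/
lemma goodImage (p : octagon) (hv : ¬ VertexEq p.1) : GoodImage p := by
  have hp := (mem_octagon_iff _).mp p.2
  by_cases hy : p.1 1 = apothem ∨ p.1 1 = -apothem ∨ p.1 1 = 1 / 2 ∨ p.1 1 = -(1 / 2)
  · exact goodImage_boundary p hv hy
  · push Not at hy
    obtain ⟨h1, h2, h3, h4⟩ := hy
    rcases h3.lt_or_gt with h3 | h3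
    · rcases h4.lt_or_gt with h4 | h4
      · exact goodImage_bottom p h4 (lt_of_le_of_ne (by linarith) h2.symm)
      · exact goodImage_middle p (abs_lt.mpr ⟨h4, h3⟩)
    · exact goodImage_top p h3 (lt_of_le_of_ne (by linarith) h1)

lemma psiGamma_not_singular {x : Surface} (hx : ¬ IsSingular x) : ¬ IsSingular (psiGamma x) := by
  obtain ⟨p, hp, rfl⟩ := exists_rep x
  rw [isSingular_toSurface_iff] at hx
  obtain ⟨q, hq, e, hv, -⟩ := goodImage ⟨p, hp⟩ hx
  rw [psiGamma_toSurface, e, isSingular_toSurface_iff]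
  exact hv

lemma onSide_psiGamma_iff {p : Plane} (hp : p ∈ octagon) (hv : ¬ VertexEq p) (L : Letter) :
    OnSide L (psiGamma (toSurface p hp)) ↔ PrimedEq L p := by
  obtain ⟨q, hq, e, hv', h⟩ := goodImage ⟨p, hp⟩ hv
  rw [psiGamma_toSurface, e, onSide_toSurface_iff hq hv']
  exact h L

lemma gammaMatrix_mulVec_ne_zero {v : Plane} (hv : v ≠ 0) : gammaMatrix.mulVec v ≠ 0 := by
  rw [gammaMatrix_mulVec]
  intro h
  have h0 := congrFun h 0
  have h1 := congrFun h 1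
  simp only [Matrix.cons_val_zero, Matrix.cons_val_one, Pi.zero_apply] at h0 h1
  apply hv
  ext m; fin_cases m
  · change v 0 = 0
    rw [h1] at h0
    linarith
  · exact h1

lemma IsTrajectory.psiGamma {τ : ℝ → Surface} {v : Plane} (hτ : IsTrajectory τ v) :
    IsTrajectory (fun t => psiGamma (τ t)) (gammaMatrix.mulVec v) := by
  refine ⟨gammaMatrix_mulVec_ne_zero hτ.1, fun t => ?_⟩
  obtain ⟨hs, p, q, ε, hε, hf, hb⟩ := hτ.2 t
  refine ⟨psiGamma_not_singular hs, ?_⟩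
  have eq : ∀ s : ℝ, q - s • v = q + s • -v := fun s => by module
  obtain ⟨p', ε₁, h1, h2, h3⟩ := psiGamma_segment hε fun s h0 h1 => (hf s h0 h1).1
  obtain ⟨q', ε₂, k1, k2, k3⟩ := psiGamma_segment (p := q) (v := -v) hε
    fun s h0 h1 => eq s ▸ (hb s h0 h1).1
  refine ⟨p', q', min ε₁ ε₂, by positivity, fun s h0 hs => ?_, fun s h0 hs => ?_⟩
  · rw [lt_min_iff] at hs
    obtain ⟨h, e⟩ := hf s h0 (by linarith)
    obtain ⟨h', e'⟩ := h3 s h0 hs.1 h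
    exact ⟨h', by dsimp only; rw [e, e']⟩
  · rw [lt_min_iff] at hs
    obtain ⟨h, e⟩ := hb s h0 (by linarith)
    obtain ⟨h', e'⟩ := k3 s h0 hs.2 (eq s ▸ h)
    have eq' : q' + s • gammaMatrix.mulVec (-v) = q' - s • gammaMatrix.mulVec v := by
      rw [Matrix.mulVec_neg]; module
    refine ⟨eq' ▸ h', ?_⟩
    dsimp only
    rw [e, toSurface_eq_of_eq h (eq s ▸ h) (eq s), e']
    exact toSurface_eq_of_eq _ _ eq'

/-! ### The preimages of the sides as pairs of opposite segments -/

/-- For `L ≠ A`, the vertex where the preimage of the side `L` which meets the side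
`sideIndex L` starts. -/
def startVertex : Letter → Plane
  | .A => ![0, 0]
  | .B => ![-apothem, 1 / 2]
  | .C => ![-apothem, -(1 / 2)]
  | .D => ![-(1 / 2), -apothem]

/-- The points of the segment from `startVertex L` to the midpoint of the side `sideIndex L`. -/
def halfPoint (L : Letter) (r : ℝ) : Plane :=
  ![(1 - r) * startVertex L 0 + r * (shift L 0 / 2), (1 - r) * startVertex L 1 + r * (shift L 1 / 2)]

lemma neg_mem_octagon {p : Plane} (hp : p ∈ octagon) : -p ∈ octagon := by
  rw [mem_octagon_iff] at hp ⊢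
  simp only [Pi.neg_apply]
  refine ⟨⟨?_, ?_⟩, ⟨?_, ?_⟩, ⟨?_, ?_⟩, ?_, ?_⟩ <;> linarith

lemma vertexEq_neg {p : Plane} (h : VertexEq p) : VertexEq (-p) := by
  simp only [VertexEq, Pi.neg_apply, neg_eq_iff_eq_neg, neg_neg] at h ⊢
  tauto

lemma vertexEq_neg_iff {p : Plane} : VertexEq (-p) ↔ VertexEq p :=
  ⟨fun h => by simpa using vertexEq_neg h, vertexEq_neg⟩

lemma lineEq_neg_iff (i : Fin 8) (p : Plane) : LineEq i (-p) ↔ LineEq (i + 4) p := by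
  rw [← normal_dot_eq_iff, ← normal_dot_eq_iff, normal_add_four, dotProduct_neg, neg_dotProduct]

lemma vertexEq_startVertex {L : Letter} (hL : L ≠ .A) : VertexEq (startVertex L) := by
  cases L
  · exact absurd rfl hL
  · exact Or.inr ⟨Or.inr rfl, Or.inl rfl⟩
  · exact Or.inr ⟨Or.inr rfl, Or.inr rfl⟩
  · exact Or.inl ⟨Or.inr rfl, Or.inr rfl⟩

lemma halfPoint_zero (L : Letter) : halfPoint L 0 = startVertex L := by
  ext m; fin_cases m <;> simp [halfPoint]

lemma lineEq_halfPoint_one (L : Letter) : LineEq (sideIndex L) (halfPoint L 1) := by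
  have ha := apothem_eq
  cases L <;> simp [LineEq, sideIndex, halfPoint, shift]
  ring

lemma primedEq_halfPoint {L : Letter} (hL : L ≠ .A) (r : ℝ) : PrimedEq L (halfPoint L r) := by
  have ha := apothem_eq
  have hsq := apothem_sq
  cases L
  · exact absurd rfl hL
  all_goals
    left
    simp only [halfPoint, startVertex, shift, Matrix.cons_val_zero, Matrix.cons_val_one,
      show halfOuter = apothem + 1 / 2 by linarith] at hsq ⊢
  · linear_combination (-r / 2) * hsq
  · ring
  · linear_combination (1 - r / 2) * hsq

lemma primedEq_neg {L : Letter} {p : Plane} (h : PrimedEq L p) : PrimedEq L (-p) := by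
  cases L <;> simp only [PrimedEq, Pi.neg_apply] at h ⊢ <;> rcases h with h | h
  all_goals first
    | exact Or.inl (by linarith)
    | exact Or.inr (by linarith)

/-- Up to p ↦ -p there is one line for each L, and the octagon cuts from it the segment from the
start vertex to the midpoint of the side. The parameter r is read from the height, and r = 0 is
excluded because it is a vertex. -/
lemma exists_halfPoint_of_eq {p : Plane} (hp : p ∈ octagon) {L : Letter} (hL : L ≠ .A)
    (hv : ¬ VertexEq p) (h : PrimedEq L p) :
    ∃ r, 0 < r ∧ r ≤ 1 ∧ (p = halfPoint L r ∨ -p = halfPoint L r) := by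
  have ha := apothem_eq
  have hb := half_lt_apothem
  have hsq := apothem_sq
  have key : ∀ p : Plane, p ∈ octagon → (match L with
      | .A => False
      | .B => p 0 = (4 * apothem + 1) * p 1 - (2 * apothem + halfOuter)
      | .C => p 0 = 4 * apothem * p 1 + apothem
      | .D => p 0 = (4 * apothem - 1) * p 1 + (2 * apothem + halfOuter)) →
      ∃ r, 0 ≤ r ∧ r ≤ 1 ∧ p = halfPoint L r := by
    intro p hp h
    rw [mem_octagon_iff] at hp
    rw [show halfOuter = apothem + 1 / 2 by linarith] at hsq h hp
    cases L
    · exact absurd rfl hL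
    · replace h : p 0 = (4 * apothem + 1) * p 1 - (2 * apothem + (apothem + 1 / 2)) := h
      -- The height goes from 1/2 to `halfOuter` / 2, an increase of (2 * apothem - 1) / 4; as (2 *
      -- apothem - 1)² = 2, division by 2 * apothem - 1 is multiplication by half of it.
      refine ⟨(2 * p 1 - 1) * (2 * apothem - 1), ?_, ?_, ?_⟩
      · refine mul_nonneg ?_ (by linarith)
        by_contra hc
        nlinarith
      · nlinarith
      · refine plane_eq ?_ ?_ <;>
          simp only [startVertex, shift, Matrix.cons_val_zero, Matrix.cons_val_one] <;>
          rw [show halfOuter = apothem + 1 / 2 by linarith]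
        · linear_combination h - (3 / 4) * (2 * p 1 - 1) * hsq
        · linear_combination (-(2 * p 1 - 1) / 4) * hsq
    · replace h : p 0 = 4 * apothem * p 1 + apothem := h
      refine ⟨2 * p 1 + 1, ?_, ?_, ?_⟩
      · by_contra hc
        nlinarith
      · by_contra hc
        nlinarith
      · refine plane_eq ?_ ?_ <;>
          simp only [startVertex, shift, Matrix.cons_val_zero, Matrix.cons_val_one]
        · rw [h]; ring
        · ring
    · replace h : p 0 = (4 * apothem - 1) * p 1 + (2 * apothem + (apothem + 1 / 2)) := h
      -- The height now starts at -apothem, and its increase is again (2 * apothem - 1) / 4.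
      refine ⟨2 * (p 1 + apothem) * (2 * apothem - 1), ?_, ?_, ?_⟩
      · refine mul_nonneg (by linarith) (by linarith)
      · nlinarith
      · refine plane_eq ?_ ?_ <;>
          simp only [startVertex, shift, Matrix.cons_val_zero, Matrix.cons_val_one] <;>
          rw [show halfOuter = apothem + 1 / 2 by linarith]
        · linear_combination h + (-1 - (p 1 + apothem) / 2) * hsq
        · linear_combination (-(p 1 + apothem) / 2) * hsq
  have key2 : ∃ r, 0 ≤ r ∧ r ≤ 1 ∧ (p = halfPoint L r ∨ -p = halfPoint L r) := by
    have hor : ∀ {q : Plane}, (q = p ∨ q = -p) → (∃ r, 0 ≤ r ∧ r ≤ 1 ∧ q = halfPoint L r) →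
        ∃ r, 0 ≤ r ∧ r ≤ 1 ∧ (p = halfPoint L r ∨ -p = halfPoint L r) := by
      rintro q (rfl | rfl) ⟨r, h1, h2, h3⟩
      exacts [⟨r, h1, h2, Or.inl h3⟩, ⟨r, h1, h2, Or.inr h3⟩]
    cases L
    · exact absurd rfl hL
    all_goals
      rcases h with h | h
      · exact hor (Or.inl rfl) (key p hp h)
      · refine hor (Or.inr rfl) (key (-p) (neg_mem_octagon hp) ?_)
        simp only [Pi.neg_apply]
        linarith
  obtain ⟨r, h1, h2, h3⟩ := key2
  refine ⟨r, lt_of_le_of_ne h1 fun e => ?_, h2, h3⟩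
  subst e
  rw [halfPoint_zero] at h3
  rcases h3 with h3 | h3
  · exact hv (h3 ▸ vertexEq_startVertex hL)
  · exact hv (vertexEq_neg_iff.mp (h3 ▸ vertexEq_startVertex hL))

/-- The half segments are inside the octagon, except for their ends. -/
lemma halfPoint_interior {L : Letter} (hL : L ≠ .A) {r : ℝ} (h0 : 0 < r) (h1 : r < 1) :
    halfPoint L r ∈ octagon ∧ ∀ i, ¬ LineEq i (halfPoint L r) := by
  have ha := apothem_eq
  have hb := half_lt_apothem
  have hsq := apothem_sq
  have k1 : r * apothem < apothem := by nlinarith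
  have k2 : 0 < r * (apothem - 1 / 2) := mul_pos h0 (by linarith)
  have k3 : 0 < (1 - r) * (apothem - 1 / 2) := mul_pos (by linarith) (by linarith)
  have hh : halfOuter = apothem + 1 / 2 := by linarith
  have strict : ((halfPoint L r) 0 < apothem ∧ -(halfPoint L r) 0 < apothem) ∧
      ((halfPoint L r) 1 < apothem ∧ -(halfPoint L r) 1 < apothem) ∧
      ((halfPoint L r) 0 + (halfPoint L r) 1 < halfOuter ∧
        -(halfPoint L r) 0 - (halfPoint L r) 1 < halfOuter) ∧
      ((halfPoint L r) 0 - (halfPoint L r) 1 < halfOuter ∧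
        (halfPoint L r) 1 - (halfPoint L r) 0 < halfOuter) := by
    cases L
    · exact absurd rfl hL
    all_goals
      simp only [halfPoint, startVertex, shift, Matrix.cons_val_zero, Matrix.cons_val_one]
      rw [hh]
      refine ⟨⟨?_, ?_⟩, ⟨?_, ?_⟩, ⟨?_, ?_⟩, ?_, ?_⟩ <;> nlinarith
  obtain ⟨⟨s1, s2⟩, ⟨s3, s4⟩, ⟨s5, s6⟩, s7, s8⟩ := strict
  constructor
  · rw [mem_octagon_iff]
    exact ⟨⟨s1.le, s2.le⟩, ⟨s3.le, s4.le⟩, ⟨s5.le, s6.le⟩, s7.le, s8.le⟩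
  · intro i hi
    fin_cases i <;> simp [LineEq] at hi <;> linarith

/-! ### Lines with slope between `0` and `tan (π / 8)` -/

/-- `m` lies between `0` and `tan (π / 8)`. -/
structure IsSlope (m : ℝ) : Prop where
  nonneg : 0 ≤ m
  mul_le : apothem * m ≤ 1 / 2
  le : m ≤ 2 * apothem - 2

/-- The line `y = m * x + b` leaves the octagon through the interior of the side `sideIndex L`. -/
def Leaves (m : ℝ) : Letter → ℝ → Prop
  | .A, b => apothem - m / 2 < b ∧ b < apothem + m / 2
  | .B, b => 1 / 2 - apothem * m < b ∧ b < apothem - m / 2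
  | .C, b => -(1 / 2) - apothem * m < b ∧ b < 1 / 2 - apothem * m
  | .D, b => -apothem - m / 2 < b ∧ b < -(1 / 2) - apothem * m

/-- The intercept of the line of slope `m` through `startVertex L`. -/
def startIntercept (m : ℝ) (L : Letter) : ℝ := startVertex L 1 - m * startVertex L 0

/-- The intercept of the line of slope `m` through the midpoint of the side `sideIndex L`. -/
def midIntercept (m : ℝ) (L : Letter) : ℝ := (shift L 1 - m * shift L 0) / 2

lemma one_lt_apothem : 1 < apothem := by
  have : (1 : ℝ) < √2 := Real.one_lt_sqrt_two
  unfold apothem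
  linarith

/-- The ends of the interval `Leaves m L` are the intercepts of the lines of slope m through the two
ends of the side. For the side A and m = 0 this interval is empty although a horizontal line can
contain the side, hence the condition on A. -/
lemma leaves_of_lineEq {m b : ℝ} (hm : IsSlope m) {L : Letter} {p : Plane} (hp : p ∈ octagon)
    (hv : ¬ VertexEq p) (h : LineEq (sideIndex L) p) (hA : L = .A → 0 < m)
    (hb : p 1 = m * p 0 + b) : Leaves m L b := by
  have hp' := (mem_octagon_iff _).mp hp
  have ha := apothem_eq
  have h1 := one_lt_apothem
  have hm0 := hm.nonneg
  have hm1 : m < 1 := by have := hm.mul_le; nlinarith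
  cases L
  · have hA := hA rfl
    replace h : p 1 = apothem := h
    have l1 : -(1 / 2) < p 0 := lt_of_le_of_ne (by linarith) fun e =>
      hv (Or.inl ⟨Or.inr e.symm, Or.inl h⟩)
    have l2 : p 0 < 1 / 2 := lt_of_le_of_ne (by linarith) fun e =>
      hv (Or.inl ⟨Or.inl e, Or.inl h⟩)
    constructor <;> nlinarith
  · replace h : p 0 + p 1 = halfOuter := h
    have l1 : 1 / 2 < p 1 := lt_of_le_of_ne (by linarith) fun e =>
      hv (Or.inr ⟨Or.inl (by linarith), Or.inl e.symm⟩)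
    have l2 : p 1 < apothem := lt_of_le_of_ne (by linarith) fun e =>
      hv (Or.inl ⟨Or.inl (by linarith), Or.inl e⟩)
    have e : p 0 = apothem + 1 / 2 - p 1 := by linarith
    rw [e] at hb
    constructor <;> nlinarith
  · replace h : p 0 = apothem := h
    have l1 : -(1 / 2) < p 1 := lt_of_le_of_ne (by linarith) fun e =>
      hv (Or.inr ⟨Or.inl h, Or.inr e.symm⟩)
    have l2 : p 1 < 1 / 2 := lt_of_le_of_ne (by linarith) fun e =>
      hv (Or.inr ⟨Or.inl h, Or.inl e⟩)
    rw [h] at hb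
    constructor <;> linarith
  · replace h : p 0 - p 1 = halfOuter := h
    have l1 : -apothem < p 1 := lt_of_le_of_ne (by linarith) fun e =>
      hv (Or.inl ⟨Or.inl (by linarith), Or.inr e.symm⟩)
    have l2 : p 1 < -(1 / 2) := lt_of_le_of_ne (by linarith) fun e =>
      hv (Or.inr ⟨Or.inl (by linarith), Or.inr e⟩)
    have e : p 0 = apothem + 1 / 2 + p 1 := by linarith
    rw [e] at hb
    constructor <;> nlinarith

/-- By symmetry, `Leaves m L (-b)` says that the line `y = m * x + b` enters the octagon through
the side opposite to `sideIndex L`. -/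
lemma diagramZero_of_leaves {m b : ℝ} (hm : IsSlope m) {L L' : Letter} (h : Leaves m L (-b))
    (h' : Leaves m L' b) : diagramZero L L' := by
  obtain ⟨h1, h2, h3⟩ := hm
  have h4 := one_lt_apothem
  have h0 : m ≤ apothem * m := le_mul_of_one_le_left h1 h4.le
  cases L <;> cases L' <;> simp only [diagramZero] <;> obtain ⟨h5, h6⟩ := h <;>
    obtain ⟨h7, h8⟩ := h' <;> linarith

/-- The intervals for D, C, B, A are stacked in this order, each one starting where the previous one
ends. -/
lemma leaves_unique {m b : ℝ} (hm : IsSlope m) {L L' : Letter} (h : Leaves m L b)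
    (h' : Leaves m L' b) : L = L' := by
  obtain ⟨h1, h2, h3⟩ := hm
  have h4 := one_lt_apothem
  have h0 : m ≤ apothem * m := le_mul_of_one_le_left h1 h4.le
  cases L <;> cases L' <;> first
    | rfl
    | (exfalso
       obtain ⟨h5, h6⟩ := h
       obtain ⟨h7, h8⟩ := h'
       linarith)

/-- The start vertices are the opposites of the vertices separating consecutive exit sides, so their
intercepts are the opposites of the common ends of the intervals in `Leaves`, which the open
intervals omit. -/
lemma ne_startIntercept {m b : ℝ} (hm : IsSlope m) {L L' : Letter} (hL : L ≠ .A)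
    (h : Leaves m L' (-b)) : b ≠ startIntercept m L := by
  obtain ⟨h1, h2, h3⟩ := hm
  have h4 := one_lt_apothem
  have h0 : m ≤ apothem * m := le_mul_of_one_le_left h1 h4.le
  rintro rfl
  cases L
  · exact hL rfl
  all_goals
    simp only [startIntercept, startVertex, Matrix.cons_val_zero, Matrix.cons_val_one] at h
    cases L' <;> obtain ⟨h5, h6⟩ := h <;> linarith

/-- A line separating `startVertex L` from the midpoint of the side `sideIndex L` leaves through
this side. -/
lemma leaves_of_separates {m b : ℝ} (hm : IsSlope m) {L : Letter} (hL : L ≠ .A)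
    (h : (b - startIntercept m L) * (b - midIntercept m L) < 0) : Leaves m L b := by
  obtain ⟨h1, h2, h3⟩ := hm
  have h4 := one_lt_apothem
  have h0 : m ≤ apothem * m := le_mul_of_one_le_left h1 h4.le
  have ha := apothem_eq
  have hh : halfOuter = apothem + 1 / 2 := by linarith
  cases L
  · exact absurd rfl hL
  all_goals
    simp only [startIntercept, midIntercept, startVertex, shift, Matrix.cons_val_zero,
      Matrix.cons_val_one, hh] at h
    rcases mul_neg_iff.mp h with ⟨k1, k2⟩ | ⟨k1, k2⟩ <;> constructor <;> linarith

/-- The line enters through the side `L` after its translation by `-shift L`. -/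
lemma leaves_reflect {m b b' : ℝ} {L : Letter} (h : Leaves m L b)
    (hb : b' = b - 2 * midIntercept m L) : Leaves m L (-b') := by
  have ha := apothem_eq
  have hh : halfOuter = apothem + 1 / 2 := by linarith
  subst hb
  cases L <;> obtain ⟨h1, h2⟩ := h <;>
    simp only [Leaves, midIntercept, shift, Matrix.cons_val_zero, Matrix.cons_val_one, hh] <;>
    constructor <;> linarith

/-- A letter different from `A` is sandwiched if and only if the line separates the end points of
the preimage of the corresponding side. -/
lemma sandwiched_iff_separates {m b b' : ℝ} (hm : IsSlope m) {L₀ L L₁ : Letter} (hL : L ≠ .A)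
    (h₀ : Leaves m L₀ (-b)) (h : Leaves m L b) (hb : b' = b - 2 * midIntercept m L)
    (h₁ : Leaves m L₁ b') :
    L₀ = L₁ ↔ (b - startIntercept m L) * (b' + startIntercept m L) < 0 := by
  have hd := diagramZero_of_leaves hm h₀ h
  have hd' := diagramZero_of_leaves hm (leaves_reflect h hb) h₁
  obtain ⟨h1, h2, h3⟩ := hm
  have h4 := one_lt_apothem
  clear h hb
  cases L
  · exact absurd rfl hL
  all_goals
    simp only [startIntercept, startVertex, Matrix.cons_val_zero, Matrix.cons_val_one]
    -- The diagram leaves two choices for each of L₀ and L₁. The start vertex lies between the two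
    -- entrance sides and its opposite between the two exit sides, so each factor has a sign
    -- determined by one of the letters.
    cases L₀ <;> first
      | exact absurd hd id
      | (cases L₁ <;> first
          | exact absurd hd' id
          | (obtain ⟨h5, h6⟩ := h₀
             obtain ⟨h7, h8⟩ := h₁
             first
             | exact iff_of_true rfl (mul_neg_of_pos_of_neg (by linarith) (by linarith))
             | exact iff_of_true rfl (mul_neg_of_neg_of_pos (by linarith) (by linarith))
             | exact iff_of_false (by simp)
                 (mul_nonneg (by linarith) (by linarith)).not_gt
             | exact iff_of_false (by simp)
                 (mul_nonneg_of_nonpos_of_nonpos (by linarith) (by linarith)).not_gt))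

/-- In `diagramZero` the letter A is preceded and followed only by D. -/
lemma sandwiched_A {m b b' : ℝ} (hm : IsSlope m) {L₀ L₁ : Letter}
    (h₀ : Leaves m L₀ (-b)) (h : Leaves m .A b) (hb : b' = b - 2 * midIntercept m .A)
    (h₁ : Leaves m L₁ b') : L₀ = L₁ := by
  have hd := diagramZero_of_leaves hm h₀ h
  have hd' := diagramZero_of_leaves hm (leaves_reflect h hb) h₁
  cases L₀ <;> cases L₁ <;> first
    | rfl
    | exact absurd hd id
    | exact absurd hd' id

lemma halfPoint_intercept (m : ℝ) (L : Letter) (r : ℝ) :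
    halfPoint L r 1 - m * halfPoint L r 0 =
      startIntercept m L + r * (midIntercept m L - startIntercept m L) := by
  simp only [halfPoint, startIntercept, midIntercept, Matrix.cons_val_zero, Matrix.cons_val_one]
  ring

/-- The intercept is affine along the half segment, so an interior point lies strictly between its
ends; the condition on b excludes a half segment contained in the line. -/
lemma separates_of_halfPoint {m b r : ℝ} {L : Letter} (hb : b ≠ startIntercept m L)
    (h0 : 0 < r) (h1 : r < 1) (h : halfPoint L r 1 = m * halfPoint L r 0 + b) :
    (b - startIntercept m L) * (b - midIntercept m L) < 0 := by
  have e := halfPoint_intercept m L r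
  have e1 : b - startIntercept m L = r * (midIntercept m L - startIntercept m L) := by linarith
  have e2 : b - midIntercept m L = -((1 - r) * (midIntercept m L - startIntercept m L)) := by
    linarith
  have hne : midIntercept m L - startIntercept m L ≠ 0 := by
    intro h
    rw [h, mul_zero] at e1
    exact hb (by linarith)
  have := mul_pos (mul_pos h0 (by linarith : 0 < 1 - r)) (mul_self_pos.mpr hne)
  rw [e1, e2]
  linarith

lemma exists_halfPoint_of_separates {m b : ℝ} {L : Letter}
    (h : (b - startIntercept m L) * (b - midIntercept m L) < 0) :
    ∃ r, 0 < r ∧ r < 1 ∧ halfPoint L r 1 = m * halfPoint L r 0 + b := by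
  set x := startIntercept m L with hx
  set y := midIntercept m L with hy
  have hne : y - x ≠ 0 := by
    intro h0
    have : y = x := by linarith
    rw [this] at h
    exact absurd h (mul_self_nonneg _).not_gt
  have hr : (b - x) / (y - x) * (y - x) = b - x := div_mul_cancel₀ _ hne
  refine ⟨(b - x) / (y - x), ?_, ?_, ?_⟩
  · rw [div_pos_iff]
    rcases mul_neg_iff.mp h with ⟨h1, h2⟩ | ⟨h1, h2⟩
    exacts [Or.inl ⟨h1, by linarith⟩, Or.inr ⟨h1, by linarith⟩]
  · rcases mul_neg_iff.mp h with ⟨h1, h2⟩ | ⟨h1, h2⟩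
    · rw [div_lt_one (by linarith)]; linarith
    · rw [div_lt_one_of_neg (by linarith)]; linarith
  · have := halfPoint_intercept m L ((b - x) / (y - x))
    rw [← hx, ← hy, hr] at this
    linarith

lemma halfPoint_unique {m b r r' : ℝ} {L : Letter} (hb : b ≠ startIntercept m L)
    (hr : halfPoint L r 1 = m * halfPoint L r 0 + b)
    (hr' : halfPoint L r' 1 = m * halfPoint L r' 0 + b) : r = r' := by
  have e := halfPoint_intercept m L r
  have e' := halfPoint_intercept m L r'
  have hne : midIntercept m L - startIntercept m L ≠ 0 := by
    intro h
    rw [h, mul_zero] at e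
    exact hb (by linarith)
  exact mul_right_cancel₀ hne (by linarith)

/-- In the same chord, the segment starting at the entrance side is met before the segment ending
at the exit side. -/
lemma halfPoint_order {m b r r' : ℝ} (hm : IsSlope m) {L L' : Letter} (hL : L ≠ .A) (hL' : L' ≠ .A)
    (h : Leaves m L (-b)) (h' : Leaves m L' b)
    (hr : 0 < r ∧ r < 1) (hr' : 0 < r' ∧ r' < 1)
    (e : (-b - startIntercept m L) * (-b - midIntercept m L) < 0)
    (e' : (b - startIntercept m L') * (b - midIntercept m L') < 0) :
    (-halfPoint L r) 1 < halfPoint L' r' 1 := by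
  have hd := diagramZero_of_leaves hm h h'
  obtain ⟨h1, h2, h3⟩ := hm
  have h4 := one_lt_apothem
  have h0 : m ≤ apothem * m := le_mul_of_one_le_left h1 h4.le
  have ha := apothem_eq
  have hh : halfOuter = apothem + 1 / 2 := by linarith
  obtain ⟨h5, h6⟩ := hr
  obtain ⟨h7, h8⟩ := hr'
  have k1 : 0 < r * (apothem - 1 / 2) := mul_pos h5 (by linarith)
  have k2 : 0 < r' * (apothem - 1 / 2) := mul_pos h7 (by linarith)
  cases L <;> cases L' <;> first
    | exact absurd rfl hL
    | exact absurd rfl hL'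
    | exact absurd hd id
    | (simp only [halfPoint, startVertex, shift, Matrix.cons_val_zero, Matrix.cons_val_one, hh,
        Pi.neg_apply]
       linarith)
    -- This concerns the transitions BD, CC and DB, where the heights are in the opposite order but
    -- no line can meet both half segments.
    | (exfalso
       simp only [startIntercept, midIntercept, startVertex, shift, Matrix.cons_val_zero,
         Matrix.cons_val_one, hh] at e e'
       obtain ⟨h9, h10⟩ := h
       obtain ⟨h11, h12⟩ := h'
       rcases mul_neg_iff.mp e with ⟨k1, k2⟩ | ⟨k1, k2⟩ <;>
         rcases mul_neg_iff.mp e' with ⟨k3, k4⟩ | ⟨k3, k4⟩ <;> linarith)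

/-! ### Trajectories with direction in the closed sector `0` -/

lemma lineEq_sub_shift {L : Letter} {p : Plane} (h : LineEq (sideIndex L) p) :
    LineEq (sideIndex L + 4) (p - shift L) := by
  cases L
  · replace h : p 1 = apothem := h
    change p 1 - 2 * apothem = -apothem
    linarith
  · replace h : p 0 + p 1 = halfOuter := h
    change (p 0 - halfOuter) + (p 1 - halfOuter) = -halfOuter
    linarith
  · replace h : p 0 = apothem := h
    change p 0 - 2 * apothem = -apothem
    linarith
  · replace h : p 0 - p 1 = halfOuter := h
    change (p 0 - halfOuter) - (p 1 - -halfOuter) = -halfOuter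
    linarith

/-- The trajectory `τ` crosses the sides with labels `w n` at the times `t n`, and follows between
the times `t n` and `t (n + 1)` the chord `c n + s • v`, of slope `m` and intercept `b n`. -/
structure Chords (τ : ℝ → Surface) (v : Plane) (w : Word) (t : ℤ → ℝ) (c : ℤ → Plane) (m : ℝ)
    (b : ℤ → ℝ) : Prop where
  traj : IsTrajectory τ v
  slope : IsSlope m
  pos : 0 < v 0
  vel : v 1 = m * v 0
  mono : StrictMono t
  follows : ∀ n, Follows τ v (c n) (t n) (t (n + 1))
  exit : ∀ n, LineEq (sideIndex (w n)) (c (n - 1) + t n • v)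
  transversal : ∀ n, 0 < normal (sideIndex (w n)) ⬝ᵥ v
  step : ∀ n, c n = c (n - 1) - shift (w n)
  intercept : ∀ n, b n = c n 1 - m * c n 0
  between : ∀ n s, t n < s → s < t (n + 1) → ∀ L, ¬ OnSide L (τ s)
  cover : ∀ s, ∃ n, t n ≤ s ∧ s < t (n + 1)

/-! ### The chords of a trajectory and the half segments which they meet. -/

namespace Chords

variable {τ : ℝ → Surface} {v : Plane} {w : Word} {t : ℤ → ℝ} {c : ℤ → Plane} {m : ℝ} {b : ℤ → ℝ}

lemma time_lt (h : Chords τ v w t c m b) (n : ℤ) : t n < t (n + 1) := h.mono (by omega)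

lemma time_pred_lt (h : Chords τ v w t c m b) (n : ℤ) : t (n - 1) < t n := h.mono (by omega)

lemma follows_pred (h : Chords τ v w t c m b) (n : ℤ) :
    Follows τ v (c (n - 1)) (t (n - 1)) (t n) := by
  simpa using h.follows (n - 1)

lemma line (h : Chords τ v w t c m b) (n : ℤ) (s : ℝ) :
    (c n + s • v) 1 = m * (c n + s • v) 0 + b n := by
  simp only [Pi.add_apply, Pi.smul_apply, smul_eq_mul, h.vel, h.intercept n]
  ring

lemma not_vertexEq (h : Chords τ v w t c m b) {n : ℤ} {s : ℝ} (h1 : t n ≤ s) (h2 : s ≤ t (n + 1)) :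
    ¬ VertexEq (c n + s • v) := by
  obtain ⟨hm, he⟩ := h.follows n s h1 h2
  rw [← isSingular_toSurface_iff hm, ← he]
  exact (h.traj.2 s).1

lemma entry (h : Chords τ v w t c m b) (n : ℤ) :
    LineEq (sideIndex (w n) + 4) (c n + t n • v) := by
  have := lineEq_sub_shift (h.exit n)
  rwa [show c (n - 1) + t n • v - shift (w n) = c n + t n • v by rw [h.step n]; module] at this

lemma intercept_step (h : Chords τ v w t c m b) (n : ℤ) :
    b n = b (n - 1) - 2 * midIntercept m (w n) := by
  rw [h.intercept n, h.intercept (n - 1), midIntercept, h.step n]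
  simp only [Pi.sub_apply]
  ring

lemma leaves (h : Chords τ v w t c m b) (n : ℤ) : Leaves m (w n) (b (n - 1)) := by
  have hn : n - 1 + 1 = n := by omega
  have h1 := h.time_pred_lt n
  refine leaves_of_lineEq h.slope (h.follows_pred n (t n) h1.le le_rfl).1
    (h.not_vertexEq h1.le (by rw [hn])) (h.exit n) ?_ (h.line _ _)
  -- For the side A, transversality means that the vertical speed is positive, so m > 0.
  intro hA
  have := h.transversal n
  rw [hA] at this
  have e : normal (sideIndex .A) ⬝ᵥ v = v 1 := by simp [sideIndex, normal]; rfl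
  rw [e, h.vel] at this
  exact pos_of_mul_pos_left this h.pos.le

lemma leaves_succ (h : Chords τ v w t c m b) (n : ℤ) : Leaves m (w (n + 1)) (b n) := by
  simpa using h.leaves (n + 1)

lemma enters (h : Chords τ v w t c m b) (n : ℤ) : Leaves m (w n) (-b n) :=
  leaves_reflect (h.leaves n) (h.intercept_step n)

lemma diagram (h : Chords τ v w t c m b) (n : ℤ) : diagramZero (w n) (w (n + 1)) :=
  diagramZero_of_leaves h.slope (h.enters n) (h.leaves_succ n)

lemma not_lineEq (h : Chords τ v w t c m b) {n : ℤ} {s : ℝ} (h1 : t n < s) (h2 : s < t (n + 1))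
    (i : Fin 8) : ¬ LineEq i (c n + s • v) := by
  intro hi
  obtain ⟨hm, he⟩ := h.follows n s h1.le h2.le
  obtain ⟨L, hL⟩ := exists_onSide_of_lineEq hm hi
  exact h.between n s h1 h2 L (he ▸ hL)

lemma exists_param (h : Chords τ v w t c m b) {n : ℤ} {p : Plane} (hb : p 1 = m * p 0 + b n) :
    ∃ s : ℝ, c n + s • v = p := by
  have hs : (p 0 - c n 0) / v 0 * v 0 = p 0 - c n 0 := div_mul_cancel₀ _ h.pos.ne'
  have e0 : (c n + ((p 0 - c n 0) / v 0) • v) 0 = p 0 := by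
    simp only [Pi.add_apply, Pi.smul_apply, smul_eq_mul, hs]; ring
  have e1 := h.line n ((p 0 - c n 0) / v 0)
  rw [e0, ← hb] at e1
  refine ⟨(p 0 - c n 0) / v 0, ?_⟩
  ext k; fin_cases k
  exacts [e0, e1]

/-- A point of the line strictly inside the octagon is strictly inside the half planes of the
entrance and exit sides, to which v is transversal; this places its time strictly between the two
crossings. -/
lemma exists_time (h : Chords τ v w t c m b) {n : ℤ} {p : Plane} (hp : p ∈ octagon)
    (hi : ∀ i, ¬ LineEq i p) (hb : p 1 = m * p 0 + b n) :
    ∃ s, t n < s ∧ s < t (n + 1) ∧ c n + s • v = p := by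
  obtain ⟨s, e⟩ := h.exists_param hb
  have strict : ∀ i, normal i ⬝ᵥ (c n + s • v) < apothem := fun i =>
    lt_of_le_of_ne (e ▸ hp i) fun h' => hi i (by rw [← e, ← normal_dot_eq_iff]; exact h')
  refine ⟨s, ?_, ?_, e⟩
  · have l1 := strict (sideIndex (w n) + 4)
    have l2 := (normal_dot_eq_iff _ _).mpr (h.entry n)
    have l3 := h.transversal n
    rw [normal_dot_add_smul, normal_add_four, neg_dotProduct, neg_dotProduct] at l1 l2
    by_contra hc
    nlinarith
  · have l1 := strict (sideIndex (w (n + 1)))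
    have l2 := h.exit (n + 1)
    rw [add_sub_cancel_right, ← normal_dot_eq_iff] at l2
    have l3 := h.transversal (n + 1)
    rw [normal_dot_add_smul] at l1 l2
    by_contra hc
    nlinarith

lemma onSide_psiGamma_iff (h : Chords τ v w t c m b) {n : ℤ} {s : ℝ} (h1 : t n ≤ s)
    (h2 : s ≤ t (n + 1)) (L : Letter) :
    OnSide L (psiGamma (τ s)) ↔ PrimedEq L (c n + s • v) := by
  obtain ⟨hm, he⟩ := h.follows n s h1 h2
  rw [he, OctagonCutting.onSide_psiGamma_iff hm (h.not_vertexEq h1 h2)]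

/-- The point of the trajectory at the time `s`, in the chord `n`, is on the part of the preimage of
the side `L` which ends at the exit side. -/
def HitsBefore (v : Plane) (t : ℤ → ℝ) (c : ℤ → Plane) (n : ℤ) (L : Letter) (s : ℝ) : Prop :=
  t n < s ∧ s < t (n + 1) ∧ L ≠ .A ∧ ∃ r, 0 < r ∧ r < 1 ∧ c n + s • v = halfPoint L r

/-- The point of the trajectory at the time `s`, in the chord `n`, is on the part of the preimage of
the side `L` which starts at the entrance side. -/
def HitsAfter (v : Plane) (t : ℤ → ℝ) (c : ℤ → Plane) (n : ℤ) (L : Letter) (s : ℝ) : Prop :=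
  t n < s ∧ s < t (n + 1) ∧ L ≠ .A ∧ ∃ r, 0 < r ∧ r < 1 ∧ -(c n + s • v) = halfPoint L r

/-- Strictly between two crossings the point is on no side, which excludes L = A and the end r = 1
of a half segment. -/
lemma hits_of_onSide (h : Chords τ v w t c m b) {n : ℤ} {s : ℝ} (h1 : t n < s)
    (h2 : s < t (n + 1)) {L : Letter} (hL : OnSide L (psiGamma (τ s))) :
    HitsBefore v t c n L s ∨ HitsAfter v t c n L s := by
  have hni := h.not_lineEq h1 h2
  rw [h.onSide_psiGamma_iff h1.le h2.le] at hL
  have hLA : L ≠ .A := by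
    rintro rfl
    rcases hL with hL | hL
    exacts [hni 0 hL, hni 4 hL]
  obtain ⟨r, hr0, hr1, hr⟩ := exists_halfPoint_of_eq (h.follows n s h1.le h2.le).1 hLA
    (h.not_vertexEq h1.le h2.le) hL
  have hr1 : r < 1 := by
    refine lt_of_le_of_ne hr1 ?_
    rintro rfl
    have := lineEq_halfPoint_one L
    rcases hr with hr | hr <;> rw [← hr] at this
    · exact hni _ this
    · rw [lineEq_neg_iff] at this
      exact hni _ this
  rcases hr with hr | hr
  exacts [Or.inl ⟨h1, h2, hLA, r, hr0, hr1, hr⟩, Or.inr ⟨h1, h2, hLA, r, hr0, hr1, hr⟩]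

lemma onSide_of_hitsBefore (h : Chords τ v w t c m b) {n : ℤ} {s : ℝ} {L : Letter}
    (hs : HitsBefore v t c n L s) : OnSide L (psiGamma (τ s)) := by
  obtain ⟨h1, h2, hL, r, -, -, e⟩ := hs
  rw [h.onSide_psiGamma_iff h1.le h2.le, e]
  exact primedEq_halfPoint hL r

lemma onSide_of_hitsAfter (h : Chords τ v w t c m b) {n : ℤ} {s : ℝ} {L : Letter}
    (hs : HitsAfter v t c n L s) : OnSide L (psiGamma (τ s)) := by
  obtain ⟨h1, h2, hL, r, -, -, e⟩ := hs
  rw [h.onSide_psiGamma_iff h1.le h2.le, ← neg_neg (c n + s • v), e]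
  exact primedEq_neg (primedEq_halfPoint hL r)

lemma neg_line (h : Chords τ v w t c m b) (n : ℤ) (s : ℝ) :
    (-(c n + s • v)) 1 = m * (-(c n + s • v)) 0 + -b n := by
  have := h.line n s
  simp only [Pi.neg_apply]
  linarith

lemma ne_start (h : Chords τ v w t c m b) (n : ℤ) {L : Letter} (hL : L ≠ .A) :
    b n ≠ startIntercept m L := ne_startIntercept h.slope hL (h.enters n)

lemma neg_ne_start (h : Chords τ v w t c m b) (n : ℤ) {L : Letter} (hL : L ≠ .A) :
    -b n ≠ startIntercept m L :=
  ne_startIntercept h.slope hL (by rw [neg_neg]; exact h.leaves_succ n)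

lemma separates_of_hitsBefore (h : Chords τ v w t c m b) {n : ℤ} {s : ℝ} {L : Letter}
    (hs : HitsBefore v t c n L s) :
    (b n - startIntercept m L) * (b n - midIntercept m L) < 0 := by
  obtain ⟨h1, h2, hL, r, h3, h4, e⟩ := hs
  exact separates_of_halfPoint (h.ne_start n hL) h3 h4 (e ▸ h.line n s)

lemma separates_of_hitsAfter (h : Chords τ v w t c m b) {n : ℤ} {s : ℝ} {L : Letter}
    (hs : HitsAfter v t c n L s) :
    (-b n - startIntercept m L) * (-b n - midIntercept m L) < 0 := by
  obtain ⟨h1, h2, hL, r, h3, h4, e⟩ := hs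
  exact separates_of_halfPoint (h.neg_ne_start n hL) h3 h4 (e ▸ h.neg_line n s)

/-- A line passing between the start vertex and the midpoint of the side L has to leave through L.
-/
lemma eq_of_hitsBefore (h : Chords τ v w t c m b) {n : ℤ} {s : ℝ} {L : Letter}
    (hs : HitsBefore v t c n L s) : L = w (n + 1) :=
  leaves_unique h.slope (leaves_of_separates h.slope hs.2.2.1 (h.separates_of_hitsBefore hs))
    (h.leaves_succ n)

lemma eq_of_hitsAfter (h : Chords τ v w t c m b) {n : ℤ} {s : ℝ} {L : Letter}
    (hs : HitsAfter v t c n L s) : L = w n :=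
  leaves_unique h.slope (leaves_of_separates h.slope hs.2.2.1 (h.separates_of_hitsAfter hs))
    (h.enters n)

lemma time_unique (h : Chords τ v w t c m b) {n : ℤ} {s s' : ℝ}
    (e : c n + s • v = c n + s' • v) : s = s' := by
  have := congrFun (add_left_cancel e) 0
  simp only [Pi.smul_apply, smul_eq_mul] at this
  exact mul_right_cancel₀ h.pos.ne' this

lemma hitsBefore_unique (h : Chords τ v w t c m b) {n : ℤ} {s s' : ℝ} {L : Letter}
    (hs : HitsBefore v t c n L s) (hs' : HitsBefore v t c n L s') : s = s' := by
  obtain ⟨-, -, hL, r, -, -, e⟩ := hs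
  obtain ⟨-, -, -, r', -, -, e'⟩ := hs'
  have := halfPoint_unique (h.ne_start n hL) (e ▸ h.line n s) (e' ▸ h.line n s')
  subst this
  exact h.time_unique (e.trans e'.symm)

lemma hitsAfter_unique (h : Chords τ v w t c m b) {n : ℤ} {s s' : ℝ} {L : Letter}
    (hs : HitsAfter v t c n L s) (hs' : HitsAfter v t c n L s') : s = s' := by
  obtain ⟨-, -, hL, r, -, -, e⟩ := hs
  obtain ⟨-, -, -, r', -, -, e'⟩ := hs'
  have := halfPoint_unique (h.neg_ne_start n hL) (e ▸ h.neg_line n s) (e' ▸ h.neg_line n s')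
  subst this
  exact h.time_unique (neg_injective (e.trans e'.symm))

lemma exists_hitsBefore (h : Chords τ v w t c m b) {n : ℤ} {L : Letter} (hL : L ≠ .A)
    (hb : (b n - startIntercept m L) * (b n - midIntercept m L) < 0) :
    ∃ s, HitsBefore v t c n L s := by
  obtain ⟨r, h0, h1, e⟩ := exists_halfPoint_of_separates hb
  obtain ⟨hp, hi⟩ := halfPoint_interior hL h0 h1
  obtain ⟨s, k1, k2, k3⟩ := h.exists_time hp hi e
  exact ⟨s, k1, k2, hL, r, h0, h1, k3⟩

lemma exists_hitsAfter (h : Chords τ v w t c m b) {n : ℤ} {L : Letter} (hL : L ≠ .A)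
    (hb : (-b n - startIntercept m L) * (-b n - midIntercept m L) < 0) :
    ∃ s, HitsAfter v t c n L s := by
  obtain ⟨r, h0, h1, e⟩ := exists_halfPoint_of_separates hb
  obtain ⟨hp, hi⟩ := halfPoint_interior hL h0 h1
  obtain ⟨s, k1, k2, k3⟩ := h.exists_time (p := -halfPoint L r) (neg_mem_octagon hp)
    (fun i hi' => hi (i + 4) ((lineEq_neg_iff _ _).mp hi'))
    (by simp only [Pi.neg_apply]; linarith)
  exact ⟨s, k1, k2, hL, r, h0, h1, by rw [k3, neg_neg]⟩

lemma hits_order (h : Chords τ v w t c m b) {n : ℤ} {s s' : ℝ} {L L' : Letter}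
    (hs : HitsAfter v t c n L s) (hs' : HitsBefore v t c n L' s') : s < s' := by
  have e1 := h.separates_of_hitsAfter hs
  have e2 := h.separates_of_hitsBefore hs'
  have hL := h.eq_of_hitsAfter hs
  have hL' := h.eq_of_hitsBefore hs'
  obtain ⟨-, -, hA, r, h0, h1, e⟩ := hs
  obtain ⟨-, -, hA', r', h0', h1', e'⟩ := hs'
  have := halfPoint_order h.slope hA hA' (hL ▸ h.enters n) (hL' ▸ h.leaves_succ n) ⟨h0, h1⟩
    ⟨h0', h1'⟩ e1 e2
  rw [← e, ← e', neg_neg] at this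
  simp only [Pi.add_apply, Pi.smul_apply, smul_eq_mul, add_lt_add_iff_left] at this
  have hv : 0 ≤ v 1 := by rw [h.vel]; exact mul_nonneg h.slope.nonneg h.pos.le
  exact lt_of_mul_lt_mul_right this hv

/-- At the time `s` the trajectory crosses the preimage of the side `w n`, near its `n`-th crossing
of the sides. -/
def Near (τ : ℝ → Surface) (v : Plane) (w : Word) (t : ℤ → ℝ) (c : ℤ → Plane) (n : ℤ) (s : ℝ) :
    Prop :=
  HitsBefore v t c (n - 1) (w n) s ∨ (s = t n ∧ OnSide (w n) (psiGamma (τ s))) ∨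
    HitsAfter v t c n (w n) s

lemma onSide_of_near (h : Chords τ v w t c m b) {n : ℤ} {s : ℝ} (hs : Near τ v w t c n s) :
    OnSide (w n) (psiGamma (τ s)) := by
  rcases hs with hs | hs | hs
  exacts [h.onSide_of_hitsBefore hs, hs.2, h.onSide_of_hitsAfter hs]

/-- Inside a chord, the half segments met belong to the entrance or to the exit side. At the
crossing time itself the point is on the boundary, where a half segment has only its vertex, which
is excluded, and its midpoint. -/
lemma exists_near (h : Chords τ v w t c m b) {L : Letter} {s : ℝ}
    (hL : OnSide L (psiGamma (τ s))) : ∃ n, Near τ v w t c n s := by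
  obtain ⟨n, h1, h2⟩ := h.cover s
  rcases h1.lt_or_eq with h1 | rfl
  · rcases h.hits_of_onSide h1 h2 hL with hs | hs
    · refine ⟨n + 1, Or.inl ?_⟩
      rw [← h.eq_of_hitsBefore hs, add_sub_cancel_right]
      exact hs
    · exact ⟨n, Or.inr (Or.inr (h.eq_of_hitsAfter hs ▸ hs))⟩
  · refine ⟨n, Or.inr (Or.inl ⟨rfl, ?_⟩)⟩
    suffices L = w n from this ▸ hL
    rw [h.onSide_psiGamma_iff le_rfl h2.le] at hL
    have hv := h.not_vertexEq le_rfl h2.le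
    have hm := (h.follows n _ le_rfl h2.le).1
    have he := h.entry n
    have lab : ∀ i, LineEq i (c n + t n • v) → label i = w n := by
      intro i hi
      have : i = sideIndex (w n) + 4 := by
        by_contra hne
        exact hv (vertexEq_of_lineEq hm hne hi he)
      rw [this]
      cases w n <;> rfl
    by_cases hA : L = .A
    · subst hA
      rcases hL with hL | hL
      exacts [lab 0 hL, lab 4 hL]
    · obtain ⟨r, hr0, hr1, hr⟩ := exists_halfPoint_of_eq hm hA hv hL
      rcases hr1.lt_or_eq with hr1 | rfl
      · have hi := (halfPoint_interior hA hr0 hr1).2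
        rcases hr with hr | hr <;> rw [← hr] at hi
        · exact absurd he (hi _)
        · exact absurd ((lineEq_neg_iff _ _).mpr (by rwa [add_assoc, show (4 : Fin 8) + 4 = 0 from rfl,
            add_zero])) (hi (sideIndex (w n) + 4 + 4))
      · have hl := lineEq_halfPoint_one L
        rcases hr with hr | hr <;> rw [← hr] at hl
        · rw [← lab _ hl]
          cases L <;> rfl
        · rw [lineEq_neg_iff] at hl
          rw [← lab _ hl]
          cases L <;> rfl

end Chords

/-- The hypothesis says |u| < |d|, so a nonzero u is strictly between 0 and d or strictly between 0
and -d. -/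
lemma mul_neg_or_mul_neg {u d : ℝ} (hu : u ≠ 0) (h : (u - d) * (u + d) < 0) :
    u * (u - d) < 0 ∨ u * (u + d) < 0 := by
  rcases mul_neg_iff.mp h with ⟨h1, h2⟩ | ⟨h1, h2⟩ <;> rcases lt_or_gt_of_ne hu with hu | hu
  · exact Or.inl (mul_neg_of_neg_of_pos hu h1)
  · exact Or.inr (mul_neg_of_pos_of_neg hu h2)
  · exact Or.inr (mul_neg_of_neg_of_pos hu h2)
  · exact Or.inl (mul_neg_of_pos_of_neg hu h1)

/-! ### Sandwiched letters correspond to crossings of the preimages. -/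

namespace Chords

variable {τ : ℝ → Surface} {v : Plane} {w : Word} {t : ℤ → ℝ} {c : ℤ → Plane} {m : ℝ} {b : ℤ → ℝ}

/-- For a letter other than A, the preimage of the side meets that side, away from the vertices,
only at its midpoint; so the chord must pass through this midpoint. -/
lemma onSide_at_iff (h : Chords τ v w t c m b) (n : ℤ) :
    OnSide (w n) (psiGamma (τ (t n))) ↔ w n = .A ∨ b (n - 1) - midIntercept m (w n) = 0 := by
  have hlt := h.time_lt n
  have hm := (h.follows n _ le_rfl hlt.le).1
  have hv := h.not_vertexEq le_rfl hlt.le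
  have he := h.entry n
  have hstep := h.intercept_step n
  have hone := halfPoint_intercept m (w n) 1
  rw [h.onSide_psiGamma_iff le_rfl hlt.le]
  constructor
  · intro hs
    by_cases hA : w n = .A
    · exact Or.inl hA
    · right
      obtain ⟨r, hr0, hr1, hr⟩ := exists_halfPoint_of_eq hm hA hv hs
      have hi : r < 1 → ∀ i, ¬ LineEq i (halfPoint (w n) r) :=
        fun h => (halfPoint_interior hA hr0 h).2
      have hl := lineEq_halfPoint_one (w n)
      rcases hr1.lt_or_eq with hr1 | rfl
      · rcases hr with hr | hr
        · exact absurd (hr ▸ he) (hi hr1 _)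
        · refine absurd (hr ▸ (lineEq_neg_iff (sideIndex (w n)) _).mpr he) (hi hr1 _)
      · rcases hr with hr | hr
        · rw [← hr] at hl
          refine absurd (vertexEq_of_lineEq hm ?_ hl he) hv
          cases w n <;> decide
        · have := h.neg_line n (t n)
          rw [hr] at this
          linarith
  · rintro (hA | hu)
    · rw [hA] at he ⊢
      exact Or.inr he
    · by_cases hA : w n = .A
      · rw [hA] at he ⊢
        exact Or.inr he
      · obtain ⟨s, hs⟩ := h.exists_param (n := n) (p := -halfPoint (w n) 1)
          (by simp only [Pi.neg_apply]; linarith)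
        have hl := lineEq_halfPoint_one (w n)
        rw [← neg_neg (halfPoint (w n) 1), lineEq_neg_iff, ← hs, ← normal_dot_eq_iff,
          normal_dot_add_smul] at hl
        rw [← normal_dot_eq_iff, normal_dot_add_smul] at he
        have ht := h.transversal n
        rw [normal_add_four, neg_dotProduct, neg_dotProduct] at hl he
        have hst : s = t n := mul_right_cancel₀ ht.ne' (by linarith)
        rw [← hst, hs]
        exact primedEq_neg (primedEq_halfPoint hA 1)

/-- The position of the line with respect to the preimage of the side `w n`. -/
lemma near_cases (h : Chords τ v w t c m b) {n : ℤ} (hA : w n ≠ .A) {u d : ℝ}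
    (hu : u = b (n - 1) - midIntercept m (w n))
    (hd : d = startIntercept m (w n) - midIntercept m (w n)) {s : ℝ} :
    (HitsBefore v t c (n - 1) (w n) s → u * (u - d) < 0) ∧
      (HitsAfter v t c n (w n) s → u * (u + d) < 0) ∧
      (OnSide (w n) (psiGamma (τ (t n))) ↔ u = 0) ∧
      (u * (u - d) < 0 → ∃ s, HitsBefore v t c (n - 1) (w n) s) ∧
      (u * (u + d) < 0 → ∃ s, HitsAfter v t c n (w n) s) ∧ u ≠ d ∧
      (IsSandwiched w n ↔ (u - d) * (u + d) < 0) := by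
  have hstep := h.intercept_step n
  -- Intercepts are measured from the midpoint of the side: the chord before the crossing is at u
  -- and the start vertex at d. The chord after the crossing, reflected through the centre, is at
  -- -u, which is why its condition has u + d in place of u - d.
  have e1 : (b (n - 1) - startIntercept m (w n)) * (b (n - 1) - midIntercept m (w n)) =
      u * (u - d) := by rw [hu, hd]; ring
  have e2 : (-b n - startIntercept m (w n)) * (-b n - midIntercept m (w n)) =
      u * (u + d) := by rw [hu, hd, hstep]; ring
  have e3 : (b (n - 1) - startIntercept m (w n)) * (b n + startIntercept m (w n)) =
      (u - d) * (u + d) := by rw [hu, hd, hstep]; ring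
  refine ⟨fun hs => ?_, fun hs => ?_, ?_, fun hs => ?_, fun hs => ?_, ?_, ?_⟩
  · rw [← e1]; exact h.separates_of_hitsBefore hs
  · rw [← e2]; exact h.separates_of_hitsAfter hs
  · rw [h.onSide_at_iff, hu]
    exact or_iff_right hA
  · exact h.exists_hitsBefore hA (by rw [e1]; exact hs)
  · exact h.exists_hitsAfter hA (by rw [e2]; exact hs)
  · intro hud
    exact h.ne_start (n - 1) hA (by linarith)
  · rw [← e3]
    exact sandwiched_iff_separates h.slope hA (h.enters (n - 1)) (h.leaves n) hstep
      (h.leaves_succ n)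

lemma isSandwiched_of_eq_A (h : Chords τ v w t c m b) {n : ℤ} (hA : w n = .A) :
    IsSandwiched w n := by
  have h1 := h.leaves n
  have h2 := h.intercept_step n
  rw [hA] at h1 h2
  exact sandwiched_A h.slope (h.enters (n - 1)) h1 h2 (h.leaves_succ n)

/-- Sandwiched means |u| < |d|: the line passes between the two ends of the preimage. It then meets
one half, the other half, or the midpoint, according to the position of u relative to 0. -/
lemma isSandwiched_iff (h : Chords τ v w t c m b) (n : ℤ) :
    IsSandwiched w n ↔ ∃ s, Near τ v w t c n s := by
  by_cases hA : w n = .A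
  · exact iff_of_true (h.isSandwiched_of_eq_A hA)
      ⟨t n, Or.inr (Or.inl ⟨rfl, (h.onSide_at_iff n).mpr (Or.inl hA)⟩)⟩
  · obtain ⟨u, hu⟩ : ∃ u, u = b (n - 1) - midIntercept m (w n) := ⟨_, rfl⟩
    obtain ⟨d, hd⟩ : ∃ d, d = startIntercept m (w n) - midIntercept m (w n) := ⟨_, rfl⟩
    constructor
    · intro hs
      obtain ⟨-, -, h3, h4, h5, h6, h7⟩ := h.near_cases hA hu hd (s := 0)
      rw [h7] at hs
      rcases eq_or_ne u 0 with hu0 | hu0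
      · exact ⟨t n, Or.inr (Or.inl ⟨rfl, h3.mpr hu0⟩)⟩
      · rcases mul_neg_or_mul_neg hu0 hs with hs | hs
        · obtain ⟨s, hs⟩ := h4 hs
          exact ⟨s, Or.inl hs⟩
        · obtain ⟨s, hs⟩ := h5 hs
          exact ⟨s, Or.inr (Or.inr hs)⟩
    · rintro ⟨s, hs⟩
      obtain ⟨h1, h2, h3, -, -, h6, h7⟩ := h.near_cases hA hu hd (s := s)
      rw [h7]
      rcases hs with hs | ⟨rfl, hs⟩ | hs
      · have := h1 hs
        -- The identity (u - d)(u + d) = 2u(u - d) - (u - d)² gives the sign.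
        nlinarith [sq_nonneg (u - d)]
      · have := h3.mp hs
        subst this
        have := mul_self_pos.mpr (Ne.symm h6)
        linarith
      · have := h2 hs
        nlinarith [sq_nonneg (u + d)]

/-- The three ways of crossing are exclusive: u(u - d) and u(u + d) have sum 2u² ≥ 0, so they are
not both negative, and both vanish when u = 0. -/
lemma near_unique (h : Chords τ v w t c m b) {n : ℤ} {s s' : ℝ} (hs : Near τ v w t c n s)
    (hs' : Near τ v w t c n s') : s = s' := by
  by_cases hA : w n = .A
  · rcases hs with hs | hs | hs
    · exact absurd hA hs.2.2.1
    · rcases hs' with hs' | hs' | hs'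
      · exact absurd hA hs'.2.2.1
      · exact hs.1.trans hs'.1.symm
      · exact absurd hA hs'.2.2.1
    · exact absurd hA hs.2.2.1
  · obtain ⟨u, hu⟩ : ∃ u, u = b (n - 1) - midIntercept m (w n) := ⟨_, rfl⟩
    obtain ⟨d, hd⟩ : ∃ d, d = startIntercept m (w n) - midIntercept m (w n) := ⟨_, rfl⟩
    obtain ⟨h1, h2, h3, -⟩ := h.near_cases hA hu hd (s := s)
    obtain ⟨h1', h2', -⟩ := h.near_cases hA hu hd (s := s')
    rcases hs with hs | ⟨rfl, hs⟩ | hs <;> rcases hs' with hs' | ⟨rfl, hs'⟩ | hs'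
    · exact h.hitsBefore_unique hs hs'
    · have k1 := h1 hs
      rw [h3.mp hs'] at k1
      linarith
    · nlinarith [h1 hs, h2' hs', mul_self_nonneg u]
    · have k1 := h1' hs'
      rw [h3.mp hs] at k1
      linarith
    · rfl
    · have k1 := h2' hs'
      rw [h3.mp hs] at k1
      linarith
    · nlinarith [h2 hs, h1' hs', mul_self_nonneg u]
    · have k1 := h2 hs
      rw [h3.mp hs'] at k1
      linarith
    · exact h.hitsAfter_unique hs hs'

lemma near_bounds (h : Chords τ v w t c m b) {n : ℤ} {s : ℝ} (hs : Near τ v w t c n s) :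
    t (n - 1) < s ∧ s < t (n + 1) := by
  have h1 := h.time_lt n
  have h2 := h.time_pred_lt n
  rcases hs with hs | ⟨rfl, -⟩ | hs
  · obtain ⟨k1, k2, -⟩ := hs
    rw [sub_add_cancel] at k2
    exact ⟨k1, k2.trans h1⟩
  · exact ⟨h2, h1⟩
  · exact ⟨h2.trans hs.1, hs.2.1⟩

/-- A crossing near the n-th side happens between `t (n - 1)` and `t (n + 1)`. So the order can only
be in doubt for consecutive indices and two hits in their common chord, which is the case settled by
`hits_order`. -/
lemma near_lt (h : Chords τ v w t c m b) {n k : ℤ} {s s' : ℝ} (hs : Near τ v w t c n s)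
    (hs' : Near τ v w t c k s') (hnk : n < k) : s < s' := by
  obtain ⟨-, k1⟩ := h.near_bounds hs
  obtain ⟨k2, -⟩ := h.near_bounds hs'
  rcases (show n + 1 ≤ k from hnk).lt_or_eq with hk | rfl
  · exact (k1.trans_le (h.mono.monotone (by omega))).trans k2
  · rw [add_sub_cancel_right] at k2
    rcases hs with hs | ⟨rfl, -⟩ | hs
    · have := hs.2.1
      rw [sub_add_cancel] at this
      exact this.trans k2
    · exact k2
    · rcases hs' with hs' | ⟨rfl, -⟩ | hs'
      · rw [add_sub_cancel_right] at hs'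
        exact h.hits_order hs hs'
      · exact k1
      · exact k1.trans hs'.1

/-- The derived sequence is the cutting sequence of the image under `Ψ_γ`. -/
lemma isCuttingSequenceOf_derived (h : Chords τ v w t c m b) {w' : Word}
    (hw : IsDerivedSequence w w') : IsCuttingSequenceOf (fun s => psiGamma (τ s)) w' := by
  obtain ⟨e, he, hr, hw⟩ := hw
  have hsand : ∀ n, IsSandwiched w (e n) := fun n => by
    have : e n ∈ {n | IsSandwiched w n} := hr ▸ Set.mem_range_self n
    exact this
  choose s hs using fun n => (h.isSandwiched_iff (e n)).mp (hsand n)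
  refine ⟨s, fun i j hij => h.near_lt (hs i) (hs j) (he hij), ?_, fun n => ?_⟩
  · ext x
    constructor
    · rintro ⟨n, rfl⟩
      exact ⟨_, h.onSide_of_near (hs n)⟩
    · rintro ⟨L, hL⟩
      obtain ⟨n, hn⟩ := h.exists_near hL
      have : n ∈ Set.range e := by
        rw [hr]
        exact (h.isSandwiched_iff n).mpr ⟨x, hn⟩
      obtain ⟨i, rfl⟩ := this
      exact ⟨i, h.near_unique (hs i) hn⟩
  · rw [hw n]
    exact h.onSide_of_near (hs n)

end Chords

/-- `v` has direction in `[0, π / 8]`. -/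
def InClosedSectorZero (v : Plane) : Prop := v ≠ 0 ∧ 0 ≤ v 1 ∧ 2 * apothem * v 1 ≤ v 0

lemma InClosedSectorZero.pos {v : Plane} (h : InClosedSectorZero v) : 0 < v 0 := by
  obtain ⟨h0, h1, h2⟩ := h
  have h3 := one_lt_apothem
  have h4 : 0 ≤ 2 * apothem * v 1 := by positivity
  refine lt_of_le_of_ne (h4.trans h2) fun e => h0 ?_
  rw [← e] at h2
  have h5 : v 1 = 0 := by
    by_contra hc
    have : 0 < v 1 := lt_of_le_of_ne h1 (Ne.symm hc)
    have : 0 < 2 * apothem * v 1 := by positivity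
    linarith
  ext m; fin_cases m
  exacts [e.symm, h5]

lemma InClosedSectorZero.isSlope {v : Plane} (h : InClosedSectorZero v) : IsSlope (v 1 / v 0) := by
  have hp := h.pos
  obtain ⟨h0, h1, h2⟩ := h
  have h3 := one_lt_apothem
  have ha := apothem_eq
  have hsq := apothem_sq
  have hm : apothem * (v 1 / v 0) ≤ 1 / 2 := by
    rw [mul_div_assoc', div_le_iff₀ hp]
    linarith
  refine ⟨div_nonneg h1 hp.le, hm, ?_⟩
  -- As 4 * (apothem - 1) * apothem = 1, the bounds 1 / (2 * apothem) and 2 * apothem - 2 are the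
  -- same number tan (π / 8).
  have := mul_le_mul_of_nonneg_left hm (show 0 ≤ 4 * (apothem - 1) by linarith)
  have e : 4 * (apothem - 1) * (apothem * (v 1 / v 0)) = v 1 / v 0 := by
    have : 4 * (apothem - 1) * apothem = 1 := by linarith
    rw [← mul_assoc, this, one_mul]
  linarith

/-- The normals of the four chosen sides have nonnegative product with v, so those of the opposite
sides cannot have a positive one. -/
lemma InClosedSectorZero.eq_sideIndex {v : Plane} (h : InClosedSectorZero v) (i : Fin 8)
    (hi : 0 < normal i ⬝ᵥ v) : i = sideIndex (label i) := by
  have hp := h.pos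
  obtain ⟨h0, h1, h2⟩ := h
  have h3 := one_lt_apothem
  have h5 := sqrt_two_pos
  have h4 : v 1 ≤ v 0 := by nlinarith
  have nonneg : ∀ L, 0 ≤ normal (sideIndex L) ⬝ᵥ v := by
    intro L
    cases L <;> simp only [sideIndex, normal, dotProduct, Fin.sum_univ_two, Matrix.cons_val,
      Matrix.cons_val_zero, Matrix.cons_val_one] <;> nlinarith
  rcases sideIndex_cases i with h | h
  · exact h
  · rw [h, normal_add_four, neg_dotProduct] at hi
    linarith [nonneg (label i)]

lemma exists_chords {τ : ℝ → Surface} {v : Plane} {w : Word} (hτ : IsTrajectory τ v)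
    (hv : InClosedSectorZero v) (hw : IsCuttingSequenceOf τ w) :
    ∃ t c m b, Chords τ v w t c m b := by
  obtain ⟨t, ht, hr, hw⟩ := hw
  obtain ⟨c, hc⟩ := exists_unfolding hτ ht hr hw hv.eq_sideIndex
  have hc' : ∀ n, LineEq (sideIndex (w n)) (c (n - 1) + t n • v) ∧
      0 < normal (sideIndex (w n)) ⬝ᵥ v ∧ c n = c (n - 1) - shift (w n) := fun n => by
    simpa using (hc (n - 1)).2
  exact ⟨t, c, v 1 / v 0, fun n => c n 1 - v 1 / v 0 * c n 0,
    { traj := hτ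
      slope := hv.isSlope
      pos := hv.pos
      vel := (div_mul_cancel₀ _ hv.pos.ne').symm
      mono := ht
      follows := fun n => (hc n).1
      exit := fun n => (hc' n).1
      transversal := fun n => (hc' n).2.1
      step := fun n => (hc' n).2.2
      intercept := fun _ => rfl
      between := fun _ _ h1 h2 => not_onSide_between ht hr h1 h2
      cover := exists_chord_of_time hτ ht hr }⟩

/-! ### Existence of the derived sequence -/

/-- A set of integers unbounded in both directions is a locally finite order without ends, hence
isomorphic to ℤ. -/
lemma exists_strictMono_range {S : Set ℤ} (h1 : ∀ n, ∃ k ∈ S, n < k) (h2 : ∀ n, ∃ k ∈ S, k < n) :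
    ∃ e : ℤ → ℤ, StrictMono e ∧ Set.range e = S := by
  classical
  have : Nonempty S := by
    obtain ⟨k, hk, -⟩ := h1 0
    exact ⟨⟨k, hk⟩⟩
  have : NoMaxOrder S := ⟨fun a => by
    obtain ⟨k, hk, h⟩ := h1 a
    exact ⟨⟨k, hk⟩, h⟩⟩
  have : NoMinOrder S := ⟨fun a => by
    obtain ⟨k, hk, h⟩ := h2 a
    exact ⟨⟨k, hk⟩, h⟩⟩
  let : SuccOrder S := LinearLocallyFiniteOrder.succOrder S
  let : PredOrder S := LinearLocallyFiniteOrder.predOrder S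
  let f : S ≃o ℤ := orderIsoIntOfLinearSuccPredArch
  refine ⟨fun n => (f.symm n : ℤ), fun a b hab => f.symm.strictMono hab, ?_⟩
  ext x
  constructor
  · rintro ⟨n, rfl⟩
    exact (f.symm n).2
  · intro hx
    exact ⟨f ⟨x, hx⟩, by simp⟩

/-- In a run of letters none of which is sandwiched, A does not occur since its neighbours are both
D. Away from the ends of the run D does not occur either, since both its neighbours would be B, and
then B does not, since both its neighbours would be C. Each exclusion costs at most one position at
each end, so seven letters leave three consecutive C, the middle one being sandwiched. -/
lemma exists_isSandwiched {x : Word} (h : ∀ n, diagramZero (x n) (x (n + 1))) (n : ℤ) :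
    ∃ j, n - 3 ≤ j ∧ j ≤ n + 3 ∧ IsSandwiched x j := by
  have h' : ∀ n, diagramZero (x (n - 1)) (x n) := fun n => by simpa using h (n - 1)
  have stepA : ∀ j, ¬ IsSandwiched x j → x j ≠ .A := by
    intro j hj hx
    have e1 := h' j
    have e2 := h j
    rw [hx] at e1 e2
    apply hj
    unfold IsSandwiched
    cases hl : x (j - 1) <;> cases hr : x (j + 1) <;> rw [hl] at e1 <;> rw [hr] at e2 <;> first
      | rfl
      | exact absurd e1 id
      | exact absurd e2 id
  have stepD : ∀ j, ¬ IsSandwiched x (j - 1) → ¬ IsSandwiched x j → ¬ IsSandwiched x (j + 1) →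
      x j ≠ .D := by
    intro j h1 h2 h3 hx
    have e1 := h' j
    have e2 := h j
    have e3 := stepA _ h1
    have e4 := stepA _ h3
    rw [hx] at e1 e2
    apply h2
    unfold IsSandwiched
    cases hl : x (j - 1) <;> cases hr : x (j + 1) <;> rw [hl] at e1 <;> rw [hr] at e2 <;> first
      | rfl
      | exact absurd e1 id
      | exact absurd e2 id
      | exact absurd hl e3
      | exact absurd hr e4
  by_contra! hc
  have ns : ∀ j, n - 3 ≤ j → j ≤ n + 3 → ¬ IsSandwiched x j := hc
  have nA : ∀ j, n - 3 ≤ j → j ≤ n + 3 → x j ≠ .A := fun j h1 h2 => stepA j (ns j h1 h2)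
  have nD : ∀ j, n - 2 ≤ j → j ≤ n + 2 → x j ≠ .D := fun j h1 h2 =>
    stepD j (ns _ (by omega) (by omega)) (ns _ (by omega) (by omega)) (ns _ (by omega) (by omega))
  have nB : ∀ j, n - 1 ≤ j → j ≤ n + 1 → x j ≠ .B := by
    intro j h1 h2 hx
    have e1 := h' j
    have e2 := h j
    have e3 := nD (j - 1) (by omega) (by omega)
    have e4 := nD (j + 1) (by omega) (by omega)
    rw [hx] at e1 e2
    apply ns j (by omega) (by omega)
    unfold IsSandwiched
    cases hl : x (j - 1) <;> cases hr : x (j + 1) <;> rw [hl] at e1 <;> rw [hr] at e2 <;> first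
      | rfl
      | exact absurd e1 id
      | exact absurd e2 id
      | exact absurd hl e3
      | exact absurd hr e4
  have isC : ∀ j, n - 1 ≤ j → j ≤ n + 1 → x j = .C := by
    intro j h1 h2
    have e1 := nA j (by omega) (by omega)
    have e2 := nB j h1 h2
    have e3 := nD j (by omega) (by omega)
    cases hx : x j
    exacts [absurd hx e1, absurd hx e2, rfl, absurd hx e3]
  exact ns n (by omega) (by omega) ((isC _ (by omega) (by omega)).trans
    (isC _ (by omega) (by omega)).symm)

lemma labelPerm_bijective (k : Fin 8) : Function.Bijective (labelPerm k) := by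
  constructor
  · intro L L' h
    fin_cases k <;> cases L <;> cases L' <;> first
      | rfl
      | exact Letter.noConfusion h
  · intro L
    fin_cases k <;> cases L <;> first
      | exact ⟨.A, rfl⟩
      | exact ⟨.B, rfl⟩
      | exact ⟨.C, rfl⟩
      | exact ⟨.D, rfl⟩

lemma isSandwiched_map_iff {f : Letter → Letter} (hf : Function.Injective f) (w : Word) (n : ℤ) :
    IsSandwiched (fun n => f (w n)) n ↔ IsSandwiched w n := hf.eq_iff

lemma IsDerivedSequence.map {f : Letter → Letter} (hf : Function.Injective f) {w w' : Word}
    (h : IsDerivedSequence w w') :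
    IsDerivedSequence (fun n => f (w n)) (fun n => f (w' n)) := by
  obtain ⟨e, he, hr, hw⟩ := h
  refine ⟨e, he, ?_, fun n => congrArg f (hw n)⟩
  simp only [isSandwiched_map_iff hf]
  exact hr

lemma Admissible.exists_derived {w : Word} (h : Admissible w) : ∃ w', IsDerivedSequence w w' := by
  obtain ⟨k, hk⟩ := h
  have key : ∀ n, ∃ j, n - 3 ≤ j ∧ j ≤ n + 3 ∧ IsSandwiched w j := fun n => by
    obtain ⟨j, h1, h2, h3⟩ := exists_isSandwiched (x := fun n => labelPerm k (w n)) hk n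
    exact ⟨j, h1, h2, (isSandwiched_map_iff (labelPerm_bijective k).1 w j).mp h3⟩
  obtain ⟨e, he, hr⟩ := exists_strictMono_range (S := {n | IsSandwiched w n})
    (fun n => by
      obtain ⟨j, h1, h2, h3⟩ := key (n + 4)
      exact ⟨j, h3, by omega⟩)
    (fun n => by
      obtain ⟨j, h1, h2, h3⟩ := key (n - 4)
      exact ⟨j, h3, by omega⟩)
  exact ⟨fun n => w (e n), e, he, hr, fun _ => rfl⟩

/-! ### The action of the isometries -/

lemma normal_injective : Function.Injective normal := by
  intro i j h
  have h0 := congrFun h 0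
  have h1 := congrFun h 1
  have h2 := sqrt_two_pos
  have h3 : √2 < (2 : ℝ) := by nlinarith [sqrt_two_sq]
  fin_cases i <;> fin_cases j <;> first
    | rfl
    | (exfalso
       simp only [normal, Fin.zero_eta, Fin.mk_one, Fin.reduceFinMk, Matrix.cons_val,
         Matrix.cons_val_zero, Matrix.cons_val_one] at h0 h1
       linarith)

section Isometry

variable {M : Matrix (Fin 2) (Fin 2) ℝ}

lemma isometryMap_toSurface (h : IsOctagonIsometry M) {p : Plane} (hp : p ∈ octagon) :
    isometryMap h (toSurface p hp) = toSurface (M.mulVec p) (h.mem hp) := rfl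

lemma isometryMap_transpose_isometryMap (h : IsOctagonIsometry M) (x : Surface) :
    isometryMap h.transpose (isometryMap h x) = x := by
  obtain ⟨p, hp, rfl⟩ := exists_rep x
  rw [isometryMap_toSurface, isometryMap_toSurface]
  exact toSurface_eq_of_eq _ _ (by rw [Matrix.mulVec_mulVec, h.1.1, Matrix.one_mulVec])

lemma IsOctagonIsometry.mem_side (h : IsOctagonIsometry M) {i j : Fin 8} {p : Plane}
    (hij : M.mulVec (normal i) = normal j) (hp : p ∈ side i) : M.mulVec p ∈ side j := by
  refine ⟨h.mem hp.1, ?_⟩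
  rw [← hij, dot_mulVec, Matrix.mulVec_mulVec, h.1.1, Matrix.one_mulVec]
  exact hp.2

lemma IsSingular.isometryMap (h : IsOctagonIsometry M) {x : Surface} (hx : IsSingular x) :
    IsSingular (isometryMap h x) := by
  obtain ⟨p, hp, ⟨i, j, hij, hi, hj⟩, rfl⟩ := hx
  obtain ⟨i', hi'⟩ := h.2.1 i
  obtain ⟨j', hj'⟩ := h.2.1 j
  refine ⟨M.mulVec p, h.mem hp, ⟨i', j', ?_, h.mem_side hi' hi, h.mem_side hj' hj⟩, rfl⟩
  rintro rfl
  refine hij (normal_injective ?_)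
  have := congrArg M.transpose.mulVec (hi'.trans hj'.symm)
  simpa only [Matrix.mulVec_mulVec, h.1.1, Matrix.one_mulVec] using this

lemma IsTrajectory.isometryMap (h : IsOctagonIsometry M) {τ : ℝ → Surface} {v : Plane}
    (hτ : IsTrajectory τ v) :
    IsTrajectory (fun t => OctagonCutting.isometryMap h (τ t)) (M.mulVec v) := by
  constructor
  · intro h0
    apply hτ.1
    rw [← Matrix.one_mulVec v, ← h.1.1, ← Matrix.mulVec_mulVec, h0, Matrix.mulVec_zero]
  · intro t
    obtain ⟨hs, p, q, ε, hε, hf, hb⟩ := hτ.2 t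
    refine ⟨fun hs' => hs ?_, M.mulVec p, M.mulVec q, ε, hε, fun s h0 h1 => ?_, fun s h0 h1 => ?_⟩
    · have := hs'.isometryMap h.transpose
      rwa [isometryMap_transpose_isometryMap] at this
    · obtain ⟨hm, he⟩ := hf s h0 h1
      have e : M.mulVec (p + s • v) = M.mulVec p + s • M.mulVec v := by
        rw [Matrix.mulVec_add, Matrix.mulVec_smul]
      exact ⟨e ▸ h.mem hm, by
        dsimp only; rw [he, isometryMap_toSurface]; exact toSurface_eq_of_eq _ _ e⟩
    · obtain ⟨hm, he⟩ := hb s h0 h1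
      have e : M.mulVec (q - s • v) = M.mulVec q - s • M.mulVec v := by
        rw [Matrix.mulVec_sub, Matrix.mulVec_smul]
      exact ⟨e ▸ h.mem hm, by
        dsimp only; rw [he, isometryMap_toSurface]; exact toSurface_eq_of_eq _ _ e⟩

lemma OnSide.isometryMap (h : IsOctagonIsometry M) {f : Letter → Letter}
    (hf : ∀ i, ∃ j, M.mulVec (normal i) = normal j ∧ label j = f (label i)) {L : Letter}
    {x : Surface} (hx : OnSide L x) : OnSide (f L) (isometryMap h x) := by
  obtain ⟨i, p, hp, rfl, hi, rfl⟩ := hx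
  obtain ⟨j, hj, hl⟩ := hf i
  exact ⟨j, M.mulVec p, h.mem hp, hl, h.mem_side hj hi, rfl⟩

lemma onSide_isometryMap_iff (h : IsOctagonIsometry M) {f : Letter → Letter}
    (hinj : Function.Injective f)
    (hf : ∀ i, ∃ j, M.mulVec (normal i) = normal j ∧ label j = f (label i)) (L : Letter)
    (x : Surface) : OnSide (f L) (isometryMap h x) ↔ OnSide L x := by
  refine ⟨fun hx => ?_, OnSide.isometryMap h hf⟩
  obtain ⟨i, p, hp, hL, hi, he⟩ := hx
  obtain ⟨j, hj⟩ := h.2.2 i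
  obtain ⟨i', hi', hl⟩ := hf j
  have hii : i' = i := by
    apply normal_injective
    rw [← hi', ← hj, Matrix.mulVec_mulVec, h.1.2, Matrix.one_mulVec]
  subst hii
  have hLj : label j = L := hinj (hl.symm.trans hL)
  refine ⟨j, M.transpose.mulVec p, h.transpose.mem hp, hLj, h.transpose.mem_side hj hi, ?_⟩
  rw [← isometryMap_transpose_isometryMap h x, he, isometryMap_toSurface]

end Isometry

lemma isCuttingSequenceOf_map_iff {g : Surface → Surface} {f : Letter → Letter}
    (hf : Function.Surjective f) (hg : ∀ L x, OnSide (f L) (g x) ↔ OnSide L x)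
    (τ : ℝ → Surface) (w : Word) :
    IsCuttingSequenceOf (fun t => g (τ t)) (fun n => f (w n)) ↔ IsCuttingSequenceOf τ w := by
  have : ∀ s, (∃ L, OnSide L (g (τ s))) ↔ ∃ L, OnSide L (τ s) := fun s => by
    rw [hf.exists]
    simp only [hg]
  simp only [IsCuttingSequenceOf, hg, this]

/-- `νₖ` maps the side `i` to the side `nuIndex k i`. -/
def nuIndex (k i : Fin 8) : Fin 8 :=
  (![i, 3 - i, i + 1, 2 - i, i + 2, 1 - i, i + 3, -i] : Fin 8 → Fin 8) k

lemma label_nuIndex (k i : Fin 8) : label (nuIndex k i) = labelPerm k (label i) := by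
  fin_cases k <;> fin_cases i <;> simp [label, labelPerm, nuIndex]

lemma nuMatrix_normal (k i : Fin 8) : (nuMatrix k).mulVec (normal i) = normal (nuIndex k i) := by
  have e : √2 / 2 * (√2 / 2) = (1 : ℝ) / 2 := by linear_combination (1 / 4) * sqrt_two_sq
  fin_cases k <;> fin_cases i <;> ext m <;> fin_cases m <;>
    simp [nuIndex, nuMatrix, normal, Matrix.mulVec, dotProduct, Fin.sum_univ_two, e] <;> norm_num

lemma onSide_nu_iff (k : Fin 8) (L : Letter) (x : Surface) :
    OnSide (labelPerm k L) (nu k x) ↔ OnSide L x :=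
  onSide_isometryMap_iff (nuMatrix_isometry k) (labelPerm_bijective k).1
    (fun i => ⟨_, nuMatrix_normal k i, label_nuIndex k i⟩) L x

lemma neg_normal (i : Fin 8) : (-1 : Matrix (Fin 2) (Fin 2) ℝ).mulVec (normal i) = normal (i + 4) := by
  rw [normal_add_four, Matrix.neg_mulVec, Matrix.one_mulVec]

lemma neg_one_isometry : IsOctagonIsometry (-1) := by
  refine ⟨by simp, fun i => ⟨i + 4, neg_normal i⟩, fun i => ⟨i + 4, ?_⟩⟩
  rw [Matrix.transpose_neg, Matrix.transpose_one, neg_normal]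

/-- The central symmetry exchanges opposite sides, which share a label. -/
lemma onSide_neg_iff (L : Letter) (x : Surface) :
    OnSide L (isometryMap neg_one_isometry x) ↔ OnSide L x :=
  onSide_isometryMap_iff neg_one_isometry (f := id) Function.injective_id
    (fun i => ⟨i + 4, neg_normal i, by fin_cases i <;> rfl⟩) L x

/-! ### Directions -/

/-- `v` is a positive real multiple of the unit vector making an angle `θ` with the horizontal. -/
def HasRealDirection (v : Plane) (θ : ℝ) : Prop :=
  ∃ r : ℝ, 0 < r ∧ v = r • ![Real.cos θ, Real.sin θ]

/-- In `HasDirection` the factor r has no type ascription and is a natural number; the arguments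
below allow every positive real factor. -/
lemma HasDirection.hasRealDirection {v : Plane} {θ : ℝ} (h : HasDirection v θ) :
    HasRealDirection v θ := by
  obtain ⟨r, hr, rfl⟩ := h
  exact ⟨r, Nat.cast_pos.mpr hr, (Nat.cast_smul_eq_nsmul ℝ r _).symm⟩

/-- This is cot (π / 8) = 1 + √2, obtained from the double angle formulas at π / 4 after
multiplication by 2 sin (π / 8). -/
lemma cos_pi_div_eight : Real.cos (Real.pi / 8) = 2 * apothem * Real.sin (Real.pi / 8) := by
  have hs : 0 < Real.sin (Real.pi / 8) :=
    Real.sin_pos_of_pos_of_lt_pi (by positivity) (by linarith [Real.pi_pos])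
  have h1 := Real.sin_two_mul (Real.pi / 8)
  have h2 := Real.cos_two_mul (Real.pi / 8)
  have h3 := Real.sin_sq_add_cos_sq (Real.pi / 8)
  rw [show 2 * (Real.pi / 8) = Real.pi / 4 by ring] at h1 h2
  rw [Real.sin_pi_div_four] at h1
  rw [Real.cos_pi_div_four] at h2
  refine mul_left_cancel₀ (mul_pos two_pos hs).ne' ?_
  unfold apothem
  set s := Real.sin (Real.pi / 8)
  set c := Real.cos (Real.pi / 8)
  have h4 : 2 * s ^ 2 = 1 - √2 / 2 := by linarith
  have h5 : √2 ^ 2 = (2 : ℝ) := by rw [sq]; exact sqrt_two_sq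
  linear_combination (-1 : ℝ) * h1 - (1 + √2) * h4 + (1 / 2) * h5

lemma inClosedSectorZero_of_angle {φ r : ℝ} (hr : 0 < r) (h0 : 0 ≤ φ) (h1 : φ ≤ Real.pi / 8) :
    InClosedSectorZero (r • ![Real.cos φ, Real.sin φ]) := by
  have hpi := Real.pi_pos
  have hc : 0 < Real.cos φ := Real.cos_pos_of_mem_Ioo ⟨by linarith, by linarith⟩
  have hs : 0 ≤ Real.sin φ := Real.sin_nonneg_of_nonneg_of_le_pi h0 (by linarith)
  have h2 : 0 ≤ Real.sin (Real.pi / 8 - φ) :=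
    Real.sin_nonneg_of_nonneg_of_le_pi (by linarith) (by linarith)
  have hs8 : 0 < Real.sin (Real.pi / 8) :=
    Real.sin_pos_of_pos_of_lt_pi (by positivity) (by linarith)
  -- The left factor sin (π / 8) comes out of the expansion of sin (π / 8 - φ) ≥ 0, leaving the
  -- linear inequality which defines the sector.
  rw [Real.sin_sub, cos_pi_div_eight] at h2
  have h3 : 2 * apothem * Real.sin φ ≤ Real.cos φ := by
    refine le_of_mul_le_mul_left ?_ hs8
    linarith
  refine ⟨fun h => ?_, ?_, ?_⟩
  · have := congrFun h 0
    simp only [Pi.smul_apply, Matrix.cons_val_zero, smul_eq_mul, Pi.zero_apply] at this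
    exact (mul_pos hr hc).ne' this
  · simp only [Pi.smul_apply, Matrix.cons_val_one, smul_eq_mul]
    positivity
  · simp only [Pi.smul_apply, Matrix.cons_val_zero, Matrix.cons_val_one, smul_eq_mul]
    nlinarith

lemma nuMatrix_mulVec_inClosedSectorZero {k : Fin 8} {θ : ℝ} {v : Plane} (hθ : θ ∈ sector k)
    (hv : HasRealDirection v θ) : InClosedSectorZero ((nuMatrix k).mulVec v) := by
  obtain ⟨r, hr, rfl⟩ := hv
  rw [Matrix.mulVec_smul]
  have c3 : Real.cos (3 * Real.pi / 4) = -(√2 / 2) := by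
    rw [show 3 * Real.pi / 4 = Real.pi - Real.pi / 4 by ring, Real.cos_pi_sub,
      Real.cos_pi_div_four]
  have s3 : Real.sin (3 * Real.pi / 4) = √2 / 2 := by
    rw [show 3 * Real.pi / 4 = Real.pi - Real.pi / 4 by ring, Real.sin_pi_sub,
      Real.sin_pi_div_four]
  have key : ∀ φ, (nuMatrix k).mulVec ![Real.cos θ, Real.sin θ] = ![Real.cos φ, Real.sin φ] →
      0 ≤ φ → φ ≤ Real.pi / 8 →
      InClosedSectorZero (r • (nuMatrix k).mulVec ![Real.cos θ, Real.sin θ]) := by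
    intro φ e h0 h1
    rw [e]
    exact inClosedSectorZero_of_angle hr h0 h1
  have hsec : (k.val : ℝ) * Real.pi / 8 ≤ θ ∧ θ ≤ ((k.val : ℝ) + 1) * Real.pi / 8 := by
    unfold sector at hθ
    split_ifs at hθ with hk
    · subst hk
      rw [show ((7 : Fin 8).val : ℝ) = 7 from by norm_num]
      exact ⟨hθ.1, hθ.2.trans_eq (by ring)⟩
    · exact ⟨hθ.1, hθ.2.le⟩
  clear hθ
  -- For even k the matrix is the rotation by -kπ/8; for odd k it is the reflection sending the
  -- angle θ to (k + 1)π/8 - θ.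
  refine key ((![θ, Real.pi / 4 - θ, θ - Real.pi / 4, Real.pi / 2 - θ, θ - Real.pi / 2,
    3 * Real.pi / 4 - θ, θ - 3 * Real.pi / 4, Real.pi - θ] : Fin 8 → ℝ) k) ?_ ?_ ?_
  · fin_cases k <;> ext m <;> fin_cases m <;>
      simp [nuMatrix, Matrix.mulVec, dotProduct, Fin.sum_univ_two, Real.cos_sub, Real.sin_sub, c3,
        s3, Real.cos_pi_div_four, Real.sin_pi_div_four] <;> ring
  · fin_cases k <;> simp at hsec ⊢ <;> linarith
  · fin_cases k <;> simp at hsec ⊢ <;> linarith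

/-- The eight sectors cover [0, π], which is the range of the argument on the closed upper half
plane. -/
lemma exists_hasRealDirection {v : Plane} (h0 : v ≠ 0) (h1 : 0 ≤ v 1) :
    ∃ k θ, θ ∈ sector k ∧ HasRealDirection v θ := by
  have hz : (⟨v 0, v 1⟩ : ℂ) ≠ 0 := by
    intro h
    apply h0
    ext m; fin_cases m
    exacts [congrArg Complex.re h, congrArg Complex.im h]
  set z : ℂ := ⟨v 0, v 1⟩ with hzdef
  have hdir : HasRealDirection v z.arg := by
    refine ⟨‖z‖, norm_pos_iff.mpr hz, ?_⟩
    ext m; fin_cases m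
    · exact (Complex.norm_mul_cos_arg z).symm
    · exact (Complex.norm_mul_sin_arg z).symm
  have hlo : 0 ≤ z.arg := Complex.arg_nonneg_iff.mpr h1
  have hhi : z.arg ≤ Real.pi := Complex.arg_le_pi z
  suffices ∃ k, z.arg ∈ sector k from this.imp fun k hk => ⟨_, hk, hdir⟩
  generalize z.arg = θ at hlo hhi
  have mem : ∀ k : Fin 8, k ≠ 7 → (k.val : ℝ) * Real.pi / 8 ≤ θ →
      θ < ((k.val : ℝ) + 1) * Real.pi / 8 → ∃ k, θ ∈ sector k := fun k hk h1 h2 =>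
    ⟨k, by rw [sector, if_neg hk]; exact ⟨h1, h2⟩⟩
  rcases lt_or_ge θ (1 * Real.pi / 8) with a1 | a1
  · exact mem 0 (by decide) (by simpa using hlo) (by simpa using a1)
  rcases lt_or_ge θ (2 * Real.pi / 8) with a2 | a2
  · exact mem 1 (by decide) (by simpa using a1) (by norm_num; exact a2)
  rcases lt_or_ge θ (3 * Real.pi / 8) with a3 | a3
  · exact mem 2 (by decide) (by simpa using a2) (by norm_num; exact a3)
  rcases lt_or_ge θ (4 * Real.pi / 8) with a4 | a4
  · exact mem 3 (by decide) (by simpa using a3) (by norm_num; exact a4)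
  rcases lt_or_ge θ (5 * Real.pi / 8) with a5 | a5
  · exact mem 4 (by decide) (by simpa using a4) (by norm_num; exact a5)
  rcases lt_or_ge θ (6 * Real.pi / 8) with a6 | a6
  · exact mem 5 (by decide) (by simpa using a5) (by norm_num; exact a6)
  rcases lt_or_ge θ (7 * Real.pi / 8) with a7 | a7
  · exact mem 6 (by decide) (by simpa using a6) (by norm_num; exact a7)
  · exact ⟨7, by rw [sector, if_pos rfl]; exact ⟨a7, hhi⟩⟩

/-! ### Derivation and renormalization -/

section Sector

variable {k : Fin 8} {θ : ℝ} {τ : ℝ → Surface} {v : Plane}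

lemma isTrajectory_renormalized (k : Fin 8) (hτ : IsTrajectory τ v) :
    IsTrajectory (fun t => (nu k).symm (psiGamma (nu k (τ t))))
      (((nuMatrix k)⁻¹ * gammaMatrix * nuMatrix k).mulVec v) := by
  have h := nuMatrix_isometry k
  -- The inverse of the orthogonal matrix is its transpose, which is the matrix defining the inverse
  -- of `nu k`.
  rw [Matrix.inv_eq_left_inv h.1.1, ← Matrix.mulVec_mulVec, ← Matrix.mulVec_mulVec]
  exact ((hτ.isometryMap h).psiGamma).isometryMap h.transpose

lemma exists_chords_of_sector (hθ : θ ∈ sector k) (hv : HasRealDirection v θ) (hτ : IsTrajectory τ v)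
    {w : Word} (hw : IsCuttingSequenceOf τ w) :
    ∃ t c m b, Chords (fun t => nu k (τ t)) ((nuMatrix k).mulVec v)
      (fun n => labelPerm k (w n)) t c m b :=
  exists_chords (hτ.isometryMap (nuMatrix_isometry k)) (nuMatrix_mulVec_inClosedSectorZero hθ hv)
    ((isCuttingSequenceOf_map_iff (labelPerm_bijective k).2 (onSide_nu_iff k) τ w).mpr hw)

lemma admissible_of_sector (hθ : θ ∈ sector k) (hv : HasRealDirection v θ) (hτ : IsTrajectory τ v)
    {w : Word} (hw : IsCuttingSequenceOf τ w) : Admissible w := by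
  obtain ⟨t, c, m, b, h⟩ := exists_chords_of_sector hθ hv hτ hw
  exact ⟨k, h.diagram⟩

lemma isCuttingSequenceOf_renormalized (hθ : θ ∈ sector k) (hv : HasRealDirection v θ)
    (hτ : IsTrajectory τ v) {w w' : Word} (hw : IsCuttingSequenceOf τ w)
    (hw' : IsDerivedSequence w w') :
    IsCuttingSequenceOf (fun t => (nu k).symm (psiGamma (nu k (τ t)))) w' := by
  obtain ⟨t, c, m, b, h⟩ := exists_chords_of_sector hθ hv hτ hw
  have := h.isCuttingSequenceOf_derived (hw'.map (labelPerm_bijective k).1)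
  rw [← isCuttingSequenceOf_map_iff (labelPerm_bijective k).2 (onSide_nu_iff k)]
  simpa using this

end Sector

/-- The sectors only cover upward directions. A downward trajectory is replaced by its image under
the central symmetry, which has the same cutting sequence. -/
lemma IsCuttingSequence.exists_sector {w : Word} (hw : IsCuttingSequence w) :
    ∃ τ v k θ, IsTrajectory τ v ∧ IsCuttingSequenceOf τ w ∧ θ ∈ sector k ∧ HasRealDirection v θ := by
  obtain ⟨τ, v, hτ, hc⟩ := hw
  rcases le_total 0 (v 1) with h | h
  · obtain ⟨k, θ, h1, h2⟩ := exists_hasRealDirection hτ.1 h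
    exact ⟨τ, v, k, θ, hτ, hc, h1, h2⟩
  · have hτ' := hτ.isometryMap neg_one_isometry
    obtain ⟨k, θ, h1, h2⟩ := exists_hasRealDirection hτ'.1 (by
      rw [Matrix.neg_mulVec, Matrix.one_mulVec]
      simpa using h)
    exact ⟨_, _, k, θ, hτ', (isCuttingSequenceOf_map_iff (f := id) Function.surjective_id
      onSide_neg_iff τ w).mpr hc, h1, h2⟩

lemma IsCuttingSequence.admissible {w : Word} (hw : IsCuttingSequence w) : Admissible w := by
  obtain ⟨τ, v, k, θ, hτ, hc, hθ, hv⟩ := hw.exists_sector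
  exact admissible_of_sector hθ hv hτ hc

lemma IsCuttingSequence.derived {w w' : Word} (hw : IsCuttingSequence w)
    (hw' : IsDerivedSequence w w') : IsCuttingSequence w' := by
  obtain ⟨τ, v, k, θ, hτ, hc, hθ, hv⟩ := hw.exists_sector
  exact ⟨_, _, isTrajectory_renormalized k hτ, isCuttingSequenceOf_renormalized hθ hv hτ hc hw'⟩

/-- Derivation maps the set of cutting sequences to itself and all its elements are admissible, so
it can be iterated inside this set. -/
lemma IsCuttingSequence.infinitelyDerivable {w : Word} (hw : IsCuttingSequence w) :
    InfinitelyDerivable w := by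
  choose d hd using fun x : {w // IsCuttingSequence w} => x.2.admissible.exists_derived
  let next : {w // IsCuttingSequence w} → {w // IsCuttingSequence w} :=
    fun x => ⟨d x, x.2.derived (hd x)⟩
  let u : ℕ → {w // IsCuttingSequence w} := fun n => next^[n] ⟨w, hw⟩
  have hu : ∀ n, u (n + 1) = next (u n) := fun n => Function.iterate_succ_apply' _ _ _
  have hder : ∀ n, IsDerivedSequence (u n).1 (u (n + 1)).1 := fun n => by
    rw [hu]
    exact hd (u n)
  exact ⟨fun n => (u n).1, rfl, fun n =>
    ⟨hder n, (u n).2.admissible, (u (n + 1)).1, hder n, (u (n + 1)).2.admissible⟩⟩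

end OctagonCutting

end

theorem proposition2p1 :
    -- The derived sequence of a cutting sequence is defined and is again a cutting sequence.
    (∀ w : OctagonCutting.Word, OctagonCutting.IsCuttingSequence w →
      (∃ w', OctagonCutting.IsDerivedSequence w w') ∧
      ∀ w', OctagonCutting.IsDerivedSequence w w' → OctagonCutting.IsCuttingSequence w') ∧
    -- If `τ` has direction in the sector `k`, then `νₖ⁻¹ Ψ_γ νₖ τ` is a bi-infinite linear
    -- trajectory, and the derived sequence of the cutting sequence of `τ` is its cutting sequence.
    (∀ (k : Fin 8) (θ : ℝ) (τ : ℝ → OctagonCutting.Surface) (v : OctagonCutting.Plane),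
      θ ∈ OctagonCutting.sector k → OctagonCutting.HasDirection v θ →
      OctagonCutting.IsTrajectory τ v →
      OctagonCutting.IsTrajectory
        (fun t => (OctagonCutting.nu k).symm
          (OctagonCutting.psiGamma (OctagonCutting.nu k (τ t))))
        (((OctagonCutting.nuMatrix k)⁻¹ * OctagonCutting.gammaMatrix *
          OctagonCutting.nuMatrix k).mulVec v) ∧
      ∀ w : OctagonCutting.Word, OctagonCutting.IsCuttingSequenceOf τ w →
        (∃ w', OctagonCutting.IsDerivedSequence w w') ∧
        ∀ w', OctagonCutting.IsDerivedSequence w w' →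
          OctagonCutting.IsCuttingSequenceOf
            (fun t => (OctagonCutting.nu k).symm
              (OctagonCutting.psiGamma (OctagonCutting.nu k (τ t)))) w') ∧
    -- Every cutting sequence is infinitely derivable.
    (∀ w : OctagonCutting.Word, OctagonCutting.IsCuttingSequence w →
      OctagonCutting.InfinitelyDerivable w) := by
  refine ⟨fun w hw => ⟨hw.admissible.exists_derived, fun w' hw' => hw.derived hw'⟩, ?_,
    fun w hw => hw.infinitelyDerivable⟩
  intro k θ τ v hθ hv hτ
  have hv := hv.hasRealDirection
  exact ⟨OctagonCutting.isTrajectory_renormalized k hτ, fun w hw =>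
    ⟨(OctagonCutting.admissible_of_sector hθ hv hτ hw).exists_derived, fun w' hw' =>
      OctagonCutting.isCuttingSequenceOf_renormalized hθ hv hτ hw hw'⟩⟩
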